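/- Let $S$ be a scheme, $X$ a smooth $S$-scheme and $G$ a smooth group scheme over $S$. **Combinatorial forms.** Let $\Delta^n_{X/S}$ be the functor of infinitesimal $n$-simplices of $X/S$: its $T$-valued points (for an $S$-scheme $T$) are the $(n+1)$-tuples $(x_0,\dots,x_n)$ of $S$-morphisms $T\to X$ which, locally on $T$, are given by ring homomorphisms $x_i: B\to C$ for affine opens $\operatorname{Spec}B\subset X$, $\operatorname{Spec}C\subset T$, such that any two of the $x_i$ are congruent modulo an ideal of square zero, and $(x_i b-x_0 b)(x_j b-x_0 b)=0$ for all $i,j$ and all $b\in B$. For a functor $F$ from $S$-schemes to groups, a combinatorial $n$-form with values in $F$ is a morphism of functors $f:\Delta^n_{X/S}\to F$ with $f(x_0,\dots,x_n)=1$ whenever $x_i=x_{i+1}$ for some $i$. Under pointwise multiplication write $\Psi^n_{X/S}(F)$ for the set of these forms. Let $\underline{\mathrm{Aut}}(G)$ be the functor sending $T$ to the group of automorphisms of the $T$-group scheme $G_T$. For $\Omega\in\Psi^3_{X/S}(G)$ and $\chi\in\Psi^1_{X/S}(\underline{\mathrm{Aut}}(G))$ define $\delta^3_\chi(\Omega)\in\Psi^4_{X/S}(G)$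 by $$\delta^3_\chi(\Omega)(x,y,z,u,v)=\chi(x,y)\bigl(\Omega(y,z,u,v)\bigr)\,\Omega(x,y,u,v)\,\Omega(x,y,z,u)\,\Omega(x,z,u,v)^{-1}\,\Omega(x,y,z,v)^{-1}.$$ **Classical forms.** For affine opens $\operatorname{Spec}R\subset S$ and $\operatorname{Spec}B\subset X$, the latter lying over the former, and an $R$-algebra $A$, let $\mathrm{Lie}(F)(A)=\ker(F(A[\varepsilon])\to F(A))$, where $\varepsilon^2=0$ and $\varepsilon\mapsto 0$. For $Z\in\mathrm{Lie}(F)(A)$, an $R$-algebra homomorphism $A\to C$ and $t\in C$ with $t^2=0$, let $Z(t)\in F(C)$ be the image of $Z$ under $A[\varepsilon]\to C$, $\varepsilon\mapsto t$. For $n\ge 1$, the value of $\omega=c\,db_1\wedge\dots\wedge db_n\in\Omega^n_{B/R}$ at a simplex $x_0,\dots,x_n:B\to C$ of $R$-algebra homomorphisms is $\omega(x_0,\dots,x_n)=x_0(c)\prod_{i=1}^n(x_i(b_i)-x_0(b_i))$, extended additively. A finite sum $\sum_k Z_k\otimes\omega_k$ with $Z_k\in\mathrm{Lie}(F)(B)$,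 $\omega_k\in\Omega^n_{B/R}$ corresponds to the combinatorial form $f$ on the chart if $$f(x_0,\dots,x_n)=\prod_k Z_k\bigl(\omega_k(x_0,\dots,x_n)\bigr)$$ for all such simplices (with values in all $R$-algebras $C$), where $Z_k(\cdot)$ is formed along $x_0:B\to C$. For $Y\in\mathrm{Lie}(\underline{\mathrm{Aut}}(G))(B)$ and $Z\in\mathrm{Lie}(G)(B)$, the bracket $[Y,Z]\in\mathrm{Lie}(G)(B)$ is the element $W$ with $Y(s)\bigl(Z(t)\bigr)\,Z(t)^{-1}=W(st)$ for all $B$-algebras $C$ and all $s,t\in C$ with $s^2=t^2=0$ (algebras over $R$ with an $R$-homomorphism $B\to C$). **Theorem 3.13.** In this situation $\delta^3_\chi(\Omega)=d\Omega+[\chi,\Omega]$ for all $\Omega\in\Psi^3_{X/S}(G)$ and $\chi\in\Psi^1_{X/S}(\underline{\mathrm{Aut}}(G))$. Explicitly: 1. $X$ is covered by opens $\operatorname{Spec}B$ as above, over some $\operatorname{Spec}R\subset S$, on which $\Omega$ corresponds to a finite sum $\sum_j Z_j\otimes\omega_j$ with $Z_j\in\mathrm{Lie}(G)(R)$, $\omega_j\in\Omega^3_{B/R}$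 (each $Z_j$ being viewed in $\mathrm{Lie}(G)(B)$), and $\chi$ corresponds to a finite sum $\sum_i Y_i\otimes\eta_i$ with $Y_i\in\mathrm{Lie}(\underline{\mathrm{Aut}}(G))(B)$, $\eta_i\in\Omega^1_{B/R}$. 2. The bracket $[Y,Z]$ exists and is unique for all $Y\in\mathrm{Lie}(\underline{\mathrm{Aut}}(G))(B)$ and $Z\in\mathrm{Lie}(G)(B)$, for every pair of affine opens as above. 3. For every pair of affine opens as above and every such presentation of $\Omega$ and $\chi$ on it, the form $\delta^3_\chi(\Omega)$ corresponds there to $$d\Omega+[\chi,\Omega]=\sum_j Z_j\otimes d\omega_j+\sum_{i,j}[Y_i,Z_j]\otimes(\eta_i\wedge\omega_j).$$ -/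

import Mathlib

open CategoryTheory Opposite AlgebraicGeometry
open scoped TrivSqZeroExt ExteriorAlgebra
universe u w

namespace CombForms
noncomputable section

section Algebra

variable (R B : Type u) [CommRing R] [CommRing B] [Algebra R B]

/-- Two copies of the exterior algebra of `Ω[B⁄R]`, with the `B`-action
`b • (α, β) = (b α, b β + db ∧ α)` for which `α ↦ (α, dα)` is to be `B`-linear. -/
@[ext]
structure Jet where
  fst : ExteriorAlgebra B Ω[B⁄R]
  snd : ExteriorAlgebra B Ω[B⁄R]

namespace Jet
variable {R B}

instance : Zero (Jet R B) := ⟨⟨0, 0⟩⟩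
instance : Add (Jet R B) := ⟨fun x y => ⟨x.fst + y.fst, x.snd + y.snd⟩⟩
instance : Neg (Jet R B) := ⟨fun x => ⟨-x.fst, -x.snd⟩⟩
instance : SMul B (Jet R B) :=
  ⟨fun b x => ⟨b • x.fst, b • x.snd + ExteriorAlgebra.ι B (KaehlerDifferential.D R B b) * x.fst⟩⟩

@[simp] theorem zero_fst : (0 : Jet R B).fst = 0 := rfl
@[simp] theorem zero_snd : (0 : Jet R B).snd = 0 := rfl
@[simp] theorem add_fst (x y : Jet R B) : (x + y).fst = x.fst + y.fst := rfl
@[simp] theorem add_snd (x y : Jet R B) : (x + y).snd = x.snd + y.snd := rfl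
@[simp] theorem neg_fst (x : Jet R B) : (-x).fst = -x.fst := rfl
@[simp] theorem neg_snd (x : Jet R B) : (-x).snd = -x.snd := rfl
@[simp] theorem smul_fst (b : B) (x : Jet R B) : (b • x).fst = b • x.fst := rfl
@[simp] theorem smul_snd (b : B) (x : Jet R B) : (b • x).snd =
    b • x.snd + ExteriorAlgebra.ι B (KaehlerDifferential.D R B b) * x.fst := rfl

instance : AddCommGroup (Jet R B) where
  add_assoc x y z := by ext <;> simp [add_assoc]
  zero_add x := by ext <;> simp
  add_zero x := by ext <;> simp
  add_comm x y := by ext <;> simp [add_comm]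
  neg_add_cancel x := by ext <;> simp
  nsmul := nsmulRec
  zsmul := zsmulRec

instance : Module B (Jet R B) where
  one_smul x := by ext <;> simp
  mul_smul a b x := by
    ext
    · simp [mul_smul]
    · simp only [smul_snd, smul_fst, Derivation.leibniz, map_add, map_smul, add_mul,
        smul_mul_assoc, mul_smul_comm, smul_add, mul_smul]
      abel
  smul_zero b := by ext <;> simp
  smul_add b x y := by
    ext
    · simp
    · simp only [smul_snd, add_fst, add_snd, mul_add, smul_add]; abel
  add_smul a b x := by
    ext
    · simp [add_smul]
    · simp only [smul_snd, add_snd, add_smul, map_add, add_mul]; abel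
  zero_smul x := by ext <;> simp

instance : Module R (Jet R B) := Module.compHom _ (algebraMap R B)
instance : IsScalarTower R B (Jet R B) := IsScalarTower.of_algebraMap_smul fun _ _ => rfl

/-- The derivation `b ↦ (db, 0)`. -/
def derivation : Derivation R B (Jet R B) where
  toFun b := ⟨ExteriorAlgebra.ι B (KaehlerDifferential.D R B b), 0⟩
  map_add' a b := by ext <;> simp
  map_smul' r b := by
    ext
    · change _ = algebraMap R B r • _
      simp [Algebra.smul_def r b]
    · change _ = algebraMap R B r • _ + _
      simp
  map_one_eq_zero' := by ext <;> simp
  leibniz' a b := by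
    ext
    · simp
    · have h (x y : ExteriorAlgebra B Ω[B⁄R]) (hxy : x + y = 0) :
          0 = a • (0 : ExteriorAlgebra B Ω[B⁄R]) + x + (b • 0 + y) := by simp [hxy]
      exact h _ _ (ExteriorAlgebra.ι_add_mul_swap (R := B) (KaehlerDifferential.D R B a)
        (KaehlerDifferential.D R B b))

/-- The `B`-linear map `ω ↦ (ω, dω)` on one-forms. -/
def ofOneForm : Ω[B⁄R] →ₗ[B] Jet R B := derivation.liftKaehlerDifferential

theorem ofOneForm_D (b : B) : ofOneForm (KaehlerDifferential.D R B b) =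
    ⟨ExteriorAlgebra.ι B (KaehlerDifferential.D R B b), 0⟩ :=
  derivation.liftKaehlerDifferential_comp_D b

theorem oneForm_induction {p : Ω[B⁄R] → Prop} (ω : Ω[B⁄R])
    (hD : ∀ b, p (KaehlerDifferential.D R B b)) (hadd : ∀ ω ω', p ω → p ω' → p (ω + ω'))
    (hsmul : ∀ (b : B) ω, p ω → p (b • ω)) (h0 : p 0) : p ω := by
  have h : ω ∈ Submodule.span B (Set.range (KaehlerDifferential.D R B)) := by
    rw [KaehlerDifferential.span_range_derivation]; trivial
  induction h using Submodule.span_induction with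
  | mem x hx => obtain ⟨b, rfl⟩ := hx; exact hD b
  | zero => exact h0
  | add x y _ _ hx hy => exact hadd x y hx hy
  | smul b x _ hx => exact hsmul b x hx

theorem ofOneForm_fst (ω : Ω[B⁄R]) : (ofOneForm ω).fst = ExteriorAlgebra.ι B ω := by
  induction ω using oneForm_induction with
  | hD b => rw [ofOneForm_D]
  | hadd x y hx hy => simp [hx, hy]
  | hsmul b x hx => simp [hx]
  | h0 => simp

theorem ofOneForm_snd_mem (ω : Ω[B⁄R]) : (ofOneForm ω).snd ∈ ⋀[B]^2 Ω[B⁄R] := by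
  induction ω using oneForm_induction with
  | hD b => rw [ofOneForm_D]; exact zero_mem _
  | hadd x y hx hy => simpa using add_mem hx hy
  | hsmul b x hx =>
    rw [map_smul, smul_snd, ofOneForm_fst]
    refine add_mem (Submodule.smul_mem _ _ hx) ?_
    rw [ExteriorAlgebra.exteriorPower, pow_two]
    exact Submodule.mul_mem_mul (LinearMap.mem_range_self _ _) (LinearMap.mem_range_self _ _)
  | h0 => simp

theorem ι_mul_ι_swap (x y : Ω[B⁄R]) :
    ExteriorAlgebra.ι B x * ExteriorAlgebra.ι B y =
      -(ExteriorAlgebra.ι B y * ExteriorAlgebra.ι B x) :=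
  eq_neg_of_add_eq_zero_left (ExteriorAlgebra.ι_add_mul_swap x y)

theorem ofOneForm_snd_mul_ι (ω η : Ω[B⁄R]) : (ofOneForm ω).snd * ExteriorAlgebra.ι B η =
    ExteriorAlgebra.ι B η * (ofOneForm ω).snd := by
  induction ω using oneForm_induction with
  | hD b => rw [ofOneForm_D]; simp
  | hadd x y hx hy => simp [add_mul, mul_add, hx, hy]
  | hsmul b x hx =>
    rw [map_smul, smul_snd, ofOneForm_fst, add_mul, mul_add, smul_mul_assoc, mul_smul_comm, hx,
      mul_assoc, ι_mul_ι_swap x η, mul_neg, ← mul_assoc, ι_mul_ι_swap _ η, neg_mul, neg_neg,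
      mul_assoc]
  | h0 => simp

/-- Exterior multiplication by a one-form `ω`, compatibly with `d`:
`(α, β) ↦ (ω ∧ α, dω ∧ α - ω ∧ β)`. -/
def mulLeft : Ω[B⁄R] →ₗ[B] Module.End B (Jet R B) where
  toFun ω :=
    { toFun x := ⟨ExteriorAlgebra.ι B ω * x.fst,
        (ofOneForm ω).snd * x.fst - ExteriorAlgebra.ι B ω * x.snd⟩
      map_add' x y := by
        ext
        · simp [mul_add]
        · simp only [add_fst, add_snd, mul_add]; abel
      map_smul' b x := by
        ext
        · simp
        · simp only [smul_fst, smul_snd, RingHom.id_apply, mul_smul_comm, mul_add, smul_sub,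
            ← mul_assoc, ι_mul_ι_swap ω]
          simp only [neg_mul]; abel }
  map_add' ω η := by
    ext x
    · simp [add_mul]
    · simp only [map_add, add_snd, add_mul, LinearMap.add_apply, LinearMap.coe_mk,
        AddHom.coe_mk]; abel
  map_smul' b ω := by
    ext x
    · simp
    · simp only [map_smul, smul_snd, ofOneForm_fst, LinearMap.coe_mk, AddHom.coe_mk,
        RingHom.id_apply, LinearMap.smul_apply, smul_mul_assoc, add_mul, mul_assoc, smul_sub]
      abel

theorem mulLeft_fst (ω : Ω[B⁄R]) (x : Jet R B) :
    (mulLeft ω x).fst = ExteriorAlgebra.ι B ω * x.fst := rfl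

theorem mulLeft_snd (ω : Ω[B⁄R]) (x : Jet R B) : (mulLeft ω x).snd =
    (ofOneForm ω).snd * x.fst - ExteriorAlgebra.ι B ω * x.snd := rfl

theorem mulLeft_mul_self (ω : Ω[B⁄R]) : mulLeft ω * mulLeft ω = 0 := by
  ext x
  · simp [mulLeft_fst, ← mul_assoc]
  · simp [mulLeft_fst, mulLeft_snd, mul_sub, ← mul_assoc, ofOneForm_snd_mul_ι]

/-- The pair `(α, dα)`. -/
def ofForm (α : ExteriorAlgebra B Ω[B⁄R]) : Jet R B :=
  ExteriorAlgebra.lift B ⟨mulLeft, mulLeft_mul_self⟩ α ⟨1, 0⟩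

theorem ofForm_algebraMap (b : B) : ofForm (R := R) (algebraMap B _ b) =
    ⟨algebraMap B _ b, ExteriorAlgebra.ι B (KaehlerDifferential.D R B b)⟩ := by
  rw [ofForm, AlgHom.commutes, Module.algebraMap_end_apply]
  ext <;> simp [Algebra.algebraMap_eq_smul_one]

theorem ofForm_add (α β : ExteriorAlgebra B Ω[B⁄R]) :
    ofForm (α + β) = ofForm α + ofForm β := by simp [ofForm]

theorem ofForm_ι_mul (ω : Ω[B⁄R]) (α : ExteriorAlgebra B Ω[B⁄R]) :
    ofForm (ExteriorAlgebra.ι B ω * α) = mulLeft ω (ofForm α) := by simp [ofForm]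

theorem ofForm_smul (c : B) (α : ExteriorAlgebra B Ω[B⁄R]) :
    ofForm (c • α) = c • ofForm α := by simp [ofForm]

theorem ofForm_ιMulti_D {n : ℕ} (b : Fin n → B) : (ofForm (R := R)
    (ExteriorAlgebra.ιMulti B n fun i => KaehlerDifferential.D R B (b i))).snd = 0 := by
  induction n with
  | zero =>
    have := ofForm_algebraMap (R := R) (1 : B)
    rw [map_one] at this
    simp [ExteriorAlgebra.ιMulti_zero_apply, this]
  | succ n ih =>
    rw [ExteriorAlgebra.ιMulti_succ_apply, ofForm_ι_mul, mulLeft_snd, ofOneForm_D]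
    have := ih (fun i => b i.succ)
    simp [Matrix.vecTail, Function.comp_def, this]

theorem ofForm_mem {n : ℕ} {α : ExteriorAlgebra B Ω[B⁄R]} (h : α ∈ ⋀[B]^n Ω[B⁄R]) :
    (ofForm α).fst = α ∧ (ofForm α).snd ∈ ⋀[B]^(n + 1) Ω[B⁄R] := by
  induction h using Submodule.pow_induction_on_left' with
  | algebraMap b =>
    rw [ofForm_algebraMap]
    refine ⟨rfl, ?_⟩
    rw [ExteriorAlgebra.exteriorPower, zero_add, pow_one]
    exact LinearMap.mem_range_self _ _
  | add x y i hx hy ihx ihy =>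
    rw [ofForm_add]
    exact ⟨by rw [add_fst, ihx.1, ihy.1], add_mem ihx.2 ihy.2⟩
  | mem_mul m hm i x hx ih =>
    obtain ⟨ω, rfl⟩ := hm
    rw [ofForm_ι_mul, mulLeft_fst, mulLeft_snd, ih.1]
    refine ⟨rfl, sub_mem ?_ ?_⟩
    · have := Submodule.mul_mem_mul (ofOneForm_snd_mem ω) hx
      rw [ExteriorAlgebra.exteriorPower, ← pow_add] at this
      rwa [ExteriorAlgebra.exteriorPower, show i.succ + 1 = 2 + i by omega]
    · rw [ExteriorAlgebra.exteriorPower, pow_succ']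
      exact Submodule.mul_mem_mul (LinearMap.mem_range_self _ _) ih.2

end Jet

variable {R B}

/-- The exterior derivative, i.e. the `R`-linear map with
`d (c db₁ ∧ ⋯ ∧ dbₙ) = dc ∧ db₁ ∧ ⋯ ∧ dbₙ`. -/
def formDeriv {n : ℕ} (ω : ⋀[B]^n Ω[B⁄R]) : ⋀[B]^(n + 1) Ω[B⁄R] :=
  ⟨(Jet.ofForm ω.1).snd, (Jet.ofForm_mem ω.2).2⟩

theorem formDeriv_smul_ιMulti {n : ℕ} (c : B) (b : Fin n → B) :
    formDeriv (R := R) (c • exteriorPower.ιMulti B n fun i => KaehlerDifferential.D R B (b i)) =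
      exteriorPower.ιMulti B (n + 1) (Matrix.vecCons (KaehlerDifferential.D R B c)
        fun i => KaehlerDifferential.D R B (b i)) := by
  ext
  have h := (Jet.ofForm_mem
    (exteriorPower.ιMulti B n fun i => KaehlerDifferential.D R B (b i)).2).1
  simp only [exteriorPower.ιMulti_apply_coe] at h
  simp only [formDeriv, Submodule.coe_smul, exteriorPower.ιMulti_apply_coe, Jet.ofForm_smul,
    Jet.smul_snd, Jet.ofForm_ιMulti_D, h]
  simp [ExteriorAlgebra.ιMulti_succ_apply]

end Algebra

/-- Two points with values in `C` are infinitesimally close if they agree modulo a square-zero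
ideal. A family `y₀, …, yₙ` of ring homomorphisms `B → C` is an infinitesimal `n`-simplex (in the
strong sense) if its members are pairwise infinitesimally close and moreover
`(yᵢ b - y₀ b) (yⱼ b - y₀ b) = 0` for every `b`. -/
structure IsSimplex {B C : Type u} [CommRing B] [CommRing C] {n : ℕ}
    (y : Fin (n + 1) → (B →+* C)) : Prop where
  close : ∀ i j, ∃ K : Ideal C, K ^ 2 = ⊥ ∧ ∀ b, y i b - y j b ∈ K
  strong : ∀ i j b, (y i b - y 0 b) * (y j b - y 0 b) = 0

namespace IsSimplex

variable {B C D : Type u} [CommRing B] [CommRing C] [CommRing D] {n : ℕ}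
  {y : Fin (n + 1) → (B →+* C)}

theorem mul_eq_zero (hy : IsSimplex y) (i j : Fin (n + 1)) (b b' : B) :
    (y i b - y j b) * (y i b' - y j b') = 0 := by
  obtain ⟨K, hK, h⟩ := hy.close i j
  have := Ideal.mul_mem_mul (h b) (h b')
  rwa [← pow_two, hK, Ideal.mem_bot] at this

theorem polar (hy : IsSimplex y) (i j : Fin (n + 1)) (b b' : B) :
    (y i b - y 0 b) * (y j b' - y 0 b') = -((y i b' - y 0 b') * (y j b - y 0 b)) := by
  have h := hy.strong i j (b + b')
  simp only [map_add] at h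
  linear_combination h - hy.strong i j b - hy.strong i j b'

theorem comp (hy : IsSimplex y) (f : C →+* D) : IsSimplex fun i => f.comp (y i) where
  close i j := by
    obtain ⟨K, hK, h⟩ := hy.close i j
    refine ⟨K.map f, by rw [← Ideal.map_pow, hK, Ideal.map_bot], fun b => ?_⟩
    simpa using Ideal.mem_map_of_mem f (h b)
  strong i j b := by simpa using congrArg f (hy.strong i j b)

theorem precomp (hy : IsSimplex y) {m : ℕ} (σ : Fin (m + 1) → Fin (n + 1)) :
    IsSimplex fun i => y (σ i) where
  close i j := hy.close _ _
  strong i j b := by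
    linear_combination hy.strong (σ i) (σ j) b - hy.strong (σ i) (σ 0) b
      - hy.strong (σ 0) (σ j) b + hy.strong (σ 0) (σ 0) b

end IsSimplex

section Eval

variable {R B C : Type u} [CommRing R] [CommRing B] [CommRing C] [Algebra R B] [Algebra R C]
  {n : ℕ} (y : Fin (n + 1) → (B →ₐ[R] C)) (hy : IsSimplex fun i => (y i : B →+* C))

/-- `C` as a `B`-algebra through the initial vertex of a simplex. -/
abbrev vertexAlgebra : Algebra B C := (y 0).toRingHom.toAlgebra

theorem IsSimplex.derivation_leibniz (hy : IsSimplex fun i => (y i : B →+* C)) (i : Fin n) (a b : B) :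
    y i.succ (a * b) - y 0 (a * b) =
      y 0 a * (y i.succ b - y 0 b) + y 0 b * (y i.succ a - y 0 a) := by
  have := hy.mul_eq_zero i.succ 0 a b
  simp only [map_mul, AlgHom.coe_toRingHom] at this ⊢
  linear_combination this

/-- For an infinitesimal simplex `y`, the `B`-linear map `Ω[B⁄R] → C` with
`db ↦ yᵢ b - y₀ b` (here `C` is a `B`-module through `y₀`). -/
def edge (i : Fin n) :
    letI := vertexAlgebra y
    Ω[B⁄R] →ₗ[B] C :=
  letI := vertexAlgebra y
  haveI : IsScalarTower R B C := IsScalarTower.of_algebraMap_eq fun r => ((y 0).commutes r).symm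
  Derivation.liftKaehlerDifferential
    { toFun b := y i.succ b - y 0 b
      map_add' a b := by simp only [map_add]; ring
      map_smul' r b := by simp only [map_smul, RingHom.id_apply, smul_sub]
      map_one_eq_zero' := by simp
      leibniz' a b := hy.derivation_leibniz y i a b }

theorem edge_D (i : Fin n) (b : B) :
    edge y hy i (KaehlerDifferential.D R B b) = y i.succ b - y 0 b :=
  letI := vertexAlgebra y
  haveI : IsScalarTower R B C := IsScalarTower.of_algebraMap_eq fun r => ((y 0).commutes r).symm
  Derivation.liftKaehlerDifferential_comp_D _ b

theorem edge_smul (i : Fin n) (b : B) (ω : Ω[B⁄R]) :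
    edge y hy i (b • ω) = y 0 b * edge y hy i ω :=
  letI := vertexAlgebra y
  map_smul (edge y hy i) b ω

theorem edge_polar (i j : Fin n) (ω η : Ω[B⁄R]) :
    edge y hy i ω * edge y hy j η = -(edge y hy i η * edge y hy j ω) := by
  induction ω using Jet.oneForm_induction with
  | hD b =>
    induction η using Jet.oneForm_induction with
    | hD b' => simp only [edge_D]; exact hy.polar i.succ j.succ b b'
    | hadd x x' h h' => simp only [map_add, mul_add, add_mul, h, h', neg_add]
    | hsmul c x h => simp only [edge_smul]; linear_combination y 0 c * h
    | h0 => simp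
  | hadd x x' h h' => simp only [map_add, mul_add, add_mul, h, h', neg_add]
  | hsmul c x h => simp only [edge_smul]; linear_combination y 0 c * h
  | h0 => simp

theorem edge_mul_self (i j : Fin n) (ω : Ω[B⁄R]) : edge y hy i ω * edge y hy j ω = 0 := by
  induction ω using Jet.oneForm_induction with
  | hD b => simp only [edge_D]; exact hy.strong i.succ j.succ b
  | hadd x x' h h' =>
    simp only [map_add]
    linear_combination h + h' + edge_polar y hy i j x x'
  | hsmul c x h => simp only [edge_smul]; linear_combination (y 0 c) ^ 2 * h
  | h0 => simp

/-- The value `ω(y₀, …, yₙ)` of a differential `n`-form at an infinitesimal `n`-simplex: the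
additive map with `c db₁ ∧ ⋯ ∧ dbₙ ↦ y₀ c (y₁ b₁ - y₀ b₁) ⋯ (yₙ bₙ - y₀ bₙ)`. -/
def evalForm : (⋀[B]^n Ω[B⁄R]) →+ C :=
  letI := vertexAlgebra y
  (exteriorPower.alternatingMapLinearEquiv
    { (MultilinearMap.mkPiAlgebra B (Fin n) C).compLinearMap (edge y hy) with
      map_eq_zero_of_eq' v i j hv hij := by
        change ∏ k, edge y hy k (v k) = 0
        rw [← Finset.mul_prod_erase _ _ (Finset.mem_univ i),
          ← Finset.mul_prod_erase _ _ (Finset.mem_erase.2 ⟨hij.symm, Finset.mem_univ j⟩),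
          ← mul_assoc, hv, edge_mul_self, zero_mul] }).toAddMonoidHom

theorem evalForm_ιMulti (v : Fin n → Ω[B⁄R]) :
    evalForm y hy (exteriorPower.ιMulti B n v) = ∏ k, edge y hy k (v k) :=
  letI := vertexAlgebra y
  exteriorPower.alternatingMapLinearEquiv_apply_ιMulti _ v

theorem evalForm_smul (b : B) (ω : ⋀[B]^n Ω[B⁄R]) :
    evalForm y hy (b • ω) = y 0 b * evalForm y hy ω :=
  letI := vertexAlgebra y
  map_smul (exteriorPower.alternatingMapLinearEquiv _) b ω

theorem edge_mul_edge (i : Fin n) (ω η : Ω[B⁄R]) : edge y hy i ω * edge y hy i η = 0 := by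
  induction ω using Jet.oneForm_induction with
  | hD b =>
    induction η using Jet.oneForm_induction with
    | hD b' => simp only [edge_D]; exact hy.mul_eq_zero i.succ 0 b b'
    | hadd x x' h h' => simp only [map_add, mul_add, h, h', add_zero]
    | hsmul c x h => simp only [edge_smul]; linear_combination y 0 c * h
    | h0 => simp
  | hadd x x' h h' => simp only [map_add, add_mul, h, h', add_zero]
  | hsmul c x h => simp only [edge_smul]; linear_combination y 0 c * h
  | h0 => simp

theorem evalForm_mul_self [NeZero n] (ω : ⋀[B]^n Ω[B⁄R]) :
    evalForm y hy ω * evalForm y hy ω = 0 := by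
  have key : ∀ ω η : ⋀[B]^n Ω[B⁄R], evalForm y hy ω * evalForm y hy η = 0 := by
    have hspan : ∀ ω : ⋀[B]^n Ω[B⁄R],
        ω ∈ Submodule.span B (Set.range (exteriorPower.ιMulti B n (M := Ω[B⁄R]))) := fun ω => by
      rw [exteriorPower.ιMulti_span]; trivial
    intro ω η
    induction hspan ω using Submodule.span_induction with
    | zero => simp
    | add x x' _ _ h h' => rw [map_add, add_mul, h, h', add_zero]
    | smul c x _ h => rw [evalForm_smul, mul_assoc, h, mul_zero]
    | mem x hx =>
      obtain ⟨v, rfl⟩ := hx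
      induction hspan η using Submodule.span_induction with
      | zero => simp
      | add x x' _ _ h h' => rw [map_add, mul_add, h, h', add_zero]
      | smul c x _ h => rw [evalForm_smul, mul_left_comm, h, mul_zero]
      | mem x hx =>
        obtain ⟨v', rfl⟩ := hx
        rw [evalForm_ιMulti, evalForm_ιMulti, ← Finset.prod_mul_distrib]
        exact Finset.prod_eq_zero (Finset.mem_univ 0) (edge_mul_edge y hy 0 _ _)
  exact key ω ω

/-- The exterior product of two differential forms. -/
def wedge {m n : ℕ} (η : ⋀[B]^m Ω[B⁄R]) (ω : ⋀[B]^n Ω[B⁄R]) : ⋀[B]^(m + n) Ω[B⁄R] :=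
  ⟨η.1 * ω.1, by
    rw [show ⋀[B]^(m + n) Ω[B⁄R] = ⋀[B]^m Ω[B⁄R] * ⋀[B]^n Ω[B⁄R] from pow_add _ m n]
    exact Submodule.mul_mem_mul η.2 ω.2⟩

end Eval

section Schemes

variable {S : Scheme.{u}}

/-- The `T`-valued points of `Δⁿ_{X/S}`: the `(n + 1)`-tuples of `T`-valued points of `X` which,
locally on `T`, are given by an infinitesimal simplex of ring homomorphisms `B → C` for affine
opens `Spec B ⊆ X` and `Spec C ⊆ T`. -/
def InDelta {X : Over S} {n : ℕ} {T : Over S} (x : Fin (n + 1) → (T ⟶ X)) : Prop :=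
  ∀ t : T.left, ∃ (B C : CommRingCat.{u}) (j : Spec B ⟶ X.left) (g : Spec C ⟶ T.left)
    (y : Fin (n + 1) → (B ⟶ C)), IsOpenImmersion j ∧ IsOpenImmersion g ∧ t ∈ Set.range g ∧
      (∀ i, g ≫ (x i).left = Spec.map (y i) ≫ j) ∧ IsSimplex fun i => (y i).hom

theorem InDelta.precomp {X : Over S} {m n : ℕ} {T : Over S} {x : Fin (n + 1) → (T ⟶ X)}
    (hx : InDelta x) (σ : Fin (m + 1) → Fin (n + 1)) : InDelta fun i => x (σ i) := fun t => by
  obtain ⟨B, C, j, g, y, hj, hg, ht, h, hy⟩ := hx t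
  exact ⟨B, C, j, g, fun i => y (σ i), hj, hg, ht, fun i => h (σ i), hy.precomp σ⟩

theorem InDelta.comp {X : Over S} {n : ℕ} {T T' : Over S} {x : Fin (n + 1) → (T ⟶ X)}
    (hx : InDelta x) (f : T' ⟶ T) : InDelta fun i => f ≫ x i := fun t' => by
  obtain ⟨B, C, j, g, y, hj, hg, ht, h, hy⟩ := hx (f.left t')
  obtain ⟨U, hU, htU, hUV⟩ := exists_isAffineOpen_mem_and_subset
    (x := t') (U := f.left ⁻¹ᵁ g.opensRange) ht
  have hr : Set.range (hU.fromSpec ≫ f.left) ⊆ Set.range g := by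
    rintro _ ⟨z, rfl⟩
    have : hU.fromSpec z ∈ U := by
      have h1 : hU.fromSpec z ∈ Set.range hU.fromSpec := ⟨z, rfl⟩
      rwa [hU.range_fromSpec] at h1
    simpa using hUV this
  let l : Spec Γ(T'.left, U) ⟶ Spec C := IsOpenImmersion.lift g (hU.fromSpec ≫ f.left) hr
  have hl : l ≫ g = hU.fromSpec ≫ f.left := IsOpenImmersion.lift_fac _ _ _
  refine ⟨B, Γ(T'.left, U), j, hU.fromSpec, fun i => y i ≫ Spec.preimage l, hj, inferInstance,
    ?_, fun i => ?_, ?_⟩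
  · rw [hU.range_fromSpec]; exact htU
  · rw [Over.comp_left, ← Category.assoc, ← hl, Category.assoc, h, Spec.map_comp,
      Spec.map_preimage, Category.assoc]
  · simpa using hy.comp (Spec.preimage l).hom

/-- A combinatorial `n`-form on `X/S` with values in a presheaf of groups `F` on `S`-schemes: a
morphism of functors `Δⁿ_{X/S} → F` which is trivial whenever two consecutive points coincide. -/
structure CombForm (X : Over S) (F : (Over S)ᵒᵖ ⥤ GrpCat.{w}) (n : ℕ) where
  app : ∀ {T : Over S} (x : Fin (n + 1) → (T ⟶ X)), InDelta x → F.obj (op T)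
  naturality : ∀ {T T' : Over S} (f : T' ⟶ T) (x : Fin (n + 1) → (T ⟶ X)) (hx : InDelta x),
    F.map f.op (app x hx) = app (fun i => f ≫ x i) (hx.comp f)
  degenerate : ∀ {T : Over S} (x : Fin (n + 1) → (T ⟶ X)) (hx : InDelta x) (i : Fin n),
    x i.castSucc = x i.succ → app x hx = 1

theorem aut_app_congr {F : (Over S)ᵒᵖ ⥤ GrpCat.{w}} {T Z : Over S}
    (a : Aut ((Over.forget T).op ⋙ F)) {p q : Z ⟶ T} (h : p = q) (z : F.obj (op Z)) :
    a.hom.app (op (Over.mk p)) z = a.hom.app (op (Over.mk q)) z := by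
  subst h; rfl

/-- The presheaf of automorphisms of a presheaf of groups `F`: its sections over `T` are the
automorphisms of the restriction of `F` to `T`-schemes. -/
def autPresheaf (F : (Over S)ᵒᵖ ⥤ GrpCat.{w}) : (Over S)ᵒᵖ ⥤ GrpCat where
  obj T := GrpCat.of (Aut ((Over.forget T.unop).op ⋙ F))
  map {T T'} f := GrpCat.ofHom
    { toFun a := NatIso.ofComponents
        (fun Y => a.app (op ((Over.map f.unop).obj Y.unop)))
        (fun {Y Y'} g => a.hom.naturality ((Over.map f.unop).map g.unop).op)
      map_one' := by ext; rfl
      map_mul' a b := by ext; rfl }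
  map_id T := by
    ext a Y z
    exact aut_app_congr a (Category.comp_id Y.unop.hom) z
  map_comp f g := by
    ext a Y z
    exact aut_app_congr a (Category.assoc Y.unop.hom g.unop f.unop).symm z

/-- The value `u(g)` of an automorphism at a section. -/
def act {F : (Over S)ᵒᵖ ⥤ GrpCat.{w}} {T : Over S} (a : (autPresheaf F).obj (op T))
    (g : F.obj (op T)) : F.obj (op T) :=
  Iso.hom (a : Aut ((Over.forget T).op ⋙ F)) |>.app (op (Over.mk (𝟙 T))) g


theorem map_act {F : (Over S)ᵒᵖ ⥤ GrpCat.{w}} {T T' : Over S} (f : T' ⟶ T)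
    (a : (autPresheaf F).obj (op T)) (g : F.obj (op T)) :
    F.map f.op (act a g) = act ((autPresheaf F).map f.op a) (F.map f.op g) := by
  let a' : Aut ((Over.forget T).op ⋙ F) := a
  have h := ConcreteCategory.congr_hom
    (a'.hom.naturality (Over.homMk f : Over.mk f ⟶ Over.mk (𝟙 T)).op) g
  exact h.symm.trans (aut_app_congr a' (Category.id_comp f).symm (F.map f.op g))

theorem act_one_left {F : (Over S)ᵒᵖ ⥤ GrpCat.{w}} {T : Over S} (g : F.obj (op T)) :
    act (1 : (autPresheaf F).obj (op T)) g = g := rfl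

theorem act_one_right {F : (Over S)ᵒᵖ ⥤ GrpCat.{w}} {T : Over S}
    (a : (autPresheaf F).obj (op T)) : act a 1 = 1 :=
  map_one (Iso.hom (a : Aut ((Over.forget T).op ⋙ F)) |>.app (op (Over.mk (𝟙 T)))).hom

namespace CombForm

variable {X : Over S} {F : (Over S)ᵒᵖ ⥤ GrpCat.{w}}

theorem app_congr {n : ℕ} (f : CombForm X F n) {T : Over S} {x x' : Fin (n + 1) → (T ⟶ X)}
    (h : x = x') (hx : InDelta x) : f.app x hx = f.app x' (h ▸ hx) := by subst h; rfl

/-- The value of a combinatorial form at the face with vertices `σ` of a simplex. -/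
def face {m n : ℕ} (f : CombForm X F m) {T : Over S} (x : Fin (n + 1) → (T ⟶ X))
    (hx : InDelta x) (σ : Fin (m + 1) → Fin (n + 1)) : F.obj (op T) :=
  f.app (fun i => x (σ i)) (hx.precomp σ)

theorem map_face {m n : ℕ} (f : CombForm X F m) {T T' : Over S} (p : T' ⟶ T)
    (x : Fin (n + 1) → (T ⟶ X)) (hx : InDelta x) (σ : Fin (m + 1) → Fin (n + 1)) :
    F.map p.op (f.face x hx σ) = f.face (fun i => p ≫ x i) (hx.comp p) σ :=
  f.naturality _ _ _

theorem face_eq_one {m n : ℕ} (f : CombForm X F m) {T : Over S} {x : Fin (n + 1) → (T ⟶ X)}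
    (hx : InDelta x) {σ : Fin (m + 1) → Fin (n + 1)} (i : Fin m)
    (h : x (σ i.castSucc) = x (σ i.succ)) : f.face x hx σ = 1 :=
  f.degenerate _ _ i h

theorem face_congr {m n : ℕ} (f : CombForm X F m) {T : Over S} {x : Fin (n + 1) → (T ⟶ X)}
    (hx : InDelta x) {σ τ : Fin (m + 1) → Fin (n + 1)} (h : ∀ i, x (σ i) = x (τ i)) :
    f.face x hx σ = f.face x hx τ :=
  f.app_congr (funext h) _

/-- The combinatorial differential of a three-form `Ω` twisted by a one-form `χ` with values in
automorphisms: `(x, y, z, u, v) ↦`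
`χ(x,y)(Ω(y,z,u,v)) Ω(x,y,u,v) Ω(x,y,z,u) Ω(x,z,u,v)⁻¹ Ω(x,y,z,v)⁻¹`. -/
def delta (χ : CombForm X (autPresheaf F) 1) (Ω : CombForm X F 3) : CombForm X F 4 where
  app x hx :=
    act (χ.face x hx ![0, 1]) (Ω.face x hx ![1, 2, 3, 4]) * Ω.face x hx ![0, 1, 3, 4] *
      Ω.face x hx ![0, 1, 2, 3] * (Ω.face x hx ![0, 2, 3, 4])⁻¹ * (Ω.face x hx ![0, 1, 2, 4])⁻¹
  naturality f x hx := by simp only [map_mul, map_inv, map_act, map_face]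
  degenerate x hx i h := by
    fin_cases i
    · have h : x 0 = x 1 := h
      rw [χ.face_eq_one hx 0 h, Ω.face_eq_one hx (σ := ![0, 1, 3, 4]) 0 h,
        Ω.face_eq_one hx (σ := ![0, 1, 2, 3]) 0 h, Ω.face_eq_one hx (σ := ![0, 1, 2, 4]) 0 h,
        Ω.face_congr hx (σ := ![1, 2, 3, 4]) (τ := ![0, 2, 3, 4])
          (by intro i; fin_cases i <;> simp [h]), act_one_left]
      simp
    · have h : x 1 = x 2 := h
      rw [Ω.face_eq_one hx (σ := ![1, 2, 3, 4]) 0 h, Ω.face_eq_one hx (σ := ![0, 1, 2, 3]) 1 h,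
        Ω.face_eq_one hx (σ := ![0, 1, 2, 4]) 1 h,
        Ω.face_congr hx (σ := ![0, 1, 3, 4]) (τ := ![0, 2, 3, 4])
          (by intro i; fin_cases i <;> simp [h]), act_one_right]
      simp
    · have h : x 2 = x 3 := h
      rw [Ω.face_eq_one hx (σ := ![1, 2, 3, 4]) 1 h, Ω.face_eq_one hx (σ := ![0, 1, 2, 3]) 2 h,
        Ω.face_eq_one hx (σ := ![0, 2, 3, 4]) 1 h,
        Ω.face_congr hx (σ := ![0, 1, 3, 4]) (τ := ![0, 1, 2, 4])
          (by intro i; fin_cases i <;> simp [h]), act_one_right]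
      simp
    · have h : x 3 = x 4 := h
      rw [Ω.face_eq_one hx (σ := ![1, 2, 3, 4]) 2 h, Ω.face_eq_one hx (σ := ![0, 1, 3, 4]) 2 h,
        Ω.face_eq_one hx (σ := ![0, 2, 3, 4]) 2 h,
        Ω.face_congr hx (σ := ![0, 1, 2, 3]) (τ := ![0, 1, 2, 4])
          (by intro i; fin_cases i <;> simp [h]), act_one_right]
      simp

end CombForm

/-- An affine chart of `X/S`: affine opens `Spec R ⊆ S` and `Spec B ⊆ X`, the second lying over
the first. -/
structure Chart (X : Over S) where
  R : Type u
  B : Type u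
  [commRingR : CommRing R]
  [commRingB : CommRing B]
  [algebra : Algebra R B]
  i : Spec (.of R) ⟶ S
  j : Spec (.of B) ⟶ X.left
  open_i : IsOpenImmersion i
  open_j : IsOpenImmersion j
  comm : j ≫ X.hom = Spec.map (CommRingCat.ofHom (algebraMap R B)) ≫ i

namespace Chart

attribute [instance] commRingR commRingB algebra

variable {X : Over S} (c : Chart X)

/-- The spectrum of an `R`-algebra, as an `S`-scheme. -/
def aff (C : Type u) [CommRing C] [Algebra c.R C] : Over S :=
  Over.mk (Spec.map (CommRingCat.ofHom (algebraMap c.R C)) ≫ c.i)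

variable {A C D : Type u} [CommRing A] [CommRing C] [CommRing D] [Algebra c.R A] [Algebra c.R C]
  [Algebra c.R D]

/-- The morphism of spectra induced by a homomorphism of `R`-algebras. -/
def map (f : C →ₐ[c.R] D) : c.aff D ⟶ c.aff C :=
  Over.homMk (Spec.map (CommRingCat.ofHom f.toRingHom)) (by
    simp only [aff, Over.mk_left, Over.mk_hom]
    rw [← Category.assoc, ← Spec.map_comp, ← CommRingCat.ofHom_comp]
    congr 3
    exact f.comp_algebraMap)

/-- The `C`-valued point of `X` given by a homomorphism of `R`-algebras `B → C`. -/
def pt (y : c.B →ₐ[c.R] C) : c.aff C ⟶ X :=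
  Over.homMk (Spec.map (CommRingCat.ofHom y.toRingHom) ≫ c.j) (by
    simp only [aff, Over.mk_left, Over.mk_hom]
    rw [Category.assoc, c.comm, ← Category.assoc, ← Spec.map_comp, ← CommRingCat.ofHom_comp]
    congr 3
    exact y.comp_algebraMap)

theorem inDelta {n : ℕ} {y : Fin (n + 1) → (c.B →ₐ[c.R] C)}
    (hy : IsSimplex fun i => (y i : c.B →+* C)) : InDelta fun i => c.pt (y i) := fun t =>
  ⟨.of c.B, .of C, c.j, 𝟙 (Spec (.of C)), fun i => CommRingCat.ofHom (y i).toRingHom,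
    c.open_j, IsOpenImmersion.of_isIso (𝟙 (Spec (.of C))), ⟨t, rfl⟩, fun _ => Category.id_comp _, hy⟩

variable (F : (Over S)ᵒᵖ ⥤ GrpCat.{w})

variable (A) in
/-- The `A`-valued points of the Lie algebra of a presheaf of groups: the kernel of
`F(A[ε]) → F(A)`, `ε ↦ 0`. -/
def lie : Subgroup (F.obj (op (c.aff (DualNumber A)))) :=
  (F.map (c.map (TrivSqZeroExt.fstHom c.R A A)).op).hom.ker

variable {c F}

/-- For `Z` in the Lie algebra over `A`, the element `Z(t)` of `F(C)`, obtained through the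
homomorphism `A[ε] → C`, `a + a' ε ↦ f a + f a' t`. -/
def lieEval (Z : c.lie A F) (f : A →ₐ[c.R] C) (t : C) (ht : t * t = 0) : F.obj (op (c.aff C)) :=
  F.map (c.map (DualNumber.lift ⟨(f, t), ht, fun _ => Commute.all _ _⟩)).op Z.1

theorem map_map (f : A →ₐ[c.R] C) (g : C →ₐ[c.R] D) : c.map g ≫ c.map f = c.map (g.comp f) := by
  ext : 1
  change Spec.map _ ≫ Spec.map _ = _
  rw [← Spec.map_comp, ← CommRingCat.ofHom_comp]
  rfl

/-- Base change of elements of the Lie algebra. -/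
def lieMap (f : A →ₐ[c.R] C) (Z : c.lie A F) : c.lie C F :=
  ⟨lieEval Z ((TrivSqZeroExt.inlAlgHom c.R C C).comp f) DualNumber.eps DualNumber.eps_mul_eps, by
    have hZ : F.map (c.map (TrivSqZeroExt.fstHom c.R A A)).op Z.1 = 1 := Z.2
    change F.map (c.map (TrivSqZeroExt.fstHom c.R C C)).op (F.map _ Z.1) = 1
    rw [← ConcreteCategory.comp_apply, ← F.map_comp, ← op_comp, map_map,
      show (TrivSqZeroExt.fstHom c.R C C).comp _ = f.comp (TrivSqZeroExt.fstHom c.R A A) by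
        ext <;> simp, ← map_map, op_comp, F.map_comp, ConcreteCategory.comp_apply, hZ, map_one]⟩

/-- A finite sum `∑ Zₖ ⊗ ωₖ` in the tensor product of the Lie algebra of `F` over `A` with the
differential `n`-forms on the chart, given by the list of its terms. -/
abbrev TensorForm (c : Chart X) (F : (Over S)ᵒᵖ ⥤ GrpCat.{w}) (A : Type u) [CommRing A]
    [Algebra c.R A] (n : ℕ) :=
  List (c.lie A F × ⋀[c.B]^n Ω[c.B⁄c.R])

/-- Extension of coefficients from `R` to `B`. -/
def TensorForm.toB {n : ℕ} (L : c.TensorForm F c.R n) : c.TensorForm F c.B n :=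
  L.map fun p => (lieMap (Algebra.ofId c.R c.B) p.1, p.2)

/-- The exterior derivative `∑ Zₖ ⊗ ωₖ ↦ ∑ Zₖ ⊗ dωₖ`. -/
def TensorForm.d {n : ℕ} (L : c.TensorForm F c.R n) : c.TensorForm F c.R (n + 1) :=
  L.map fun p => (p.1, formDeriv p.2)

/-- The value at an infinitesimal simplex `y` of the combinatorial form corresponding to
`∑ Zₖ ⊗ ωₖ`, namely the product of the `Zₖ(ωₖ(y₀, …, yₙ))`. -/
def TensorForm.eval {n : ℕ} [NeZero n] (L : c.TensorForm F c.B n)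
    (y : Fin (n + 1) → (c.B →ₐ[c.R] C)) (hy : IsSimplex fun i => (y i : c.B →+* C)) :
    F.obj (op (c.aff C)) :=
  (L.map fun p => lieEval p.1 (y 0) (evalForm y hy p.2) (evalForm_mul_self y hy p.2)).prod

/-- On the chart, the combinatorial form `f` is the one corresponding to `∑ Zₖ ⊗ ωₖ`. -/
def Represents {n : ℕ} [NeZero n] (L : c.TensorForm F c.B n) (f : CombForm X F n) : Prop :=
  ∀ (C : Type u) [CommRing C] [Algebra c.R C] (y : Fin (n + 1) → (c.B →ₐ[c.R] C))
    (hy : IsSimplex fun i => (y i : c.B →+* C)),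
    f.app (fun i => c.pt (y i)) (c.inDelta hy) = L.eval y hy

/-- `W` is the bracket `[Y, Z]` of `Y` in the Lie algebra of `Aut(F)` and `Z` in the Lie algebra
of `F`: the commutator `Y(s)(Z(t)) Z(t)⁻¹` equals `W(s t)` whenever `s² = t² = 0`. -/
def IsLieBracket (Y : c.lie A (autPresheaf F)) (Z W : c.lie A F) : Prop :=
  ∀ (C : Type u) [CommRing C] [Algebra c.R C] (f : A →ₐ[c.R] C) (s t : C) (hs : s * s = 0)
    (ht : t * t = 0),
    act (lieEval Y f s hs) (lieEval Z f t ht) * (lieEval Z f t ht)⁻¹ =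
      lieEval W f (s * t) (by linear_combination t * t * hs)

/-- The bracket `[∑ Yₖ ⊗ ηₖ, ∑ Zₗ ⊗ ωₗ] = ∑ [Yₖ, Zₗ] ⊗ (ηₖ ∧ ωₗ)` formed with a given pairing
`br` of the Lie algebras. -/
def TensorForm.bracket {m n : ℕ} (br : c.lie c.B (autPresheaf F) → c.lie c.B F → c.lie c.B F)
    (K : c.TensorForm (autPresheaf F) c.B m) (L : c.TensorForm F c.B n) :
    c.TensorForm F c.B (m + n) :=
  K.flatMap fun p => L.map fun q => (br p.1 q.1, wedge p.2 q.2)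

end Chart

end Schemes

end

end CombForms

/-! The proof rests on one principle. Call a presheaf of groups `F` separated if its sections are
detected along quasi-compact, scheme-theoretically dominant surjections, Zariski-locally on the
source. For separated `F`, a section over `A[εₖ]ₖ` (finitely many `εₖ`, all products `εₖ εₗ` zero)
which is trivial over `A` is the product of its components `Yₖ(εₖ)`: see `exists_eq_prod_lieEval`.
It also follows that `Z(a + b) = Z(a) Z(b)`, and that `Z(a)` and `W(b)` commute, when `a² = b² = ab
= 0` (`lieEval_add`, `lieEval_comm`). The functor `G` is separated, and so is `Aut(G)`, although it
need not be representable: flatness of `G` allows automorphisms to be compared at the universal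
point.

The formula (`represents_delta`). The vertex differences of a 4-simplex generate an ideal `I` with
`I⁵ = 0`, and three-forms take values in `I³` on its faces. Since `I³ I³ = 0`, all the factors of
`δ³_χ(Ω)` lie in one commutative subgroup. The action of `χ(x,y)` on `Ω(y,z,u,v)` contributes the
factors `[Y,Z](η(x,y) ω(y,z,u,v))`, and `η(x,y) ω(y,z,u,v) = (η ∧ ω)(x,y,z,u,v)` by
`evalForm_wedge`. What remains is the alternating sum of `ω` over the five faces, which is `dω` by
`evalForm_formDeriv`. The face `(y,z,u,v)` has another initial vertex than the rest; this is
harmless because the `Zⱼ` come from `R`.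

The bracket (`existsUnique_isLieBracket`). The commutator `Y(s)(Z(t)) Z(t)⁻¹` over the universal
ring `B[s,t]` is trivial for `s = 0` and for `t = 0`, so it involves only `st` and descends along
`B[ε] → B[s,t]`, `ε ↦ st`.

Local presentations (`exists_represents`). If `Ω[B⁄R]` is free, every 1-simplex is induced from one
over `B[εₖ]ₖ`, where the principle applies to `χ`. For `Ω`, consider its value on the universal
3-simplex. It is trivial on degenerate faces, so it differs from the unit of `G` by functions
vanishing there; these are values of three-forms (`exists_evalForm_eq`) and have zero products. The
value therefore factors through the first-order neighbourhood of the unit section, which is defined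
over `R`, and the principle yields coefficients in `Lie(G)(R)`. -/

namespace CombForms
noncomputable section

/-! ### Separated presheaves: `G` and `Aut(G)` -/

section Separation

open Limits

/-- Surjectivity settles the maps of spaces, and dominance makes pullback of sections along `q`
injective. The target `T` need not be separated. -/
theorem hom_ext_of_schemeTheoreticallyDominant {Y Z T : Scheme.{u}} (q : Y ⟶ Z)
    [IsSchemeTheoreticallyDominant q] [Surjective q] [QuasiCompact q] {f g : Z ⟶ T}
    (h : q ≫ f = q ≫ g) : f = g := by
  have hb : f.base = g.base := by
    ext z
    obtain ⟨y, rfl⟩ := q.surjective z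
    exact congr($h y)
  refine Scheme.Hom.ext hb fun U => ?_
  have key : (f.app U ≫ Z.presheaf.map (eqToHom (by rw [hb])).op) ≫ q.app (g ⁻¹ᵁ U) =
      g.app U ≫ q.app (g ⁻¹ᵁ U) := by
    exact (Category.assoc _ _ _).trans ((congrArg (f.app U ≫ ·) (q.naturality _)).trans
      ((Category.assoc _ _ _).symm.trans (Scheme.Hom.congr_app h.symm U).symm))
  ext s
  exact q.app_injective _ congr($key s)

theorem isSchemeTheoreticallyDominant_SpecMap {C D : CommRingCat.{u}} (φ : C ⟶ D)
    (hφ : Function.Injective φ) : IsSchemeTheoreticallyDominant (Spec.map φ) := by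
  rw [isSchemeTheoreticallyDominant_iff]
  refine Scheme.IdealSheafData.ext_of_isAffine ?_
  have h : Function.Injective (Spec.map φ).appTop := by
    rw [(Iso.inv_comp_eq _).mp (Scheme.ΓSpecIso_inv_naturality φ).symm]
    simp only [CommRingCat.hom_comp, RingHom.coe_comp]
    exact ((ConcreteCategory.bijective_of_isIso (Scheme.ΓSpecIso D).inv).1.comp hφ).comp
      (ConcreteCategory.bijective_of_isIso (Scheme.ΓSpecIso C).hom).1
  rw [(Spec.map φ).ker_apply ⟨⊤, isAffineOpen_top _⟩]
  exact (RingHom.injective_iff_ker_eq_bot _).mp h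

variable {S : Scheme.{u}} (G : Over S) [GrpObj G]

/-- A presheaf is separated if sections over `T` are determined by their restrictions to a Zariski
cover of a scheme that maps to `T` surjectively and scheme-theoretically dominantly. -/
def IsSeparatedPresheaf (F : (Over S)ᵒᵖ ⥤ GrpCat.{w}) : Prop :=
  ∀ {T : Over S} {Q : Scheme.{u}} (q : Q ⟶ T.left) [IsSchemeTheoreticallyDominant q]
    [Surjective q] [QuasiCompact q] (𝒰 : Scheme.OpenCover.{u} Q) (a b : F.obj (op T)),
    (∀ k, F.map (Over.homMk (𝒰.f k ≫ q) : Over.mk ((𝒰.f k ≫ q) ≫ T.hom) ⟶ T).op a =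
      F.map (Over.homMk (𝒰.f k ≫ q) : Over.mk ((𝒰.f k ≫ q) ≫ T.hom) ⟶ T).op b) → a = b

theorem yonedaGrpObj_isSeparatedPresheaf : IsSeparatedPresheaf (yonedaGrpObj G) := by
  intro T Q q _ _ _ 𝒰 a b h
  refine Over.OverMorphism.ext (hom_ext_of_schemeTheoreticallyDominant q ?_)
  refine 𝒰.hom_ext _ _ fun k => ?_
  have := congrArg (CommaMorphism.left (X := _)) (h k)
  exact (Category.assoc _ _ _).symm.trans (this.trans (Category.assoc _ _ _))

/-- By naturality an automorphism over `T` is determined by its value at the universal point `z` of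
`P = G_T`. Two such values are compared after base change of `q` along `G_T → T`; this map is flat,
so the base change is still scheme-theoretically dominant. -/
theorem autPresheaf_yonedaGrpObj_isSeparatedPresheaf [Flat G.hom] :
    IsSeparatedPresheaf (autPresheaf (yonedaGrpObj G)) := by
  intro T Q q _ _ _ 𝒰 a b h
  let F := yonedaGrpObj G
  let a' : Aut ((Over.forget T).op ⋙ F) := a
  let b' : Aut ((Over.forget T).op ⋙ F) := b
  change a' = b'
  let P : Over S := Over.mk (pullback.fst G.hom T.hom ≫ G.hom)
  let z : P ⟶ G := Over.homMk (pullback.fst _ _)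
  let π : P ⟶ T := Over.homMk (pullback.snd _ _) pullback.condition.symm
  have hπ : π.left = pullback.snd G.hom T.hom := rfl
  have hz : a'.hom.app (op (Over.mk π)) z = b'.hom.app (op (Over.mk π)) z := by
    have : Flat π.left := by rw [hπ]; infer_instance
    refine Over.OverMorphism.ext (hom_ext_of_schemeTheoreticallyDominant
      (pullback.snd q π.left) ?_)
    refine Scheme.Cover.hom_ext (𝒰.pullback₁ (pullback.fst q π.left)) _ _ fun k => ?_
    let m : pullback (pullback.fst q π.left) (𝒰.f k) ⟶ P.left :=
      pullback.fst _ _ ≫ pullback.snd q π.left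
    let T' : Over S := Over.mk ((𝒰.f k ≫ q) ≫ T.hom)
    let r : T' ⟶ T := Over.homMk (𝒰.f k ≫ q)
    let W : Over S := Over.mk (m ≫ P.hom)
    let mm : W ⟶ P := Over.homMk m
    have hsq : pullback.snd (pullback.fst q π.left) (𝒰.f k) ≫ 𝒰.f k ≫ q = m ≫ π.left := by
      rw [← Category.assoc, ← pullback.condition, Category.assoc, pullback.condition]
      exact (Category.assoc _ _ _).symm
    let n : W ⟶ T' := Over.homMk (pullback.snd (pullback.fst q π.left) (𝒰.f k))
      ((Category.assoc _ _ _).symm.trans ((congrArg (· ≫ T.hom) hsq).trans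
        ((Category.assoc _ _ _).trans (congrArg (m ≫ ·) (Over.w π)))))
    have hmn : mm ≫ π = n ≫ r := Over.OverMorphism.ext hsq.symm
    -- The two routes from `W` to `T`, through `P` and through the member `T'` of the cover, agree.
    -- Hence the restriction of the value at `z` is a value of the automorphism restricted to `T'`,
    -- where the hypothesis applies.
    have key : ∀ v : Aut ((Over.forget T).op ⋙ F), mm ≫ (v.hom.app (op (Over.mk π)) z : P ⟶ G) =
        v.hom.app (op (Over.mk (n ≫ r))) (mm ≫ z) := by
      intro v
      have h1 := ConcreteCategory.congr_hom
        (v.hom.naturality (Over.homMk mm : Over.mk (mm ≫ π) ⟶ Over.mk π).op) z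
      exact h1.symm.trans (aut_app_congr v hmn _)
    have h2 : a'.hom.app (op (Over.mk (n ≫ r))) (mm ≫ z) =
        b'.hom.app (op (Over.mk (n ≫ r))) (mm ≫ z) :=
      congr(Iso.hom (C := (Over T')ᵒᵖ ⥤ GrpCat) (X := (Over.forget T').op ⋙ F)
        (Y := (Over.forget T').op ⋙ F) $(h k) |>.app (op (Over.mk n)) (mm ≫ z))
    have h3 := (key a').trans (h2.trans (key b').symm)
    exact (Category.assoc _ _ _).symm.trans
      ((congrArg (CommaMorphism.left (X := _)) h3).trans (Category.assoc _ _ _))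
  ext Y y
  obtain ⟨Y⟩ := Y
  let y' : Y.left ⟶ G := y
  let l : Y.left ⟶ P := Over.homMk (pullback.lift y'.left Y.hom.left (by simp))
    ((pullback.lift_fst_assoc _ _ _ _).trans (Over.w y'))
  have hl : l ≫ π = Y.hom := Over.OverMorphism.ext (pullback.lift_snd _ _ _)
  have hl' : l ≫ z = y' := Over.OverMorphism.ext (pullback.lift_fst _ _ _)
  let m : Y ⟶ Over.mk π := Over.homMk l hl
  have key (v : Aut ((Over.forget T).op ⋙ F)) :
      v.hom.app (op Y) y = l ≫ (v.hom.app (op (Over.mk π)) z : P ⟶ G) :=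
    (congrArg (v.hom.app (op Y)) hl'.symm).trans
      (ConcreteCategory.congr_hom (v.hom.naturality m.op) z)
  exact (key a').trans ((congrArg (l ≫ ·) hz).trans (key b').symm)

namespace Chart

variable {X : Over S} {c : Chart X} {F : (Over S)ᵒᵖ ⥤ GrpCat.{w}}

/-- The family defines a map from the disjoint union of the `Spec (D k)` to `Spec C`. It is dominant
by joint injectivity and surjective because of the single index `k₀`; the components form the
Zariski cover. -/
theorem separated (hF : IsSeparatedPresheaf F) {C : Type u} [CommRing C] [Algebra c.R C]
    {ι : Type u} [Finite ι] {D : ι → Type u} [∀ k, CommRing (D k)] [∀ k, Algebra c.R (D k)]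
    (φ : ∀ k, C →ₐ[c.R] D k) (hφ : ∀ x, (∀ k, φ k x = 0) → x = 0)
    (k₀ : ι) (hk₀ : Function.Surjective (PrimeSpectrum.comap (φ k₀).toRingHom))
    (a b : F.obj (op (c.aff C)))
    (hab : ∀ k, F.map (c.map (φ k)).op a = F.map (c.map (φ k)).op b) : a = b := by
  let R (k : ι) : CommRingCat.{u} := .of (D k)
  let p : (CommRingCat.of C) ⟶ .of (∀ k, R k) := CommRingCat.ofHom (RingHom.pi fun k => (φ k).toRingHom)
  have hp : Function.Injective p := (injective_iff_map_eq_zero p.hom).2 fun x hx =>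
    hφ x fun k => congrFun hx k
  have := isSchemeTheoreticallyDominant_SpecMap p hp
  let q : (∐ fun k => Spec (R k)) ⟶ Spec (.of C) := sigmaSpec R ≫ Spec.map p
  have hq (k) : Sigma.ι (fun k => Spec (R k)) k ≫ q =
      Spec.map (CommRingCat.ofHom (φ k).toRingHom) := by
    simp only [q, ι_sigmaSpec_assoc]
    rw [← Spec.map_comp]
    rfl
  have h1 : IsSchemeTheoreticallyDominant q :=
    inferInstanceAs (IsSchemeTheoreticallyDominant (sigmaSpec R ≫ Spec.map p))
  have h2 : QuasiCompact q := by dsimp only [q]; infer_instance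
  have h3 : Surjective q := ⟨fun x => by
    obtain ⟨y, hy⟩ := hk₀ x
    let y' : Spec (R k₀) := y
    refine ⟨Sigma.ι (fun k => Spec (R k)) k₀ y', ?_⟩
    rw [← Scheme.Hom.comp_apply, hq]
    exact hy⟩
  refine @hF (c.aff C) _ q h1 h3 h2 (sigmaOpenCover fun k => Spec (R k)) a b fun (k : ι) => ?_
  let e : Over.mk (((sigmaOpenCover fun k => Spec (R k)).f k ≫ q) ≫ (c.aff C).hom) ⟶ c.aff (D k) :=
    Over.homMk (𝟙 (Spec (R k))) ((Category.id_comp _).trans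
      ((Over.w (c.map (φ k))).symm.trans (congrArg (· ≫ (c.aff C).hom) (hq k).symm)))
  have he : (Over.homMk ((sigmaOpenCover fun k => Spec (R k)).f k ≫ q) :
      Over.mk (((sigmaOpenCover fun k => Spec (R k)).f k ≫ q) ≫ (c.aff C).hom) ⟶ c.aff C) =
      e ≫ c.map (φ k) := Over.OverMorphism.ext ((hq k).trans (Category.id_comp _).symm)
  refine (congrArg (fun m => F.map m.op a) he).trans (Eq.trans ?_
    (congrArg (fun m => F.map m.op b) he).symm)
  beta_reduce
  rw [op_comp, F.map_comp, ConcreteCategory.comp_apply, ConcreteCategory.comp_apply, hab]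

end Chart

end Separation

/-- Every prime contains the nilpotent elements `x - s (f x)`, hence is the preimage under `f` of
its own preimage under `s`. -/
theorem comap_surjective_of_isNilpotent {C D : Type*} [CommRing C] [CommRing D] (f : C →+* D)
    (s : D →+* C) (h : ∀ x, IsNilpotent (x - s (f x))) :
    Function.Surjective (PrimeSpectrum.comap f) := fun p => by
  have hp (x : C) : x - s (f x) ∈ p.asIdeal :=
    nilpotent_iff_mem_prime.1 (h x) _ p.2
  refine ⟨PrimeSpectrum.comap s p, PrimeSpectrum.ext (Ideal.ext fun x => ?_)⟩
  simp only [PrimeSpectrum.comap_asIdeal, Ideal.mem_comap]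
  exact ⟨fun hx => by simpa using add_mem (hp x) hx, fun hx => by simpa using sub_mem hx (hp x)⟩

theorem prod_map_ite_eq_of_nodup {M ι : Type*} [Monoid M] [DecidableEq ι] (g : ι → M) (k : ι) (l : List ι)
    (hl : l.Nodup) (hk : k ∈ l) : (l.map fun j => if j = k then g j else 1).prod = g k := by
  induction l with
  | nil => simp at hk
  | cons a l ih =>
    rw [List.map_cons, List.prod_cons]
    obtain rfl | hk := List.mem_cons.1 hk
    · rw [if_pos rfl, List.prod_eq_one, mul_one]
      simp only [List.mem_map]
      rintro _ ⟨j, hj, rfl⟩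
      rw [if_neg]
      rintro rfl
      exact (List.nodup_cons.1 hl).1 hj
    · rw [if_neg, one_mul, ih (List.nodup_cons.1 hl).2 hk]
      rintro rfl
      exact (List.nodup_cons.1 hl).1 hk

/-! ### The ring `A[εₖ]ₖ` with all products `εₖ εₗ` zero -/

section MultiDual

variable {R A C κ : Type*} [CommRing R] [CommRing A] [CommRing C] [Algebra R A] [Algebra R C]

/-- The coordinate projection `A[εₖ]ₖ → A[ε]` of the trivial square-zero extension. -/
def multiDualProj (R : Type*) [CommRing R] [Algebra R A] (k : κ) :
    TrivSqZeroExt A (κ → A) →ₐ[R] DualNumber A :=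
  TrivSqZeroExt.lift (TrivSqZeroExt.inlAlgHom R A A)
    { toFun := fun v => TrivSqZeroExt.inr (v k)
      map_add' := fun _ _ => TrivSqZeroExt.inr_add A _ _
      map_smul' := fun _ _ => TrivSqZeroExt.inr_smul A _ _ }
    (fun _ _ => TrivSqZeroExt.inr_mul_inr A _ _)
    (fun r x => (TrivSqZeroExt.inl_mul_inr r (x k)).symm)
    (fun r x => (TrivSqZeroExt.inr_mul_inl r (x k)).symm)

/-- The generator `εₖ`. -/
def multiEps [DecidableEq κ] (k : κ) : TrivSqZeroExt A (κ → A) :=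
  TrivSqZeroExt.inr (Pi.single k 1)

theorem multiEps_mul [DecidableEq κ] (k l : κ) : (multiEps k * multiEps l : TrivSqZeroExt A (κ → A)) = 0 := by
  simp [multiEps]

theorem multiDualProj_inl (k : κ) (a : A) :
    multiDualProj R k (TrivSqZeroExt.inl a) = TrivSqZeroExt.inl a := by
  simp [multiDualProj]

theorem multiDualProj_inr (k : κ) (v : κ → A) :
    multiDualProj R k (TrivSqZeroExt.inr v) = TrivSqZeroExt.inr (v k) := by
  simp [multiDualProj]

theorem multiDualProj_eps [DecidableEq κ] (k l : κ) :
    multiDualProj R k (multiEps l : TrivSqZeroExt A (κ → A)) = if l = k then DualNumber.eps else 0 := by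
  rw [multiEps, multiDualProj_inr, Pi.single_apply]
  simp only [eq_comm (a := k)]
  split_ifs
  · rfl
  · simp

/-- The homomorphism on `A[εₖ]ₖ` with given values `mₖ` at the `εₖ`. -/
def multiDualLift [Fintype κ] (f : A →ₐ[R] C) (m : κ → C) (hm : ∀ k l, m k * m l = 0) :
    TrivSqZeroExt A (κ → A) →ₐ[R] C :=
  TrivSqZeroExt.lift f
    { toFun v := ∑ k, f (v k) * m k
      map_add' v w := by simp [add_mul, Finset.sum_add_distrib]
      map_smul' r v := by simp [Finset.smul_sum] }
    (fun x y => by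
      simp only [LinearMap.coe_mk, AddHom.coe_mk, Finset.sum_mul_sum]
      refine Finset.sum_eq_zero fun i _ => Finset.sum_eq_zero fun j _ => ?_
      linear_combination (f (x i) * f (y j)) * hm i j)
    (fun r x => by simp [Finset.mul_sum, mul_assoc])
    (fun r x => by
      simp only [LinearMap.coe_mk, AddHom.coe_mk, Finset.sum_mul]
      refine Finset.sum_congr rfl fun i _ => ?_
      simp only [Pi.smul_apply, MulOpposite.smul_eq_mul_unop, MulOpposite.unop_op, map_mul]
      ring)

theorem multiDualLift_inl [Fintype κ] (f : A →ₐ[R] C) (m : κ → C) (hm : ∀ k l, m k * m l = 0) (a : A) :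
    multiDualLift f m hm (TrivSqZeroExt.inl a) = f a := by
  simp [multiDualLift]

theorem multiDualLift_inr [Fintype κ] (f : A →ₐ[R] C) (m : κ → C) (hm : ∀ k l, m k * m l = 0)
    (v : κ → A) : multiDualLift f m hm (TrivSqZeroExt.inr v) = ∑ k, f (v k) * m k := by
  simp [multiDualLift]

theorem multiDualLift_eps [Fintype κ] [DecidableEq κ] (f : A →ₐ[R] C) (m : κ → C)
    (hm : ∀ k l, m k * m l = 0) (k : κ) : multiDualLift f m hm (multiEps k) = m k := by
  rw [multiEps, multiDualLift_inr, Finset.sum_eq_single k]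
  · simp
  · intro j _ hj; simp [hj]
  · simp

end MultiDual

/-! ### Calculus of the elements `Z(t)` -/

namespace Chart

variable {S : Scheme.{u}} {X : Over S} {c : Chart X} {F : (Over S)ᵒᵖ ⥤ GrpCat.{w}}
  {A C D : Type u} [CommRing A] [CommRing C] [CommRing D] [Algebra c.R A] [Algebra c.R C]
  [Algebra c.R D]

variable (F) in
/-- The map `F(C) → F(D)` induced by a homomorphism of `R`-algebras. -/
def res (f : C →ₐ[c.R] D) : F.obj (op (c.aff C)) →* F.obj (op (c.aff D)) := (F.map (c.map f).op).hom

theorem res_res {E : Type u} [CommRing E] [Algebra c.R E] (f : C →ₐ[c.R] D) (g : D →ₐ[c.R] E)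
    (x : F.obj (op (c.aff C))) : res F g (res F f x) = res F (g.comp f) x := by
  change F.map _ (F.map _ x) = F.map _ x
  rw [← ConcreteCategory.comp_apply, ← F.map_comp, ← op_comp, map_map]

theorem map_id : c.map (AlgHom.id c.R C) = 𝟙 _ := by
  ext : 1
  exact Spec.map_id _

theorem res_id (x : F.obj (op (c.aff C))) : res F (AlgHom.id c.R C) x = x := by
  change F.map _ x = x
  rw [map_id, op_id, F.map_id]; rfl

theorem res_lieEval (Z : c.lie A F) (f : A →ₐ[c.R] C) (t : C) (ht : t * t = 0) (g : C →ₐ[c.R] D) :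
    res F g (lieEval Z f t ht) = lieEval Z (g.comp f) (g t) (by rw [← map_mul, ht, map_zero]) := by
  refine (res_res _ _ _).trans (congrArg (fun h => F.map (c.map h).op Z.1) ?_)
  ext <;> simp

theorem lieEval_zero (Z : c.lie A F) (f : A →ₐ[c.R] C) : lieEval Z f 0 (mul_zero _) = 1 := by
  have hZ : res F (TrivSqZeroExt.fstHom c.R A A) Z.1 = 1 := Z.2
  have h : lieEval Z f 0 (mul_zero _) = res F (f.comp (TrivSqZeroExt.fstHom c.R A A)) Z.1 := by
    refine congrArg (fun h => F.map (c.map h).op Z.1) ?_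
    ext <;> simp
  rw [h, ← res_res, hZ, map_one]

theorem lieEval_congr (Z : c.lie A F) {f g : A →ₐ[c.R] C} {t t' : C} (hf : f = g) (h : t = t')
    (ht : t * t = 0) : lieEval Z f t ht = lieEval Z g t' (h ▸ ht) := by subst h hf; rfl

theorem lieEval_eq_one (Z : c.lie A F) (f : A →ₐ[c.R] C) (t : C) (ht : t * t = 0) (h : t = 0) :
    lieEval Z f t ht = 1 := (lieEval_congr Z rfl h ht).trans (lieEval_zero Z f)

theorem lieEval_inl_eps (Z : c.lie A F) :
    lieEval Z (TrivSqZeroExt.inlAlgHom c.R A A) DualNumber.eps DualNumber.eps_mul_eps = Z.1 := by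
  refine (congrArg (fun h => F.map (c.map h).op Z.1) DualNumber.lift_inlAlgHom_eps).trans ?_
  exact res_id _

theorem lieEval_lieMap (Z : c.lie A F) (f : A →ₐ[c.R] C) (g : C →ₐ[c.R] D) (t : D)
    (ht : t * t = 0) : lieEval (lieMap f Z) g t ht = lieEval Z (g.comp f) t ht := by
  refine (res_lieEval Z _ _ DualNumber.eps_mul_eps _).trans (lieEval_congr Z ?_ (by simp) _)
  ext; simp

theorem res_multiDualProj_lieEval {κ : Type u} [DecidableEq κ] (Z : c.lie A F) (j k : κ) :
    res F (multiDualProj c.R k) (lieEval Z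
      (TrivSqZeroExt.inlAlgHom c.R A (κ → A)) (multiEps j) (multiEps_mul j j)) =
      if j = k then Z.1 else 1 := by
  refine (res_lieEval _ _ _ _ _).trans ?_
  split_ifs with hjk
  · subst hjk
    refine (lieEval_congr Z ?_ ?_ _).trans (lieEval_inl_eps Z)
    · exact AlgHom.ext fun x => multiDualProj_inl (R := c.R) j x
    · rw [multiDualProj_eps, if_pos rfl]
  · exact lieEval_eq_one _ _ _ _ (by rw [multiDualProj_eps, if_neg hjk])

/-- An element of `A[εₖ]ₖ` is determined by its constant term and its projections to `A[ε]`, so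
separatedness applies. -/
theorem multiDual_ext (hF : IsSeparatedPresheaf F) {κ : Type u} [Finite κ] {u v : F.obj (op (c.aff (TrivSqZeroExt A (κ → A))))}
    (h0 : res F (TrivSqZeroExt.fstHom c.R A (κ → A)) u = res F (TrivSqZeroExt.fstHom c.R A (κ → A)) v)
    (h : ∀ k, res F (multiDualProj c.R k) u = res F (multiDualProj c.R k) v) : u = v := by
  -- The extra index `none` records the constant term, embedded in `A[ε]` to give all targets the
  -- same form. It ensures joint injectivity when `κ` is empty and provides surjectivity on spectra.
  let φ (k : Option κ) : TrivSqZeroExt A (κ → A) →ₐ[c.R] DualNumber A :=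
    k.elim ((TrivSqZeroExt.inlAlgHom c.R A A).comp (TrivSqZeroExt.fstHom c.R A (κ → A)))
      (multiDualProj c.R)
  refine separated hF φ (fun x hx => ?_) none ?_ u v fun k => ?_
  · have h0 : x.fst = 0 := congrArg TrivSqZeroExt.fst (hx none)
    have h1 (k : κ) : multiDualProj c.R k x = 0 := hx (some k)
    refine TrivSqZeroExt.ext h0 (funext fun k => ?_)
    have := h1 k
    rw [← TrivSqZeroExt.inl_fst_add_inr_snd_eq x, h0, map_add, multiDualProj_inl,
      multiDualProj_inr] at this
    simpa using congrArg TrivSqZeroExt.snd this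
  · change Function.Surjective (PrimeSpectrum.comap ((TrivSqZeroExt.inlAlgHom c.R A A).toRingHom.comp
      (TrivSqZeroExt.fstHom c.R A (κ → A)).toRingHom))
    rw [PrimeSpectrum.comap_comp]
    refine .comp (g := PrimeSpectrum.comap _) ?_ ?_
    · refine comap_surjective_of_isNilpotent _ (TrivSqZeroExt.inlHom A (κ → A)) fun x => ⟨2, ?_⟩
      have : x - TrivSqZeroExt.inlHom A (κ → A) (TrivSqZeroExt.fst x) = TrivSqZeroExt.inr x.snd := by
        rw [sub_eq_iff_eq_add']
        exact (TrivSqZeroExt.inl_fst_add_inr_snd_eq x).symm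
      refine (congrArg (· ^ 2) this).trans ?_
      simp only [pow_two, TrivSqZeroExt.inr_mul_inr]
    · exact comap_surjective_of_isNilpotent _ (TrivSqZeroExt.fstHom c.R A A).toRingHom fun x => by
        simp
  · match k with
    | none =>
      have := congrArg (res F (TrivSqZeroExt.inlAlgHom c.R A A)) h0
      rwa [res_res, res_res] at this
    | some k => exact h k

/-- A section over `A[εₖ]ₖ` that is trivial over `A` is the product of its components along
the `εₖ`. -/
theorem exists_eq_prod_lieEval (hF : IsSeparatedPresheaf F) {κ : Type u} [Fintype κ] [DecidableEq κ]
    (u : F.obj (op (c.aff (TrivSqZeroExt A (κ → A)))))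
    (hu : res F (TrivSqZeroExt.fstHom c.R A (κ → A)) u = 1) :
    ∃ Y : κ → c.lie A F, u = (Finset.univ.toList.map fun k => lieEval (Y k)
      (TrivSqZeroExt.inlAlgHom c.R A (κ → A)) (multiEps k) (multiEps_mul k k)).prod := by
  have hY (k : κ) : res F (multiDualProj c.R k) u ∈ c.lie A F := by
    change res F _ _ = 1
    rw [res_res, ← hu]
    refine congrArg (fun h => F.map (c.map h).op u) ?_
    refine AlgHom.ext fun x => ?_
    rw [← TrivSqZeroExt.inl_fst_add_inr_snd_eq x, map_add, map_add, AlgHom.comp_apply,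
      AlgHom.comp_apply, multiDualProj_inl, multiDualProj_inr]
    simp
  obtain ⟨Y, hYu⟩ : ∃ Y : κ → c.lie A F, ∀ k, (Y k).1 = res F (multiDualProj c.R k) u :=
    ⟨fun k => ⟨_, hY k⟩, fun _ => rfl⟩
  refine ⟨Y, multiDual_ext hF ?_ fun k => ?_⟩
  · refine hu.trans ?_
    rw [map_list_prod, List.prod_eq_one]
    simp only [List.map_map, List.mem_map]
    rintro _ ⟨k, _, rfl⟩
    refine (res_lieEval _ _ _ _ _).trans (lieEval_eq_one _ _ _ _ ?_)
    simp [multiEps]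
  · rw [map_list_prod, List.map_map, ← hYu]
    refine (prod_map_ite_eq_of_nodup (fun j => (Y j).1) k _
      (Finset.nodup_toList Finset.univ) (by simp)).symm.trans ?_
    exact congrArg List.prod (List.map_congr_left fun j _ =>
      (res_multiDualProj_lieEval (Y j) j k).symm)

/-- The universal case is `A[ε₁, ε₂]` with `ε₁ ε₂ = 0`. There each projection to `A[ε]` kills one of
the two factors, so both orders have the same components; then specialize `ε₁ ↦ a`, `ε₂ ↦ b`. -/
theorem lieEval_comm (hF : IsSeparatedPresheaf F) (Z W : c.lie A F) (f : A →ₐ[c.R] C) (a b : C) (ha : a * a = 0) (hb : b * b = 0)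
    (hab : a * b = 0) : lieEval Z f a ha * lieEval W f b hb = lieEval W f b hb * lieEval Z f a ha := by
  let κ := ULift.{u} Bool
  let e (i : Bool) : TrivSqZeroExt A (κ → A) := multiEps ⟨i⟩
  have he (i : Bool) : e i * e i = 0 := multiEps_mul _ _
  have hp (i j : Bool) : multiDualProj c.R (⟨i⟩ : κ) (e j) = if j = i then DualNumber.eps else 0 :=
    (multiDualProj_eps _ _).trans (by simp [ULift.ext_iff])
  have hm : ∀ k l : κ, cond k.down a b * cond l.down a b = 0 := by
    rintro ⟨_ | _⟩ ⟨_ | _⟩ <;> simp [ha, hb, hab, mul_comm b a]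
  let θ : TrivSqZeroExt A (κ → A) →ₐ[c.R] C := multiDualLift f (fun k => cond k.down a b) hm
  have hθ : θ.comp (TrivSqZeroExt.inlAlgHom c.R A (κ → A)) = f :=
    AlgHom.ext fun x => multiDualLift_inl f _ hm x
  have hθ1 : θ (e true) = a := multiDualLift_eps f _ hm _
  have hθ2 : θ (e false) = b := multiDualLift_eps f _ hm _
  have key : lieEval Z (TrivSqZeroExt.inlAlgHom c.R A (κ → A)) (e true) (he _) *
      lieEval W (TrivSqZeroExt.inlAlgHom c.R A (κ → A)) (e false) (he _) =
      lieEval W (TrivSqZeroExt.inlAlgHom c.R A (κ → A)) (e false) (he _) *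
      lieEval Z (TrivSqZeroExt.inlAlgHom c.R A (κ → A)) (e true) (he _) := by
    refine multiDual_ext hF ?_ ?_
    · simp only [map_mul, res_lieEval]
      rw [lieEval_eq_one Z _ _ _ (by simp [e, multiEps])]
      simp
    · rintro ⟨_ | _⟩
      · simp only [map_mul, res_lieEval]
        rw [lieEval_eq_one Z _ _ _ (by simp [hp])]
        simp
      · simp only [map_mul, res_lieEval]
        rw [lieEval_eq_one W _ _ _ (by simp [hp])]
        simp
  have := congrArg (res F θ) key
  rw [map_mul, map_mul, res_lieEval, res_lieEval] at this
  rwa [lieEval_congr Z hθ hθ1, lieEval_congr W hθ hθ2] at this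

/-- As for commutation: over `A[ε₁, ε₂]` the two sides have the same components, because each
projection retains only one of the generators. -/
theorem lieEval_add (hF : IsSeparatedPresheaf F) (Z : c.lie A F) (f : A →ₐ[c.R] C) (a b : C) (ha : a * a = 0) (hb : b * b = 0)
    (hab : a * b = 0) : lieEval Z f (a + b) (by linear_combination ha + hb + 2 * hab) =
      lieEval Z f a ha * lieEval Z f b hb := by
  let κ := ULift.{u} Bool
  let e (i : Bool) : TrivSqZeroExt A (κ → A) := multiEps ⟨i⟩
  have he (i : Bool) : e i * e i = 0 := multiEps_mul _ _
  have hp (i j : Bool) : multiDualProj c.R (⟨i⟩ : κ) (e j) = if j = i then DualNumber.eps else 0 :=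
    (multiDualProj_eps _ _).trans (by simp [ULift.ext_iff])
  have hm : ∀ k l : κ, cond k.down a b * cond l.down a b = 0 := by
    rintro ⟨_ | _⟩ ⟨_ | _⟩ <;> simp [ha, hb, hab, mul_comm b a]
  let θ : TrivSqZeroExt A (κ → A) →ₐ[c.R] C := multiDualLift f (fun k => cond k.down a b) hm
  have hθ : θ.comp (TrivSqZeroExt.inlAlgHom c.R A (κ → A)) = f :=
    AlgHom.ext fun x => multiDualLift_inl f _ hm x
  have hθ1 : θ (e true) = a := multiDualLift_eps f _ hm _
  have hθ2 : θ (e false) = b := multiDualLift_eps f _ hm _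
  have he' : (e true + e false) * (e true + e false) = 0 := by
    simp [mul_add, add_mul, e, multiEps_mul]
  have key : lieEval Z (TrivSqZeroExt.inlAlgHom c.R A (κ → A)) (e true + e false) he' =
      lieEval Z (TrivSqZeroExt.inlAlgHom c.R A (κ → A)) (e true) (he _) *
      lieEval Z (TrivSqZeroExt.inlAlgHom c.R A (κ → A)) (e false) (he _) := by
    refine multiDual_ext hF ?_ ?_
    · simp only [map_mul, res_lieEval]
      rw [lieEval_eq_one Z _ _ _ (by simp [e, multiEps]), lieEval_eq_one Z _ _ _ (by simp [e, multiEps]),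
        lieEval_eq_one Z _ _ _ (by simp [e, multiEps])]
      simp
    · rintro ⟨_ | _⟩
      · simp only [map_mul, res_lieEval]
        rw [lieEval_eq_one Z _ (multiDualProj c.R _ (e true)) _ (by simp [hp]), one_mul]
        exact lieEval_congr Z rfl (by simp [hp]) _
      · simp only [map_mul, res_lieEval]
        rw [lieEval_eq_one Z _ (multiDualProj c.R _ (e false)) _ (by simp [hp]), mul_one]
        exact lieEval_congr Z rfl (by simp [hp]) _
  have := congrArg (res F θ) key
  rw [map_mul, res_lieEval, res_lieEval, res_lieEval] at this
  rw [lieEval_congr Z hθ hθ1, lieEval_congr Z hθ hθ2,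
    lieEval_congr Z hθ ((map_add θ _ _).trans (congrArg₂ _ hθ1 hθ2))] at this
  exact this

end Chart

/-! ### Values of differential forms on simplices and their faces -/

section FormIdentities

variable {R B C : Type u} [CommRing R] [CommRing B] [CommRing C] [Algebra R B] [Algebra R C]

open KaehlerDifferential in
theorem form_induction {n : ℕ} {p : ⋀[B]^n Ω[B⁄R] → Prop} (ω : ⋀[B]^n Ω[B⁄R])
    (hD : ∀ (c : B) (b : Fin n → B), p (c • exteriorPower.ιMulti B n fun i => D R B (b i)))
    (hadd : ∀ ω ω', p ω → p ω' → p (ω + ω')) : p ω := by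
  have h := exteriorPower.ιMulti_span_of_span B n Ω[B⁄R] (span_range_derivation R B)
  have hω : ω ∈ Submodule.span B (exteriorPower.ιMulti B n '' {a | Set.range a ⊆ Set.range (D R B)}) := by
    rw [h]; trivial
  induction hω using Submodule.closure_induction with
  | zero => simpa using hD 0 (fun _ => 0)
  | add x y _ _ hx hy => exact hadd x y hx hy
  | smul_mem r x hx =>
    obtain ⟨a, ha, rfl⟩ := hx
    choose b hb using fun i => ha ⟨i, rfl⟩
    obtain rfl : (fun i => D R B (b i)) = a := funext hb
    exact hD r b

theorem formDeriv_add {n : ℕ} (ω ω' : ⋀[B]^n Ω[B⁄R]) :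
    formDeriv (ω + ω') = formDeriv ω + formDeriv ω' := by
  ext
  simp [formDeriv, Jet.ofForm_add]

theorem wedge_add_left {m n : ℕ} (η η' : ⋀[B]^m Ω[B⁄R]) (ω : ⋀[B]^n Ω[B⁄R]) :
    wedge (η + η') ω = wedge η ω + wedge η' ω := by
  ext; simp [wedge, add_mul]

theorem wedge_add_right {m n : ℕ} (η : ⋀[B]^m Ω[B⁄R]) (ω ω' : ⋀[B]^n Ω[B⁄R]) :
    wedge η (ω + ω') = wedge η ω + wedge η ω' := by
  ext; simp [wedge, mul_add]

theorem wedge_smul_ιMulti (a c : B) (u : Fin 1 → Ω[B⁄R]) (v : Fin 3 → Ω[B⁄R]) :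
    wedge (a • exteriorPower.ιMulti B 1 u) (c • exteriorPower.ιMulti B 3 v) =
      ((a * c) • exteriorPower.ιMulti B 4 (Matrix.vecCons (u 0) v) : ⋀[B]^4 Ω[B⁄R]) := by
  ext
  simp [wedge, ExteriorAlgebra.ιMulti_succ_apply, mul_smul, ExteriorAlgebra.ιMulti_zero_apply,
    smul_comm c a]

variable {n : ℕ} (y : Fin (n + 1) → (B →ₐ[R] C)) (hy : IsSimplex fun i => (y i : B →+* C))

theorem evalForm_smul_ιMulti_D (c : B) (b : Fin n → B) :
    evalForm y hy (c • exteriorPower.ιMulti B n fun i => KaehlerDifferential.D R B (b i)) =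
      y 0 c * ∏ i, (y i.succ (b i) - y 0 (b i)) := by
  simp only [evalForm_smul, evalForm_ιMulti, edge_D]

/-- The ideal generated by the differences of the vertices of a simplex. -/
def simplexIdeal (y : Fin (n + 1) → (B →ₐ[R] C)) : Ideal C :=
  ∑ i : Fin n, Ideal.span (Set.range fun b => y i.succ b - y 0 b)

theorem sub_mem_simplexIdeal (i j : Fin (n + 1)) (b : B) : y i b - y j b ∈ simplexIdeal y := by
  have h (i : Fin (n + 1)) : y i b - y 0 b ∈ simplexIdeal y := by
    refine Fin.cases (by simp) (fun i => ?_) i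
    rw [simplexIdeal, Ideal.sum_eq_sup]
    exact Finset.le_sup (f := fun i : Fin n => Ideal.span (Set.range fun b => y i.succ b - y 0 b))
      (Finset.mem_univ i) (Ideal.subset_span ⟨b, rfl⟩)
  simpa using sub_mem (h i) (h j)

include hy in
-- The ideal is a sum of `n` ideals, one for each edge issuing from the initial vertex, and each of
-- these has square zero.
theorem simplexIdeal_pow : simplexIdeal y ^ (n + 1) = 0 := by
  suffices ∀ s : Finset (Fin n),
      (∑ i ∈ s, Ideal.span (Set.range fun b => y i.succ b - y 0 b)) ^ (s.card + 1) = 0 by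
    simpa [simplexIdeal] using this Finset.univ
  intro s
  induction s using Finset.induction_on with
  | empty => simp
  | insert a s ha ih =>
    have hsq : Ideal.span (Set.range fun b => y a.succ b - y 0 b) ^ 2 = 0 := by
      rw [pow_two, Ideal.span_mul_span', Ideal.zero_eq_bot, Ideal.span_eq_bot]
      rintro _ ⟨_, ⟨b, rfl⟩, _, ⟨b', rfl⟩, rfl⟩
      exact hy.mul_eq_zero a.succ 0 b b'
    rw [Finset.sum_insert ha, Finset.card_insert_of_notMem ha, add_pow]
    refine Finset.sum_eq_zero fun k hk => ?_
    -- In the binomial expansion the terms with `k ≥ 2` contain the square of the new ideal; those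
    -- with `k ≤ 1` contain the power of the old sum that vanishes by induction.
    match k with
    | 0 => rw [Nat.sub_zero, pow_succ _ (s.card + 1), ih]; simp
    | 1 => rw [Nat.add_sub_cancel, ih]; simp
    | k + 2 => rw [pow_add, hsq]; simp

/-- Each of the `m` factors `dbᵢ` contributes a difference of two vertices of the big simplex. -/
theorem evalForm_mem_simplexIdeal {m : ℕ} (σ : Fin (m + 1) → Fin (n + 1)) (ω : ⋀[B]^m Ω[B⁄R]) :
    evalForm (fun i => y (σ i)) (hy.precomp σ) ω ∈ simplexIdeal y ^ m := by
  induction ω using form_induction with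
  | hD c b =>
    rw [evalForm_smul_ιMulti_D]
    refine Ideal.mul_mem_left _ _ ?_
    have := Ideal.prod_mem_prod (s := Finset.univ) (I := fun _ : Fin m => simplexIdeal y)
      fun (i : Fin m) _ => sub_mem_simplexIdeal y (σ i.succ) (σ 0) (b i)
    simpa using this
  | hadd ω ω' h h' => rw [map_add]; exact add_mem h h'

theorem mul_eq_zero_of_mem_simplexIdeal_pow {k l : ℕ} (hkl : n < k + l) {a b : C}
    (ha : a ∈ simplexIdeal y ^ k) (hb : b ∈ simplexIdeal y ^ l) (hy : IsSimplex fun i => (y i : B →+* C)) :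
    a * b = 0 := by
  have h := Ideal.pow_le_pow_right (I := simplexIdeal y) (Nat.succ_le_of_lt hkl)
    (pow_add (simplexIdeal y) k l ▸ Ideal.mul_mem_mul ha hb)
  rw [Nat.succ_eq_add_one, simplexIdeal_pow y hy] at h
  simpa using h

end FormIdentities

section FourSimplex

variable {R B C : Type u} [CommRing R] [CommRing B] [CommRing C] [Algebra R B] [Algebra R C]
  (y : Fin 5 → (B →ₐ[R] C)) (hy : IsSimplex fun i => (y i : B →+* C))

/-- Expand around vertex `0`. On the face `(1,2,3,4)` the terms with two differences along the edge
`01` vanish, since that edge is square-zero. The surviving terms cancel against the other faces by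
the antisymmetry coming from the strong simplex condition. -/
theorem evalForm_formDeriv (ω : ⋀[B]^3 Ω[B⁄R]) :
    evalForm y hy (formDeriv ω) =
      evalForm (fun i => y (![1, 2, 3, 4] i)) (hy.precomp _) ω
        - evalForm (fun i => y (![0, 2, 3, 4] i)) (hy.precomp _) ω
        + evalForm (fun i => y (![0, 1, 3, 4] i)) (hy.precomp _) ω
        - evalForm (fun i => y (![0, 1, 2, 4] i)) (hy.precomp _) ω
        + evalForm (fun i => y (![0, 1, 2, 3] i)) (hy.precomp _) ω := by
  induction ω using form_induction with
  | hadd ω ω' h h' => simp only [formDeriv_add, map_add, h, h']; ring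
  | hD c b =>
    simp only [formDeriv_smul_ιMulti, evalForm_smul_ιMulti_D, evalForm_ιMulti, Fin.prod_univ_succ,
      Fin.prod_univ_zero, mul_one]
    simp only [Matrix.cons_val_zero, Matrix.cons_val_succ, edge_D]
    change (y 1 c - y 0 c) * ((y 2 (b 0) - y 0 (b 0)) * ((y 3 (b 1) - y 0 (b 1)) *
      (y 4 (b 2) - y 0 (b 2)))) =
      y 1 c * ((y 2 (b 0) - y 1 (b 0)) * ((y 3 (b 1) - y 1 (b 1)) * (y 4 (b 2) - y 1 (b 2)))) -
      y 0 c * ((y 2 (b 0) - y 0 (b 0)) * ((y 3 (b 1) - y 0 (b 1)) * (y 4 (b 2) - y 0 (b 2)))) +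
      y 0 c * ((y 1 (b 0) - y 0 (b 0)) * ((y 3 (b 1) - y 0 (b 1)) * (y 4 (b 2) - y 0 (b 2)))) -
      y 0 c * ((y 1 (b 0) - y 0 (b 0)) * ((y 2 (b 1) - y 0 (b 1)) * (y 4 (b 2) - y 0 (b 2)))) +
      y 0 c * ((y 1 (b 0) - y 0 (b 0)) * ((y 2 (b 1) - y 0 (b 1)) * (y 3 (b 2) - y 0 (b 2))))
    have t0 := hy.mul_eq_zero 1 0 c (b 0)
    have t1 := hy.mul_eq_zero 1 0 c (b 1)
    have t2 := hy.mul_eq_zero 1 0 c (b 2)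
    have s01 := hy.mul_eq_zero 1 0 (b 0) (b 1)
    have s02 := hy.mul_eq_zero 1 0 (b 0) (b 2)
    have s12 := hy.mul_eq_zero 1 0 (b 1) (b 2)
    have p1 := hy.polar 2 1 (b 0) (b 1)
    have p2 := hy.polar 3 1 (b 1) (b 2)
    simp only [AlgHom.coe_toRingHom] at t0 t1 t2 s01 s02 s12 p1 p2
    obtain ⟨c1, hc1⟩ : ∃ z, y 1 c = y 0 c + z := ⟨_, (add_sub_cancel _ _).symm⟩
    obtain ⟨H10, h10⟩ : ∃ z, y 1 (b 0) = y 0 (b 0) + z := ⟨_, (add_sub_cancel _ _).symm⟩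
    obtain ⟨H11, h11⟩ : ∃ z, y 1 (b 1) = y 0 (b 1) + z := ⟨_, (add_sub_cancel _ _).symm⟩
    obtain ⟨H12, h12⟩ : ∃ z, y 1 (b 2) = y 0 (b 2) + z := ⟨_, (add_sub_cancel _ _).symm⟩
    obtain ⟨H20, h20⟩ : ∃ z, y 2 (b 0) = y 0 (b 0) + z := ⟨_, (add_sub_cancel _ _).symm⟩
    obtain ⟨H21, h21⟩ : ∃ z, y 2 (b 1) = y 0 (b 1) + z := ⟨_, (add_sub_cancel _ _).symm⟩
    obtain ⟨H31, h31⟩ : ∃ z, y 3 (b 1) = y 0 (b 1) + z := ⟨_, (add_sub_cancel _ _).symm⟩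
    obtain ⟨H32, h32⟩ : ∃ z, y 3 (b 2) = y 0 (b 2) + z := ⟨_, (add_sub_cancel _ _).symm⟩
    obtain ⟨H42, h42⟩ : ∃ z, y 4 (b 2) = y 0 (b 2) + z := ⟨_, (add_sub_cancel _ _).symm⟩
    simp only [hc1, h10, h11, h12, h20, h21, h31, h32, h42, add_sub_cancel_left, add_sub_add_left_eq_sub]
      at t0 t1 t2 s01 s02 s12 p1 p2 ⊢
    generalize y 0 c = c0 at *
    -- The relations `t` and `s` remove products of two differences along `01`; `p1` and `p2`
    -- exchange vertex `1` with vertices `2` and `3`, respectively.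
    linear_combination t2 * (H20 * H31) + t1 * (H20 * H42 - H20 * H12)
      + t0 * (H31 * H42 - H31 * H12 - H11 * H42 + H11 * H12)
      - c0 * (s12 * (H20 - H10) + s02 * H31 + s01 * H42 )
      + c0 * (H42 - H32) * p1 + c0 * H20 * p2

/-- Moving the base point of `ω` from vertex `0` to vertex `1` changes each factor by a difference
along the edge `01`, and `η(x,y)` annihilates all such differences. -/
theorem evalForm_wedge (η : ⋀[B]^1 Ω[B⁄R]) (ω : ⋀[B]^3 Ω[B⁄R]) :
    evalForm y hy (wedge η ω) = evalForm (fun i => y (![0, 1] i)) (hy.precomp ![0, 1]) η *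
      evalForm (fun i => y (![1, 2, 3, 4] i)) (hy.precomp ![1, 2, 3, 4]) ω := by
  induction η using form_induction with
  | hadd η η' h h' => rw [wedge_add_left, map_add, h, h', map_add, add_mul]
  | hD a b' =>
    induction ω using form_induction with
    | hadd ω ω' h h' => rw [wedge_add_right, map_add, h, h', map_add, mul_add]
    | hD c b =>
      simp only [wedge_smul_ιMulti, evalForm_ιMulti, evalForm_smul,
        Fin.prod_univ_succ, Fin.prod_univ_zero, mul_one]
      simp only [Matrix.cons_val_zero, Matrix.cons_val_succ, edge_D]
      change y 0 (a * c) * ((y 1 (b' 0) - y 0 (b' 0)) * ((y 2 (b 0) - y 0 (b 0)) *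
        ((y 3 (b 1) - y 0 (b 1)) * (y 4 (b 2) - y 0 (b 2))))) =
        y 0 a * (y 1 (b' 0) - y 0 (b' 0)) * (y 1 c * ((y 2 (b 0) - y 1 (b 0)) *
          ((y 3 (b 1) - y 1 (b 1)) * (y 4 (b 2) - y 1 (b 2)))))
      have t := hy.mul_eq_zero 1 0 (b' 0) c
      have t0 := hy.mul_eq_zero 1 0 (b' 0) (b 0)
      have t1 := hy.mul_eq_zero 1 0 (b' 0) (b 1)
      have t2 := hy.mul_eq_zero 1 0 (b' 0) (b 2)
      simp only [AlgHom.coe_toRingHom, map_mul] at t t0 t1 t2 ⊢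
      generalize y 1 (b' 0) - y 0 (b' 0) = x at *
      linear_combination -y 0 a * ((y 2 (b 0) - y 1 (b 0)) *
          ((y 3 (b 1) - y 1 (b 1)) * (y 4 (b 2) - y 1 (b 2)))) * t + y 0 a * y 0 c *
        (t0 * ((y 3 (b 1) - y 1 (b 1)) * (y 4 (b 2) - y 1 (b 2))) + (y 2 (b 0) - y 0 (b 0)) *
          (t1 * (y 4 (b 2) - y 1 (b 2)) + (y 3 (b 1) - y 0 (b 1)) * t2))

end FourSimplex

/-! ### Ordered products of commuting elements and the formula for `δ³_χ(Ω)` -/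

theorem list_prod_map_mul_of_commute {ι M : Type*} [Monoid M] (l : List ι) (f g : ι → M)
    (h : ∀ i ∈ l, ∀ j ∈ l, Commute (f i) (g j)) :
    (l.map fun i => f i * g i).prod = (l.map f).prod * (l.map g).prod := by
  induction l with
  | nil => simp
  | cons a l ih =>
    have hc : Commute (g a) (l.map f).prod := Commute.list_prod_right _ _ fun x hx => by
      obtain ⟨i, hi, rfl⟩ := List.mem_map.1 hx
      exact (h i (List.mem_cons_of_mem _ hi) a List.mem_cons_self).symm
    simp only [List.map_cons, List.prod_cons]
    rw [ih fun i hi j hj => h i (List.mem_cons_of_mem _ hi) j (List.mem_cons_of_mem _ hj)]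
    rw [mul_assoc, mul_assoc, ← mul_assoc (g a), hc.eq, mul_assoc]

theorem list_prod_map_inv_of_commute {ι M : Type*} [Group M] (l : List ι) (f : ι → M)
    (h : ∀ i ∈ l, ∀ j ∈ l, Commute (f i) (f j)) :
    (l.map fun i => (f i)⁻¹).prod = ((l.map f).prod)⁻¹ := by
  rw [eq_inv_iff_mul_eq_one, ← list_prod_map_mul_of_commute _ _ _ fun i hi j hj => (h i hi j hj).inv_left]
  simp

theorem list_prod_map_list_prod_comm {ι κ M : Type*} [Monoid M] (l : List ι) (m : List κ)
    (g : ι → κ → M) (h : ∀ i j i' j', Commute (g i j) (g i' j')) :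
    (m.map fun j => (l.map fun i => g i j).prod).prod =
      (l.map fun i => (m.map fun j => g i j).prod).prod := by
  induction l with
  | nil => simp
  | cons a l ih =>
    simp only [List.map_cons, List.prod_cons]
    rw [← ih]
    refine list_prod_map_mul_of_commute m (g a) _ fun j _ j' _ => Commute.list_prod_right _ _ fun x hx => ?_
    obtain ⟨i, _, rfl⟩ := List.mem_map.1 hx
    exact h _ _ _ _

theorem list_prod_map_flatMap {ι κ M : Type*} [Monoid M] (l : List ι) (f : ι → List κ) (k : κ → M) :
    ((l.flatMap f).map k).prod = (l.map fun i => ((f i).map k).prod).prod := by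
  induction l with
  | nil => simp
  | cons a l ih => simp [ih]

theorem list_prod_map_mem {ι M : Type*} [Group M] (H : Subgroup M) (l : List ι) (k : ι → M)
    (hk : ∀ i, k i ∈ H) : (l.map k).prod ∈ H := Subgroup.list_prod_mem _ fun x hx => by
  obtain ⟨i, _, rfl⟩ := List.mem_map.1 hx
  exact hk i

theorem evalForm_mul_evalForm_one {R B C : Type u} [CommRing R] [CommRing B] [CommRing C] [Algebra R B] [Algebra R C]
    (y : Fin 2 → (B →ₐ[R] C)) (hy : IsSimplex fun i => (y i : B →+* C)) (η η' : ⋀[B]^1 Ω[B⁄R]) :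
    evalForm y hy η * evalForm y hy η' = 0 := by
  induction η using form_induction with
  | hadd η₁ η₂ h h' => rw [map_add, add_mul, h, h', add_zero]
  | hD a b =>
    induction η' using form_induction with
    | hadd η₁ η₂ h h' => rw [map_add, mul_add, h, h', add_zero]
    | hD a' b' =>
      simp only [evalForm_smul_ιMulti_D, Fin.prod_univ_succ, Fin.prod_univ_zero, mul_one]
      have := hy.mul_eq_zero 1 0 (b 0) (b' 0)
      simp only [AlgHom.coe_toRingHom] at this
      change y 0 a * (y 1 (b 0) - y 0 (b 0)) * (y 0 a' * (y 1 (b' 0) - y 0 (b' 0))) = 0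
      linear_combination y 0 a * y 0 a' * this

theorem act_mul_left {S : Scheme.{u}} {F : (Over S)ᵒᵖ ⥤ GrpCat.{w}} {T : Over S}
    (a b : (autPresheaf F).obj (op T)) (g : F.obj (op T)) : act (a * b) g = act a (act b g) := rfl

theorem act_mul_right {S : Scheme.{u}} {F : (Over S)ᵒᵖ ⥤ GrpCat.{w}} {T : Over S}
    (a : (autPresheaf F).obj (op T)) (g h : F.obj (op T)) : act a (g * h) = act a g * act a h :=
  map_mul (Iso.hom (a : Aut ((Over.forget T).op ⋙ F)) |>.app (op (Over.mk (𝟙 T)))).hom g h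

/-- The action of an automorphism, as a homomorphism. -/
def actHom {S : Scheme.{u}} {F : (Over S)ᵒᵖ ⥤ GrpCat.{w}} {T : Over S}
    (a : (autPresheaf F).obj (op T)) : F.obj (op T) →* F.obj (op T) where
  toFun := act a
  map_one' := act_one_right a
  map_mul' := act_mul_right a

namespace Chart

variable {S : Scheme.{u}} {X : Over S} {c : Chart X} {F : (Over S)ᵒᵖ ⥤ GrpCat.{w}}
  {A C : Type u} [CommRing A] [CommRing C] [Algebra c.R A] [Algebra c.R C]

theorem lieEval_neg (hF : IsSeparatedPresheaf F) (Z : c.lie A F) (f : A →ₐ[c.R] C) (a : C) (ha : a * a = 0) :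
    lieEval Z f (-a) (by rwa [neg_mul_neg]) = (lieEval Z f a ha)⁻¹ := by
  rw [eq_inv_iff_mul_eq_one, ← lieEval_add hF Z f (-a) a _ ha (by rw [neg_mul, ha, neg_zero])]
  exact lieEval_eq_one _ _ _ _ (neg_add_cancel a)

theorem lieEval_alternating (hF : IsSeparatedPresheaf F) (Z : c.lie A F) (f : A →ₐ[c.R] C)
    {a₁ a₂ a₃ a₄ a₅ : C} (h₁₂ : a₁ * a₂ = 0) (h₁₃ : a₁ * a₃ = 0) (h₁₄ : a₁ * a₄ = 0)
    (h₁₅ : a₁ * a₅ = 0) (h₂₃ : a₂ * a₃ = 0) (h₂₄ : a₂ * a₄ = 0) (h₂₅ : a₂ * a₅ = 0)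
    (h₃₄ : a₃ * a₄ = 0) (h₃₅ : a₃ * a₅ = 0) (h₄₅ : a₄ * a₅ = 0) (h₁ : a₁ * a₁ = 0)
    (h₂ : a₂ * a₂ = 0) (h₃ : a₃ * a₃ = 0) (h₄ : a₄ * a₄ = 0) (h₅ : a₅ * a₅ = 0)
    (h : (a₁ - a₂ + a₃ - a₄ + a₅) * (a₁ - a₂ + a₃ - a₄ + a₅) = 0) :
    lieEval Z f (a₁ - a₂ + a₃ - a₄ + a₅) h = lieEval Z f a₁ h₁ * ((lieEval Z f a₂ h₂)⁻¹ *
      (lieEval Z f a₃ h₃ * ((lieEval Z f a₄ h₄)⁻¹ * lieEval Z f a₅ h₅))) := by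
  have e₂ : -a₂ * -a₂ = 0 := by rwa [neg_mul_neg]
  have e₄ : -a₄ * -a₄ = 0 := by rwa [neg_mul_neg]
  have k₄ : (-a₄ + a₅) * (-a₄ + a₅) = 0 := by linear_combination h₄ + h₅ - 2 * h₄₅
  have k₃ : (a₃ + (-a₄ + a₅)) * (a₃ + (-a₄ + a₅)) = 0 := by
    linear_combination k₄ + h₃ - 2 * h₃₄ + 2 * h₃₅
  have k₂ : (-a₂ + (a₃ + (-a₄ + a₅))) * (-a₂ + (a₃ + (-a₄ + a₅))) = 0 := by
    linear_combination k₃ + h₂ - 2 * h₂₃ + 2 * h₂₄ - 2 * h₂₅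
  rw [← lieEval_neg hF Z f a₂ h₂, ← lieEval_neg hF Z f a₄ h₄,
    ← lieEval_add hF Z f (-a₄) a₅ e₄ h₅ (by linear_combination -h₄₅),
    ← lieEval_add hF Z f a₃ (-a₄ + a₅) h₃ k₄ (by linear_combination -h₃₄ + h₃₅),
    ← lieEval_add hF Z f (-a₂) _ e₂ k₃ (by linear_combination -h₂₃ + h₂₄ - h₂₅),
    ← lieEval_add hF Z f a₁ _ h₁ k₂ (by linear_combination -h₁₂ + h₁₃ - h₁₄ + h₁₅)]
  exact lieEval_congr Z rfl (by ring) _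

/-- There is only one `R`-algebra map `R → C`, so for coefficients over `R` the initial vertex
enters only through the form. This makes faces with different initial vertices comparable. -/
theorem TensorForm.eval_toB {n : ℕ} [NeZero n] (L : c.TensorForm F c.R n)
    (y : Fin (n + 1) → (c.B →ₐ[c.R] C)) (hy : IsSimplex fun i => (y i : c.B →+* C)) :
    L.toB.eval y hy = (L.map fun p => lieEval p.1 (Algebra.ofId c.R C) (evalForm y hy p.2)
      (evalForm_mul_self y hy p.2)).prod := by
  rw [TensorForm.eval, TensorForm.toB, List.map_map]
  refine congrArg List.prod (List.map_congr_left fun p _ => ?_)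
  exact (lieEval_lieMap p.1 (Algebra.ofId c.R c.B) (y 0) (evalForm y hy p.2)
    (evalForm_mul_self y hy p.2)).trans
    (lieEval_congr _ (Subsingleton.elim _ _) rfl (evalForm_mul_self y hy p.2))

/-- The effect of `∏ Yᵢ(sᵢ)` on `Z(t)`, where `sᵢ sⱼ = 0`. -/
theorem act_prod_lieEval (hF : IsSeparatedPresheaf F)
    (br : c.lie A (autPresheaf F) → c.lie A F → c.lie A F) (hbr : ∀ Y Z, IsLieBracket Y Z (br Y Z))
    (f : A →ₐ[c.R] C) {κ : Type*} (K : List κ) (Y : κ → c.lie A (autPresheaf F)) (s : κ → C)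
    (hs : ∀ i j, s i * s j = 0) (Z : c.lie A F) (t : C) (ht : t * t = 0) :
    act (K.map fun i => lieEval (Y i) f (s i) (hs i i)).prod (lieEval Z f t ht) =
      (K.map fun i => lieEval (br (Y i) Z) f (s i * t) (by linear_combination t * t * hs i i)).prod *
        lieEval Z f t ht := by
  have hact (Y : c.lie A (autPresheaf F)) (Z : c.lie A F) (s t : C) (hs : s * s = 0) (ht : t * t = 0) :
      act (lieEval Y f s hs) (lieEval Z f t ht) =
        lieEval (br Y Z) f (s * t) (by linear_combination t * t * hs) * lieEval Z f t ht :=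
    mul_inv_eq_iff_eq_mul.1 (hbr Y Z C f s t hs ht)
  induction K with
  | nil => simp [act_one_left]
  | cons k K ih =>
    simp only [List.map_cons, List.prod_cons]
    rw [act_mul_left, ih, act_mul_right, hact, ← mul_assoc]
    congr 1
    -- The factor `Yₖ(sₖ)` fixes the brackets already produced: its commutator with `[Yᵢ,Z](sᵢ t)`
    -- has parameter `sₖ sᵢ t = 0`.
    have h1 : act (lieEval (Y k) f (s k) (hs k k)) (K.map fun i => lieEval (br (Y i) Z) f (s i * t)
        (by linear_combination t * t * hs i i)).prod = (K.map fun i => lieEval (br (Y i) Z) f (s i * t)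
        (by linear_combination t * t * hs i i)).prod := by
      refine (map_list_prod (actHom (lieEval (Y k) f (s k) (hs k k))) _).trans ?_
      rw [List.map_map]
      refine congrArg List.prod (List.map_congr_left fun i _ => ?_)
      refine (hact _ _ _ _ _ _).trans ?_
      rw [lieEval_eq_one, one_mul]
      rw [← mul_assoc, hs, zero_mul]
    rw [h1]
    refine (Commute.list_prod_right _ _ fun x hx => ?_).symm
    obtain ⟨i, hi, rfl⟩ := List.mem_map.1 hx
    exact lieEval_comm hF _ _ f _ _ _ _ (by linear_combination t * t * hs k i)

/-- Every factor is some `W(t)` with `t ∈ I³`, where `I` is the simplex ideal. As `I⁵ = 0`, any two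
such parameters have product zero and the factors commute. The claim thus becomes an identity in a
commutative group, term by term the two form identities for `dω` and `η ∧ ω`. -/
theorem represents_delta (hF : IsSeparatedPresheaf F) (Ω : CombForm X F 3)
    (χ : CombForm X (autPresheaf F) 1)
    (br : c.lie c.B (autPresheaf F) → c.lie c.B F → c.lie c.B F)
    (hbr : ∀ Y Z, IsLieBracket Y Z (br Y Z))
    (L : c.TensorForm F c.R 3) (K : c.TensorForm (autPresheaf F) c.B 1)
    (hL : Represents L.toB Ω) (hK : Represents K χ) :
    Represents (n := 4) (L.d.toB ++ TensorForm.bracket br K L.toB) (CombForm.delta χ Ω) := by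
  intro C _ _ y hy
  let I := simplexIdeal y
  -- the commutative subgroup in which the computation takes place
  let Sm : Set (F.obj (op (c.aff C))) :=
    {x | ∃ (W : c.lie c.B F) (t : C) (ht : t * t = 0), t ∈ I ^ 3 ∧ x = lieEval W (y 0) t ht}
  let H := Subgroup.closure Sm
  have hcomm : ∀ x ∈ Sm, ∀ z ∈ Sm, x * z = z * x := by
    rintro _ ⟨W, t, ht, htI, rfl⟩ _ ⟨W', t', ht', htI', rfl⟩
    exact lieEval_comm hF _ _ _ _ _ _ _
      (mul_eq_zero_of_mem_simplexIdeal_pow y (by norm_num) htI htI' hy)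
  let _ : CommGroup H := { (inferInstance : Group H) with
    mul_comm := (Subgroup.isMulCommutative_closure hcomm).is_comm.comm }
  have hH : ∀ x ∈ H, ∀ z ∈ H, Commute x z := fun x hx z hz =>
    congrArg Subtype.val (mul_comm (⟨x, hx⟩ : H) ⟨z, hz⟩)
  have hmem (W : c.lie c.B F) (t : C) (ht) (htI : t ∈ I ^ 3) : lieEval W (y 0) t ht ∈ H :=
    Subgroup.subset_closure ⟨W, t, ht, htI, rfl⟩
  have hofId (Z : c.lie c.R F) (t : C) (ht : t * t = 0) :
      lieEval Z (Algebra.ofId c.R C) t ht = lieEval (lieMap (Algebra.ofId c.R c.B) Z) (y 0) t ht :=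
    (lieEval_congr Z (Subsingleton.elim _ _) rfl ht).trans (lieEval_lieMap _ _ _ _ _).symm
  have hmem' (Z : c.lie c.R F) (t : C) (ht) (htI : t ∈ I ^ 3) :
      lieEval Z (Algebra.ofId c.R C) t ht ∈ H := by rw [hofId]; exact hmem _ _ _ htI
  -- the faces
  let v (σ : Fin 4 → Fin 5) (p : c.lie c.R F × ⋀[c.B]^3 Ω[c.B⁄c.R]) : C :=
    evalForm (fun i => y (σ i)) (hy.precomp σ) p.2
  have hv0 (σ p) : v σ p * v σ p = 0 := evalForm_mul_self _ _ _
  have hvI (σ p) : v σ p ∈ I ^ 3 := evalForm_mem_simplexIdeal y hy σ _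
  have hvv (σ τ p q) : v σ p * v τ q = 0 :=
    mul_eq_zero_of_mem_simplexIdeal_pow y (by norm_num) (hvI σ p) (hvI τ q) hy
  let e (σ : Fin 4 → Fin 5) (p : c.lie c.R F × ⋀[c.B]^3 Ω[c.B⁄c.R]) : F.obj (op (c.aff C)) :=
    lieEval p.1 (Algebra.ofId c.R C) (v σ p) (hv0 σ p)
  have he (σ p) : e σ p ∈ H := hmem' _ _ _ (hvI σ p)
  have hface (σ : Fin 4 → Fin 5) : Ω.face (fun i => c.pt (y i)) (c.inDelta hy) σ = (L.map (e σ)).prod :=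
    (hL C _ (hy.precomp σ)).trans (TensorForm.eval_toB L _ _)
  have hχ : χ.face (fun i => c.pt (y i)) (c.inDelta hy) ![0, 1] = K.eval (fun i => y (![0, 1] i)) (hy.precomp _) :=
    hK C _ _
  let s (p : c.lie c.B (autPresheaf F) × ⋀[c.B]^1 Ω[c.B⁄c.R]) : C :=
    evalForm (fun i => y (![0, 1] i)) (hy.precomp _) p.2
  have hs (p q) : s p * s q = 0 := evalForm_mul_evalForm_one _ _ _ _
  let g (p : c.lie c.B (autPresheaf F) × ⋀[c.B]^1 Ω[c.B⁄c.R]) (q : c.lie c.R F × ⋀[c.B]^3 Ω[c.B⁄c.R]) :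
      F.obj (op (c.aff C)) :=
    lieEval (br p.1 (lieMap (Algebra.ofId c.R c.B) q.1)) (y 0) (s p * v ![1, 2, 3, 4] q)
      (by linear_combination v ![1, 2, 3, 4] q * v ![1, 2, 3, 4] q * hs p p)
  have hg (p q) : g p q ∈ H := hmem _ _ _ (Ideal.mul_mem_left _ _ (hvI _ _))
  -- Each factor `Z(ω(y,z,u,v))` acquires the brackets with all the terms of `χ`. The resulting
  -- double product is regrouped in the order of the tensor form `[χ, Ω]`.
  have hact : act (χ.face (fun i => c.pt (y i)) (c.inDelta hy) ![0, 1])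
      (Ω.face (fun i => c.pt (y i)) (c.inDelta hy) ![1, 2, 3, 4]) =
      (K.map fun p => (L.map fun q => g p q).prod).prod * (L.map (e ![1, 2, 3, 4])).prod := by
    rw [hχ, hface]
    refine (map_list_prod (actHom (K.eval (fun i => y (![0, 1] i)) (hy.precomp _))) _).trans ?_
    rw [List.map_map, ← list_prod_map_list_prod_comm _ _ _ fun p q p' q' => hH _ (hg p q) _ (hg p' q'),
      ← list_prod_map_mul_of_commute _ _ _ fun q _ q' _ =>
        hH _ (list_prod_map_mem H _ _ fun p => hg p q) _ (he _ q')]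
    refine congrArg List.prod (List.map_congr_left fun q _ => ?_)
    have h := act_prod_lieEval hF br hbr (y 0) K Prod.fst s hs (lieMap (Algebra.ofId c.R c.B) q.1)
      (v ![1, 2, 3, 4] q) (hv0 _ q)
    rw [← hofId] at h
    exact h
  have hbracket : TensorForm.eval (n := 4) (TensorForm.bracket br K L.toB) y hy =
      (K.map fun p => (L.map fun q => g p q).prod).prod := by
    refine (list_prod_map_flatMap _ _ _).trans ?_
    refine congrArg List.prod (List.map_congr_left fun p _ => ?_)
    change (((L.map fun q => _).map _).map _).prod = _
    rw [List.map_map, List.map_map]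
    refine congrArg List.prod (List.map_congr_left fun q _ => ?_)
    exact lieEval_congr _ rfl (evalForm_wedge y hy p.2 q.2)
      (evalForm_mul_self (n := 4) y hy (wedge p.2 q.2))
  have hd : TensorForm.eval (n := 4) L.d.toB y hy = (L.map (e ![1, 2, 3, 4])).prod *
      ((L.map (e ![0, 2, 3, 4])).prod⁻¹ * ((L.map (e ![0, 1, 3, 4])).prod *
      ((L.map (e ![0, 1, 2, 4])).prod⁻¹ * (L.map (e ![0, 1, 2, 3])).prod))) := by
    have hc (σ τ p q) : Commute (e σ p) (e τ q) := hH _ (he σ p) _ (he τ q)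
    refine (TensorForm.eval_toB (n := 4) L.d y hy).trans ?_
    rw [← list_prod_map_inv_of_commute _ _ fun p _ q _ => hc _ _ p q,
      ← list_prod_map_inv_of_commute _ _ fun p _ q _ => hc _ _ p q,
      ← list_prod_map_mul_of_commute _ _ _ fun p _ q _ => (hc _ _ p q).inv_left,
      ← list_prod_map_mul_of_commute _ _ _ fun p _ q _ =>
        (hc _ _ p q).inv_right.mul_right (hc _ _ p q),
      ← list_prod_map_mul_of_commute _ _ _ fun p _ q _ => ((hc _ _ p q).mul_right
        ((hc _ _ p q).inv_right.mul_right (hc _ _ p q))).inv_left,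
      ← list_prod_map_mul_of_commute _ _ _ fun p _ q _ => (hc _ _ p q).inv_right.mul_right
        ((hc _ _ p q).mul_right ((hc _ _ p q).inv_right.mul_right (hc _ _ p q)))]
    change ((L.map fun q => _).map _).prod = _
    rw [List.map_map]
    refine congrArg List.prod (List.map_congr_left fun p _ => ?_)
    refine (lieEval_congr _ rfl (evalForm_formDeriv y hy p.2)
      (evalForm_mul_self (n := 4) y hy (formDeriv p.2))).trans
      (lieEval_alternating hF p.1 _ (hvv _ _ p p) (hvv _ _ p p) (hvv _ _ p p) (hvv _ _ p p)
        (hvv _ _ p p) (hvv _ _ p p) (hvv _ _ p p) (hvv _ _ p p) (hvv _ _ p p) (hvv _ _ p p)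
        (hv0 _ p) (hv0 _ p) (hv0 _ p) (hv0 _ p) (hv0 _ p) (evalForm_formDeriv y hy p.2 ▸ evalForm_mul_self (n := 4) y hy (formDeriv p.2)))
  refine Eq.trans ?_ (show TensorForm.eval (n := 4) L.d.toB y hy *
    TensorForm.eval (n := 4) (TensorForm.bracket br K L.toB) y hy = _ from ?_)
  · rw [hd, hbracket]
    change act _ _ * Ω.face _ _ ![0, 1, 3, 4] * Ω.face _ _ ![0, 1, 2, 3] *
      (Ω.face _ _ ![0, 2, 3, 4])⁻¹ * (Ω.face _ _ ![0, 1, 2, 4])⁻¹ = _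
    rw [hact]
    simp only [hface]
    have hE := fun σ => list_prod_map_mem H L (e σ) (he σ)
    have hK := list_prod_map_mem H K _ fun p => list_prod_map_mem H L _ fun q => hg p q
    have key (k a₁ a₂ a₃ a₄ a₅ : H) :
      k * a₁ * a₃ * a₅ * a₂⁻¹ * a₄⁻¹ = a₁ * (a₂⁻¹ * (a₃ * (a₄⁻¹ * a₅))) * k := by ac_rfl
    exact congrArg Subtype.val (key ⟨_, hK⟩ ⟨_, hE _⟩ ⟨_, hE _⟩ ⟨_, hE _⟩ ⟨_, hE _⟩ ⟨_, hE _⟩)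
  · refine (List.prod_append.symm.trans ?_)
    rw [← List.map_append]
    rfl

end Chart

/-! ### Descent of morphisms along dominant surjections -/

section Descent

open Limits

/-- Descent of morphisms along a scheme-theoretically dominant surjection is local on the base. -/
theorem exists_descent_of_local {Y Z T : Scheme.{u}} (q : Y ⟶ Z) [IsSchemeTheoreticallyDominant q]
    [Surjective q] [QuasiCompact q] (f : Y ⟶ T)
    (h : ∀ z : Z, ∃ (W : Scheme.{u}) (w : W ⟶ Z) (g : W ⟶ T), IsOpenImmersion w ∧ z ∈ Set.range w ∧
      pullback.fst q w ≫ f = pullback.snd q w ≫ g) : ∃ g : Z ⟶ T, q ≫ g = f := by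
  choose W w g hw hz hg using h
  let 𝒰 : Scheme.OpenCover.{u} Z := Scheme.Cover.mkOfCovers Z W w (fun z => ⟨z, hz z⟩) hw
  have hgl (z z' : Z) : pullback.fst (w z) (w z') ≫ g z = pullback.snd (w z) (w z') ≫ g z' := by
    let P := pullback (w z) (w z')
    let p : P ⟶ Z := pullback.fst (w z) (w z') ≫ w z
    have hp : p = pullback.snd (w z) (w z') ≫ w z' := pullback.condition
    -- The overlap is open in `Z`, so the base change of `q` to it is still dominant and surjective.
    -- After this base change both local morphisms become `f`.
    refine hom_ext_of_schemeTheoreticallyDominant (pullback.snd q p) ?_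
    have h1 : pullback.snd q p ≫ pullback.fst (w z) (w z') ≫ g z = pullback.fst q p ≫ f := by
      let l : pullback q p ⟶ pullback q (w z) := pullback.lift (pullback.fst q p)
        (pullback.snd q p ≫ pullback.fst _ _) (by rw [pullback.condition, Category.assoc])
      have := congrArg (l ≫ ·) (hg z)
      simp only [l, pullback.lift_fst_assoc, pullback.lift_snd_assoc, Category.assoc] at this
      exact this.symm
    have h2 : pullback.snd q p ≫ pullback.snd (w z) (w z') ≫ g z' = pullback.fst q p ≫ f := by
      let l : pullback q p ⟶ pullback q (w z') := pullback.lift (pullback.fst q p)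
        (pullback.snd q p ≫ pullback.snd _ _) (by rw [pullback.condition, Category.assoc, ← hp])
      have := congrArg (l ≫ ·) (hg z')
      simp only [l, pullback.lift_fst_assoc, pullback.lift_snd_assoc, Category.assoc] at this
      exact this.symm
    exact h1.trans h2.symm
  refine ⟨𝒰.glueMorphisms g hgl, Scheme.Cover.hom_ext (𝒰.pullback₁ q) _ _ fun (z : Z) => ?_⟩
  change pullback.fst q (w z) ≫ q ≫ _ = pullback.fst q (w z) ≫ f
  rw [pullback.condition_assoc, hg]
  exact congrArg (pullback.snd q (w z) ≫ ·) (𝒰.ι_glueMorphisms g hgl z)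

end Descent

/-! ### Dual numbers in one and two variables, and descent from `A[s, t]` to `A[st]` -/

section DualMap

variable {A A' A'' : Type*} [CommRing A] [CommRing A'] [CommRing A'']

/-- The homomorphism `A[ε] → A'[ε]` induced by `A → A'`. -/
def dualMap (φ : A →+* A') : DualNumber A →+* DualNumber A' where
  toFun x := TrivSqZeroExt.inl (φ x.fst) + TrivSqZeroExt.inr (φ x.snd)
  map_one' := by ext <;> simp
  map_mul' x y := by ext <;> simp [mul_comm]
  map_zero' := by ext <;> simp
  map_add' x y := by ext <;> simp

@[simp] theorem fst_dualMap (φ : A →+* A') (x : DualNumber A) : (dualMap φ x).fst = φ x.fst := by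
  simp [dualMap]

@[simp] theorem snd_dualMap (φ : A →+* A') (x : DualNumber A) : (dualMap φ x).snd = φ x.snd := by
  simp [dualMap]

/-- Dual numbers commute with localization. -/
theorem isLocalization_away_dualMap [Algebra A A'] (a : A) [IsLocalization.Away a A'] :
    letI := (dualMap (algebraMap A A')).toAlgebra
    IsLocalization.Away (TrivSqZeroExt.inl a : DualNumber A) (DualNumber A') := by
  let := (dualMap (algebraMap A A')).toAlgebra
  have hinl (n : ℕ) : (TrivSqZeroExt.inl a : DualNumber A) ^ n = TrivSqZeroExt.inl (a ^ n) :=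
    (map_pow (TrivSqZeroExt.inlHom A A) a n).symm
  refine IsLocalization.Away.mk _ ?_ ?_ ?_
  · have := (IsLocalization.Away.algebraMap_isUnit (S := A') a).map (TrivSqZeroExt.inlHom A' A')
    convert! this using 1
    change dualMap (algebraMap A A') _ = _
    ext <;> simp
  · intro z
    obtain ⟨n, x, hx⟩ := IsLocalization.Away.surj a z.fst
    obtain ⟨m, y, hy⟩ := IsLocalization.Away.surj a z.snd
    refine ⟨n + m, TrivSqZeroExt.inl (x * a ^ m) + TrivSqZeroExt.inr (y * a ^ n), ?_⟩
    change z * dualMap (algebraMap A A') _ ^ (n + m) = dualMap (algebraMap A A') _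
    rw [← map_pow, hinl]
    ext
    · simp only [TrivSqZeroExt.fst_mul, fst_dualMap, TrivSqZeroExt.fst_inl, TrivSqZeroExt.fst_add,
        TrivSqZeroExt.fst_inr, add_zero, map_mul, map_pow]
      rw [← hx]; ring
    · simp only [TrivSqZeroExt.snd_mul, fst_dualMap, snd_dualMap, TrivSqZeroExt.fst_inl,
        TrivSqZeroExt.snd_add, TrivSqZeroExt.snd_inl, TrivSqZeroExt.snd_inr, zero_add, map_mul,
        map_pow, map_zero, smul_zero, MulOpposite.smul_eq_mul_unop, MulOpposite.unop_op]
      rw [← hy]; ring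
  · intro x y hxy
    change dualMap (algebraMap A A') x = dualMap (algebraMap A A') y at hxy
    have h1 : algebraMap A A' x.fst = algebraMap A A' y.fst := by
      simpa using congrArg TrivSqZeroExt.fst hxy
    have h2 : algebraMap A A' x.snd = algebraMap A A' y.snd := by
      simpa using congrArg TrivSqZeroExt.snd hxy
    obtain ⟨n, hn⟩ := IsLocalization.Away.exists_of_eq (S := A') a h1
    obtain ⟨m, hm⟩ := IsLocalization.Away.exists_of_eq (S := A') a h2
    refine ⟨n + m, ?_⟩
    rw [hinl]
    ext
    · simp only [TrivSqZeroExt.fst_mul, TrivSqZeroExt.fst_inl]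
      linear_combination a ^ m * hn
    · simp only [TrivSqZeroExt.snd_mul, TrivSqZeroExt.fst_inl, TrivSqZeroExt.snd_inl, smul_zero,
        add_zero, smul_eq_mul]
      linear_combination a ^ n * hm

end DualMap

section DoubleDual

variable (R A : Type*) [CommRing R] [CommRing A] [Algebra R A]

/-- The inclusion `A → A[s, t]` into the ring of dual numbers in two variables, `A[t][s]`. -/
def doubleInl : A →ₐ[R] DualNumber (DualNumber A) :=
  (TrivSqZeroExt.inlAlgHom R (DualNumber A) (DualNumber A)).comp (TrivSqZeroExt.inlAlgHom R A A)

/-- The homomorphism `A[ε] → A[s, t]`, `ε ↦ s t`. -/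
def epsToMul : DualNumber A →ₐ[R] DualNumber (DualNumber A) :=
  DualNumber.lift ⟨(doubleInl R A, DualNumber.eps * TrivSqZeroExt.inl DualNumber.eps), by
    change DualNumber.eps * TrivSqZeroExt.inl DualNumber.eps *
      (DualNumber.eps * TrivSqZeroExt.inl DualNumber.eps) = _
    ext <;> simp, fun _ => Commute.all (S := DualNumber (DualNumber A)) _ _⟩

/-- The homomorphism `A[s, t] → A`, `s, t ↦ 0`. -/
def doubleFst : DualNumber (DualNumber A) →ₐ[R] A :=
  (TrivSqZeroExt.fstHom R A A).comp (TrivSqZeroExt.fstHom R (DualNumber A) (DualNumber A))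

/-- The homomorphism `A[s, t] → A[ε]`, `s ↦ ε`, `t ↦ 0`. -/
def doubleFstSnd : DualNumber (DualNumber A) →ₐ[R] DualNumber A :=
  DualNumber.lift ⟨((TrivSqZeroExt.inlAlgHom R A A).comp (TrivSqZeroExt.fstHom R A A),
    DualNumber.eps), DualNumber.eps_mul_eps, fun _ => Commute.all _ _⟩

variable {R A}

theorem epsToMul_apply (x : DualNumber A) : epsToMul R A x =
    (TrivSqZeroExt.inl (TrivSqZeroExt.inl x.fst) + TrivSqZeroExt.inr (TrivSqZeroExt.inr x.snd) :
      DualNumber (DualNumber A)) := by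
  refine (DualNumber.lift_apply_apply (R := R) _ x).trans ?_
  ext <;> simp [doubleInl]

theorem doubleFstSnd_apply (x : DualNumber (DualNumber A)) : doubleFstSnd R A x =
    (TrivSqZeroExt.inl x.fst.fst + TrivSqZeroExt.inr x.snd.fst : DualNumber A) := by
  refine (DualNumber.lift_apply_apply (R := R) _ x).trans ?_
  ext <;> simp

theorem doubleFst_comp_epsToMul : (doubleFst R A).comp (epsToMul R A) = TrivSqZeroExt.fstHom R A A := by
  apply AlgHom.ext
  intro x
  simp [doubleFst, epsToMul_apply]

theorem epsToMul_injective : Function.Injective (epsToMul R A) := fun x y h => by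
  rw [epsToMul_apply, epsToMul_apply] at h
  have h1 := congrArg (fun z => z.fst.fst) h
  have h2 := congrArg (fun z => z.snd.snd) h
  ext
  · simpa using h1
  · simpa using h2

variable (R A) in
theorem comap_fst_surjective :
    Function.Surjective (PrimeSpectrum.comap (TrivSqZeroExt.fstHom R A A).toRingHom) :=
  comap_surjective_of_isNilpotent _ (TrivSqZeroExt.inlHom A A) fun x => ⟨2, by
    ext <;> simp [pow_two]⟩

/-- Followed by `A[s, t] → A`, this map becomes the reduction `A[ε] → A`, which has nilpotent kernel
and is already surjective on spectra. -/
theorem comap_epsToMul_surjective : Function.Surjective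
    (PrimeSpectrum.comap (R := DualNumber A) (S := DualNumber (DualNumber A)) (epsToMul R A).toRingHom) := by
  have h := comap_fst_surjective R A
  rw [← doubleFst_comp_epsToMul] at h
  exact fun x => (h x).elim fun y hy =>
    ⟨PrimeSpectrum.comap (R := DualNumber (DualNumber A)) (S := A) (doubleFst R A).toRingHom y, hy⟩

theorem comap_doubleFst_surjective : Function.Surjective
    (PrimeSpectrum.comap (R := DualNumber (DualNumber A)) (S := A) (doubleFst R A).toRingHom) :=
  fun x => by
    obtain ⟨y, hy⟩ := comap_fst_surjective R (DualNumber A) x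
    obtain ⟨z, hz⟩ := comap_fst_surjective R A y
    exact ⟨z, (congrArg (PrimeSpectrum.comap (R := DualNumber (DualNumber A)) (S := DualNumber A)
      (TrivSqZeroExt.fstHom R (DualNumber A) (DualNumber A)).toRingHom) hz).trans hy⟩

end DoubleDual

section DescentDual

open Limits

theorem isOpenImmersion_range_of_isLocalization {A A' : Type u} [CommRing A] [CommRing A'] (φ : A →+* A')
    (a : A) (h : letI := φ.toAlgebra; IsLocalization.Away a A') :
    IsOpenImmersion (Spec.map (CommRingCat.ofHom φ)) ∧
      Set.range (PrimeSpectrum.comap φ) = PrimeSpectrum.basicOpen a := by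
  let := φ.toAlgebra
  exact ⟨IsOpenImmersion.of_isLocalization (S := A') a, PrimeSpectrum.localization_away_comap_range A' a⟩

section

variable {A A' : Type u} [CommRing A] [CommRing A'] [Algebra A A'] (a : A) [IsLocalization.Away a A']

theorem isOpenImmersion_range_dualMap :
    IsOpenImmersion (Spec.map (CommRingCat.ofHom (dualMap (algebraMap A A')))) ∧
      Set.range (PrimeSpectrum.comap (dualMap (algebraMap A A'))) =
        PrimeSpectrum.basicOpen (TrivSqZeroExt.inl a : DualNumber A) :=
  isOpenImmersion_range_of_isLocalization _ _ (isLocalization_away_dualMap a)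

theorem isOpenImmersion_range_dualMap_dualMap :
    IsOpenImmersion (Spec.map (CommRingCat.ofHom (R := DualNumber (DualNumber A))
      (S := DualNumber (DualNumber A')) (dualMap (dualMap (algebraMap A A'))))) ∧
      Set.range (PrimeSpectrum.comap (R := DualNumber (DualNumber A))
        (S := DualNumber (DualNumber A')) (dualMap (dualMap (algebraMap A A')))) =
        PrimeSpectrum.basicOpen (TrivSqZeroExt.inl (TrivSqZeroExt.inl a) : DualNumber (DualNumber A)) :=
  let := (dualMap (algebraMap A A')).toAlgebra
  have : IsLocalization.Away (TrivSqZeroExt.inl a : DualNumber A) (DualNumber A') :=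
    isLocalization_away_dualMap a
  isOpenImmersion_range_dualMap (A := DualNumber A) (A' := DualNumber A') (TrivSqZeroExt.inl a)

end

variable {R A A' : Type u} [CommRing R] [CommRing A] [CommRing A'] [Algebra R A] [Algebra R A'] {T : Scheme.{u}}

theorem fst_fst_mul (p q : DualNumber (DualNumber A)) : (p * q).fst.fst = p.fst.fst * q.fst.fst := by
  rw [TrivSqZeroExt.fst_mul, TrivSqZeroExt.fst_mul]

theorem snd_snd_mul (p q : DualNumber (DualNumber A)) (hp : p.fst.snd = 0) (hq : q.fst.snd = 0) :
    (p * q).snd.snd = p.fst.fst * q.snd.snd + p.snd.snd * q.fst.fst := by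
  rw [TrivSqZeroExt.snd_mul, smul_eq_mul, op_smul_eq_mul, TrivSqZeroExt.snd_add,
    TrivSqZeroExt.snd_mul, TrivSqZeroExt.snd_mul, hp, hq]
  simp

variable (R) in
-- In `A[t][s]` the component `fst.snd` is the coefficient of `t` and `snd.fst` that of `s`. The
-- elements without either form the subring `A[st]`, a copy of `A[ε]`.
theorem exists_lift_epsToMul {B : Type u} [CommRing B] (δ : B →+* DualNumber (DualNumber A))
    (h₁ : ∀ x, (δ x).fst.snd = 0) (h₂ : ∀ x, (δ x).snd.fst = 0) :
    ∃ γ : B →+* DualNumber A, ∀ x, epsToMul R A (γ x) = δ x := by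
  let γ : B →+* DualNumber A :=
    { toFun x := TrivSqZeroExt.inl (δ x).fst.fst + TrivSqZeroExt.inr (δ x).snd.snd
      map_one' := by rw [map_one]; ext <;> simp
      map_zero' := by rw [map_zero]; ext <;> simp
      map_add' x y := by rw [map_add]; ext <;> simp
      map_mul' x y := by
        rw [map_mul, fst_fst_mul, snd_snd_mul _ _ (h₁ x) (h₁ y)]
        generalize (δ x).fst.fst = a
        generalize (δ x).snd.snd = b
        generalize (δ y).fst.fst = a'
        generalize (δ y).snd.snd = b'
        ext
        · simp
        · simp }
  refine ⟨γ, fun x => ?_⟩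
  rw [epsToMul_apply]
  ext
  · simp [γ]
  · simp [γ, h₁]
  · simp [γ, h₂]
  · simp [γ]

variable (R) in
-- For an affine target the morphism is a ring homomorphism, and the two hypotheses say that its
-- `t`- and `s`-coefficients vanish.
theorem factors_epsToMul_of_isAffineOpen {f : Spec (.of (DualNumber (DualNumber A))) ⟶ T}
    {V : T.Opens} (hV : IsAffineOpen V) (hf : Set.range f ⊆ V)
    (h₁ : Spec.map (CommRingCat.ofHom (TrivSqZeroExt.fstHom R (DualNumber A) (DualNumber A)).toRingHom) ≫ f =
      Spec.map (CommRingCat.ofHom ((TrivSqZeroExt.inlAlgHom R A A).comp (doubleFst R A)).toRingHom) ≫ f)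
    (h₂ : Spec.map (CommRingCat.ofHom (doubleFstSnd R A).toRingHom) ≫ f =
      Spec.map (CommRingCat.ofHom ((TrivSqZeroExt.inlAlgHom R A A).comp (doubleFst R A)).toRingHom) ≫ f) :
    ∃ g : Spec (.of (DualNumber A)) ⟶ T, Spec.map (CommRingCat.ofHom (epsToMul R A).toRingHom) ≫ g = f := by
  rw [← hV.range_fromSpec] at hf
  let l := IsOpenImmersion.lift hV.fromSpec f hf
  have hl : l ≫ hV.fromSpec = f := IsOpenImmersion.lift_fac _ _ _
  obtain ⟨γ, hγ⟩ := Spec.map_surjective l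
  rw [← hl, ← hγ] at h₁ h₂
  have k₁ := Spec.map_injective (((Spec.map_comp _ _).trans ((cancel_mono hV.fromSpec).1
    ((Category.assoc _ _ _).trans (h₁.trans (Category.assoc _ _ _).symm)))).trans (Spec.map_comp _ _).symm)
  have k₂ := Spec.map_injective (((Spec.map_comp _ _).trans ((cancel_mono hV.fromSpec).1
    ((Category.assoc _ _ _).trans (h₂.trans (Category.assoc _ _ _).symm)))).trans (Spec.map_comp _ _).symm)
  let δ : Γ(T, V) →+* DualNumber (DualNumber A) := γ.hom
  have hδ₁ (x) : (δ x).fst.snd = 0 := by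
    have : (δ x).fst = TrivSqZeroExt.inl (δ x).fst.fst := congr($k₁ x)
    rw [this, TrivSqZeroExt.snd_inl]
  have hδ₂ (x) : (δ x).snd.fst = 0 := by
    have : doubleFstSnd R A (δ x) = TrivSqZeroExt.inl (δ x).fst.fst := congr($k₂ x)
    rw [doubleFstSnd_apply] at this
    simpa using congrArg TrivSqZeroExt.snd this
  obtain ⟨γ', hγ'⟩ := exists_lift_epsToMul R δ hδ₁ hδ₂
  refine ⟨Spec.map (CommRingCat.ofHom γ') ≫ hV.fromSpec, ?_⟩
  rw [← hl, ← hγ, ← Category.assoc, ← Spec.map_comp]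
  congr 2
  exact CommRingCat.hom_ext (RingHom.ext hγ')

theorem SpecMap_comm {A B C D : Type u} [CommRing A] [CommRing B] [CommRing C] [CommRing D]
    {f : A →+* B} {g : B →+* D} {h : A →+* C} {k : C →+* D} (H : ∀ x, g (f x) = k (h x)) :
    Spec.map (CommRingCat.ofHom g) ≫ Spec.map (CommRingCat.ofHom f) =
      Spec.map (CommRingCat.ofHom k) ≫ Spec.map (CommRingCat.ofHom h) := by
  rw [← Spec.map_comp, ← Spec.map_comp]
  exact congrArg Spec.map (CommRingCat.hom_ext (RingHom.ext H))

theorem doubleFst_apply (x : DualNumber (DualNumber A)) : doubleFst R A x = x.fst.fst := rfl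

variable (R) in
theorem doubleFst_dualMap_dualMap (φ : A →+* A') (x : DualNumber (DualNumber A)) :
    doubleFst R A' (dualMap (dualMap φ) x) = φ (doubleFst R A x) := by
  rw [doubleFst_apply, doubleFst_apply, fst_dualMap, fst_dualMap]

variable (R) in
theorem doubleFstSnd_dualMap_dualMap (φ : A →+* A') (x : DualNumber (DualNumber A)) :
    doubleFstSnd R A' (dualMap (dualMap φ) x) = dualMap φ (doubleFstSnd R A x) := by
  rw [doubleFstSnd_apply, doubleFstSnd_apply]
  ext <;> simp

variable (R) in
theorem epsToMul_dualMap (φ : A →+* A') (x : DualNumber A) :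
    epsToMul R A' (dualMap φ x) = dualMap (dualMap φ) (epsToMul R A x) := by
  rw [epsToMul_apply, epsToMul_apply]
  ext <;> simp only [TrivSqZeroExt.fst_add, TrivSqZeroExt.snd_add, TrivSqZeroExt.fst_inl,
    TrivSqZeroExt.snd_inl, TrivSqZeroExt.fst_inr, TrivSqZeroExt.snd_inr,
    add_zero, zero_add, map_zero, fst_dualMap, snd_dualMap]

theorem dualMap_inl (φ : A →+* A') (x : A) :
    dualMap φ (TrivSqZeroExt.inl x) = TrivSqZeroExt.inl (φ x) := by
  ext <;> simp

set_option maxHeartbeats 1000000 in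
/-- A morphism `Spec A[s, t] → T` which for `s = 0` and for `t = 0` is constant along `Spec A[ε] → Spec A`
factors through `Spec A[st]`. -/
theorem exists_descent_epsToMul {f : Spec (.of (DualNumber (DualNumber A))) ⟶ T}
    (h₁ : Spec.map (CommRingCat.ofHom (TrivSqZeroExt.fstHom R (DualNumber A) (DualNumber A)).toRingHom) ≫ f =
      Spec.map (CommRingCat.ofHom ((TrivSqZeroExt.inlAlgHom R A A).comp (doubleFst R A)).toRingHom) ≫ f)
    (h₂ : Spec.map (CommRingCat.ofHom (doubleFstSnd R A).toRingHom) ≫ f =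
      Spec.map (CommRingCat.ofHom ((TrivSqZeroExt.inlAlgHom R A A).comp (doubleFst R A)).toRingHom) ≫ f) :
    ∃ g : Spec (.of (DualNumber A)) ⟶ T, Spec.map (CommRingCat.ofHom (epsToMul R A).toRingHom) ≫ g = f := by
  let θ : Spec (.of (DualNumber (DualNumber A))) ⟶ Spec (.of (DualNumber A)) :=
    Spec.map (CommRingCat.ofHom (epsToMul R A).toRingHom)
  have : IsSchemeTheoreticallyDominant θ :=
    isSchemeTheoreticallyDominant_SpecMap _ epsToMul_injective
  have : Surjective θ := ⟨comap_epsToMul_surjective⟩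
  refine exists_descent_of_local θ f fun z => ?_
  obtain ⟨y, hy⟩ := comap_fst_surjective R A z
  let f₀ : Spec (.of A) ⟶ T := Spec.map (CommRingCat.ofHom (doubleFst R A).toRingHom) ≫ f
  -- All the rings involved have the spectrum of `A` as underlying space. It therefore suffices to
  -- shrink `Spec A` to a basic open that the constant part `f₀` maps into an affine open of `T`.
  obtain ⟨V, hV, hyV, -⟩ := exists_isAffineOpen_mem_and_subset (x := f₀ y) (U := ⊤) trivial
  obtain ⟨_, ⟨a, rfl⟩, hya, haV⟩ := (PrimeSpectrum.isTopologicalBasis_basic_opens (R := A)).exists_subset_of_mem_open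
    (show y ∈ (f₀ ⁻¹ᵁ V).1 from hyV) (f₀ ⁻¹ᵁ V).2
  obtain ⟨A', _, _, hA'⟩ : ∃ (A' : Type u) (_ : CommRing A') (_ : Algebra A A'), IsLocalization.Away a A' :=
    ⟨Localization.Away a, inferInstance, inferInstance, inferInstance⟩
  let : Algebra R A' := Algebra.compHom A' (algebraMap R A)
  let φ : A →+* A' := algebraMap A A'
  let w : Spec (.of (DualNumber A')) ⟶ Spec (.of (DualNumber A)) := Spec.map (CommRingCat.ofHom (dualMap φ))
  let v : Spec (.of (DualNumber (DualNumber A'))) ⟶ Spec (.of (DualNumber (DualNumber A))) :=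
    Spec.map (CommRingCat.ofHom (dualMap (dualMap φ)))
  obtain ⟨hw, hwr⟩ : IsOpenImmersion w ∧ _ := isOpenImmersion_range_dualMap a
  obtain ⟨hv, hvr⟩ : IsOpenImmersion v ∧ _ := isOpenImmersion_range_dualMap_dualMap a
  have hφr : Set.range (PrimeSpectrum.comap φ) = PrimeSpectrum.basicOpen a :=
    PrimeSpectrum.localization_away_comap_range A' a
  -- Every point of `Spec A'[s, t]` comes from `Spec A'`, where the morphism is given by `f₀`.
  have hrange : Set.range (v ≫ f) ⊆ V := by
    rintro _ ⟨x, rfl⟩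
    obtain ⟨x, rfl⟩ := comap_doubleFst_surjective (R := R) (A := A') x
    have hx : PrimeSpectrum.comap φ x ∈ (PrimeSpectrum.basicOpen a : Set _) := by
      rw [← hφr]; exact ⟨x, rfl⟩
    have hv' : Spec.map (CommRingCat.ofHom (doubleFst R A').toRingHom) ≫ v =
        Spec.map (CommRingCat.ofHom φ) ≫ Spec.map (CommRingCat.ofHom (doubleFst R A).toRingHom) :=
      SpecMap_comm (doubleFst_dualMap_dualMap R φ)
    have hv'' : Spec.map (CommRingCat.ofHom (doubleFst R A').toRingHom) ≫ v ≫ f =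
        Spec.map (CommRingCat.ofHom φ) ≫ f₀ :=
      (Category.assoc _ _ _).symm.trans ((congrArg (· ≫ f) hv').trans (Category.assoc _ _ _))
    have := congr($hv'' (x : Spec (.of A')))
    exact this ▸ haV hx
  have key (p' : DualNumber (DualNumber A') →+* DualNumber A') (p : DualNumber (DualNumber A) →+* DualNumber A)
      (hp : ∀ x, p' (dualMap (dualMap φ) x) = dualMap φ (p x)) :
      Spec.map (CommRingCat.ofHom p') ≫ v ≫ f = w ≫ Spec.map (CommRingCat.ofHom p) ≫ f :=
    (Category.assoc _ _ _).symm.trans ((congrArg (· ≫ f) (SpecMap_comm hp)).trans (Category.assoc _ _ _))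
  have k₁ := key (TrivSqZeroExt.fstHom R (DualNumber A') (DualNumber A')).toRingHom
    (TrivSqZeroExt.fstHom R (DualNumber A) (DualNumber A)).toRingHom fun x => by
      exact fst_dualMap (dualMap φ) x
  have k₂ := key (doubleFstSnd R A').toRingHom (doubleFstSnd R A).toRingHom (doubleFstSnd_dualMap_dualMap R φ)
  have k₃ := key ((TrivSqZeroExt.inlAlgHom R A' A').comp (doubleFst R A')).toRingHom
    ((TrivSqZeroExt.inlAlgHom R A A).comp (doubleFst R A)).toRingHom fun x =>
      (congrArg TrivSqZeroExt.inl (doubleFst_dualMap_dualMap R φ x)).trans (dualMap_inl _ _).symm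
  have h₁' : Spec.map (CommRingCat.ofHom
      (TrivSqZeroExt.fstHom R (DualNumber A') (DualNumber A')).toRingHom) ≫ v ≫ f =
      Spec.map (CommRingCat.ofHom ((TrivSqZeroExt.inlAlgHom R A' A').comp
        (doubleFst R A')).toRingHom) ≫ v ≫ f := k₁.trans ((congrArg (w ≫ ·) h₁).trans k₃.symm)
  have h₂' : Spec.map (CommRingCat.ofHom (doubleFstSnd R A').toRingHom) ≫ v ≫ f =
      Spec.map (CommRingCat.ofHom ((TrivSqZeroExt.inlAlgHom R A' A').comp
        (doubleFst R A')).toRingHom) ≫ v ≫ f := k₂.trans ((congrArg (w ≫ ·) h₂).trans k₃.symm)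
  obtain ⟨g, hg⟩ := factors_epsToMul_of_isAffineOpen R hV hrange h₁' h₂'
  have hsq : Spec.map (CommRingCat.ofHom (epsToMul R A').toRingHom) ≫ w = v ≫ θ :=
    SpecMap_comm (epsToMul_dualMap R φ)
  refine ⟨_, w, g, hw, ?_, ?_⟩
  · change z ∈ Set.range (PrimeSpectrum.comap (dualMap φ))
    rw [hwr, ← hy]
    exact hya
  -- The preimage under `θ` of the basic open of `a` is again the basic open of `a`, i.e. the image
  -- of `v`; so the first projection from the fibre product factors through `v`.
  · have hl : Set.range (pullback.fst θ w) ⊆ Set.range v := by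
      rintro _ ⟨x, rfl⟩
      change (pullback.fst θ w x : PrimeSpectrum (DualNumber (DualNumber A))) ∈
        Set.range (PrimeSpectrum.comap (R := DualNumber (DualNumber A))
          (S := DualNumber (DualNumber A')) (dualMap (dualMap φ)))
      rw [hvr]
      have hx : (w (pullback.snd θ w x) : PrimeSpectrum (DualNumber A)) ∈
          Set.range (PrimeSpectrum.comap (dualMap φ)) := ⟨_, rfl⟩
      rw [hwr] at hx
      have h3 : θ (pullback.fst θ w x) = w (pullback.snd θ w x) := by
        have := congr($(pullback.condition (f := θ) (g := w)) x)
        exact this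
      rw [← h3] at hx
      have h4 : epsToMul R A (TrivSqZeroExt.inl a) = TrivSqZeroExt.inl (TrivSqZeroExt.inl a) := by
        rw [epsToMul_apply]; ext <;> simp
      intro h5
      exact hx (show epsToMul R A (TrivSqZeroExt.inl a) ∈ _ from h4 ▸ h5)
    let l := IsOpenImmersion.lift v (pullback.fst θ w) hl
    have hlv : l ≫ v = pullback.fst θ w := IsOpenImmersion.lift_fac _ _ _
    have hlw : l ≫ Spec.map (CommRingCat.ofHom (epsToMul R A').toRingHom) = pullback.snd θ w := by
      rw [← cancel_mono w, Category.assoc, hsq, ← Category.assoc, hlv, pullback.condition]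
    rw [← hlw, Category.assoc, hg, ← Category.assoc, hlv]

end DescentDual

/-- The ring `A[s, t]` with `s² = t² = 0` together with the data relating it to `A` and `A[ε]`. -/
theorem exists_doubleDual (R A : Type u) [CommRing R] [CommRing A] [Algebra R A] :
    ∃ (C : Type u) (_ : CommRing C) (_ : Algebra R C) (ι : A →ₐ[R] C) (s t : C)
      (θ : DualNumber A →ₐ[R] C) (p₁ p₂ : C →ₐ[R] DualNumber A) (q : C →ₐ[R] A),
      s * s = 0 ∧ t * t = 0 ∧ θ.comp (TrivSqZeroExt.inlAlgHom R A A) = ι ∧ θ DualNumber.eps = s * t ∧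
      p₁ s = 0 ∧ p₂ t = 0 ∧ q s = 0 ∧ Function.Injective θ ∧
      Function.Surjective (PrimeSpectrum.comap θ.toRingHom) ∧ q.comp θ = TrivSqZeroExt.fstHom R A A ∧
      (∀ (D : Type u) [CommRing D] [Algebra R D] (f : A →ₐ[R] D) (a b : D), a * a = 0 → b * b = 0 →
        ∃ g : C →ₐ[R] D, g.comp ι = f ∧ g s = a ∧ g t = b) ∧
      ∀ (T : Scheme.{u}) (g : Spec (.of C) ⟶ T), Spec.map (CommRingCat.ofHom p₁.toRingHom) ≫ g =
        Spec.map (CommRingCat.ofHom ((TrivSqZeroExt.inlAlgHom R A A).comp q).toRingHom) ≫ g →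
        Spec.map (CommRingCat.ofHom p₂.toRingHom) ≫ g =
        Spec.map (CommRingCat.ofHom ((TrivSqZeroExt.inlAlgHom R A A).comp q).toRingHom) ≫ g →
        ∃ g' : Spec (.of (DualNumber A)) ⟶ T, Spec.map (CommRingCat.ofHom θ.toRingHom) ≫ g' = g := by
  refine ⟨DualNumber (DualNumber A), inferInstance, inferInstance, doubleInl R A, DualNumber.eps,
    TrivSqZeroExt.inl DualNumber.eps, epsToMul R A, TrivSqZeroExt.fstHom R _ _, doubleFstSnd R A,
    doubleFst R A, DualNumber.eps_mul_eps, ?_, DualNumber.lift_comp_inlHom _, DualNumber.lift_apply_eps _,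
    TrivSqZeroExt.fst_inr (DualNumber A) (1 : DualNumber A), ?_, ?_, epsToMul_injective, comap_epsToMul_surjective,
    doubleFst_comp_epsToMul, fun D _ _ f a b ha hb => ?_, fun T g => exists_descent_epsToMul⟩
  · rw [← TrivSqZeroExt.inl_mul, DualNumber.eps_mul_eps, TrivSqZeroExt.inl_zero]
  · rw [doubleFstSnd_apply]; ext <;> simp
  · rw [doubleFst_apply]; simp
  · let g₁ : DualNumber A →ₐ[R] D := DualNumber.lift ⟨(f, b), hb, fun _ => Commute.all _ _⟩
    let g : DualNumber (DualNumber A) →ₐ[R] D := DualNumber.lift ⟨(g₁, a), ha, fun _ => Commute.all _ _⟩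
    refine ⟨g, ?_, DualNumber.lift_apply_eps _,
      (DualNumber.lift_apply_inl _ _).trans (DualNumber.lift_apply_eps _)⟩
    ext x
    change g (TrivSqZeroExt.inl (TrivSqZeroExt.inl x)) = _
    rw [DualNumber.lift_apply_inl, DualNumber.lift_apply_inl]

/-! ### Existence and uniqueness of the bracket -/

namespace Chart

variable {S : Scheme.{u}} {X : Over S} {c : Chart X}

section

variable {F : (Over S)ᵒᵖ ⥤ GrpCat.{w}}
  {A C D : Type u} [CommRing A] [CommRing C] [CommRing D] [Algebra c.R A] [Algebra c.R C] [Algebra c.R D]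

/-- The commutator `Y(s)(Z(t)) Z(t)⁻¹`. -/
def lieCommutator (Y : c.lie A (autPresheaf F)) (Z : c.lie A F) (f : A →ₐ[c.R] C) (s t : C)
    (hs : s * s = 0) (ht : t * t = 0) : F.obj (op (c.aff C)) :=
  act (lieEval Y f s hs) (lieEval Z f t ht) * (lieEval Z f t ht)⁻¹

theorem res_lieCommutator (Y : c.lie A (autPresheaf F)) (Z : c.lie A F) (f : A →ₐ[c.R] C) (s t : C)
    (hs : s * s = 0) (ht : t * t = 0) (g : C →ₐ[c.R] D) :
    res F g (lieCommutator Y Z f s t hs ht) = lieCommutator Y Z (g.comp f) (g s) (g t)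
      (by rw [← map_mul, hs, map_zero]) (by rw [← map_mul, ht, map_zero]) := by
  rw [lieCommutator, lieCommutator, map_mul, map_inv, res_lieEval]
  congr 1
  refine (map_act (c.map g) _ _).trans ?_
  exact congrArg₂ act (res_lieEval Y f s hs g) (res_lieEval Z f t ht g)

theorem lieCommutator_eq_one_left (Y : c.lie A (autPresheaf F)) (Z : c.lie A F) (f : A →ₐ[c.R] C) (s t : C)
    (hs : s * s = 0) (ht : t * t = 0) (h : s = 0) : lieCommutator Y Z f s t hs ht = 1 := by
  rw [lieCommutator, lieEval_eq_one Y f s hs h, act_one_left, mul_inv_cancel]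

theorem lieCommutator_eq_one_right (Y : c.lie A (autPresheaf F)) (Z : c.lie A F) (f : A →ₐ[c.R] C) (s t : C)
    (hs : s * s = 0) (ht : t * t = 0) (h : t = 0) : lieCommutator Y Z f s t hs ht = 1 := by
  rw [lieCommutator, lieEval_eq_one Z f t ht h, act_one_right, inv_one, mul_one]

theorem lieCommutator_eq_lieEval_of_comp {Y : c.lie A (autPresheaf F)} {Z W : c.lie A F} {ι : A →ₐ[c.R] C}
    {s t : C} {hs : s * s = 0} {ht : t * t = 0} {hst : s * t * (s * t) = 0}
    (h : lieCommutator Y Z ι s t hs ht = lieEval W ι (s * t) hst)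
    (g : C →ₐ[c.R] D) {f : A →ₐ[c.R] D} {a b : D} (hf : g.comp ι = f) (hgs : g s = a) (hgt : g t = b)
    (ha : a * a = 0) (hb : b * b = 0) (hab : a * b * (a * b) = 0) :
    lieCommutator Y Z f a b ha hb = lieEval W f (a * b) hab := by
  subst hf hgs hgt
  have h₂ := (res_lieEval W ι (s * t) hst g).trans (lieEval_congr W rfl (map_mul g s t) _)
  exact (res_lieCommutator Y Z ι s t hs ht g).symm.trans ((congrArg _ h).trans h₂)

end

variable (G : Over S) [GrpObj G]

/-- Only compatibility with the projections to `S` is at stake. It may be checked after the dominant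
surjection given by `f`, where it holds because `x` is a morphism over `S`. -/
theorem exists_res_eq_of_comp {A C : Type u} [CommRing A] [CommRing C] [Algebra c.R A] [Algebra c.R C]
    (f : A →ₐ[c.R] C) (hf : Function.Injective f)
    (hf' : Function.Surjective (PrimeSpectrum.comap f.toRingHom)) (x : c.aff C ⟶ G)
    (g : Spec (.of A) ⟶ G.left) (hg : Spec.map (CommRingCat.ofHom f.toRingHom) ≫ g = x.left) :
    ∃ W : (yonedaGrpObj G).obj (op (c.aff A)), res (yonedaGrpObj G) f W = x := by
  let θ : Spec (.of C) ⟶ Spec (.of A) := Spec.map (CommRingCat.ofHom f.toRingHom)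
  have : IsSchemeTheoreticallyDominant θ := isSchemeTheoreticallyDominant_SpecMap _ hf
  have : Surjective θ := ⟨hf'⟩
  have hgw : g ≫ G.hom = (c.aff A).hom := by
    refine hom_ext_of_schemeTheoreticallyDominant θ ?_
    exact (Category.assoc _ _ _).symm.trans ((congrArg (· ≫ G.hom) hg).trans
      ((Over.w x).trans (Over.w (c.map f)).symm))
  let W : c.aff A ⟶ G := Over.homMk g hgw
  exact ⟨W, Over.OverMorphism.ext hg⟩

theorem eq_of_res_eq {A C : Type u} [CommRing A] [CommRing C] [Algebra c.R A] [Algebra c.R C]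
    (f : A →ₐ[c.R] C) (hf : Function.Injective f)
    (hf' : Function.Surjective (PrimeSpectrum.comap f.toRingHom)) {a b : (yonedaGrpObj G).obj (op (c.aff A))}
    (h : res (yonedaGrpObj G) f a = res (yonedaGrpObj G) f b) : a = b :=
  separated (yonedaGrpObj_isSeparatedPresheaf G) (ι := PUnit.{u+1}) (fun _ => f)
    (fun _ hx => hf ((hx ⟨⟩).trans (map_zero f).symm)) ⟨⟩ hf' _ _ fun _ => h

/-- Since `x` restricts to `1` along `q`, its constant extension along `i.comp q` is `1` too.
Triviality along `p₁` and `p₂` is thus exactly the constancy that the descent hypothesis asks for.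
-/
theorem exists_res_eq_of_descent {A B C : Type u} [CommRing A] [CommRing B] [CommRing C]
    [Algebra c.R A] [Algebra c.R B] [Algebra c.R C]
    (f : B →ₐ[c.R] C) (hf : Function.Injective f)
    (hf' : Function.Surjective (PrimeSpectrum.comap f.toRingHom)) (i : A →ₐ[c.R] B) (q : C →ₐ[c.R] A)
    (p₁ p₂ : C →ₐ[c.R] B)
    (hdesc : ∀ g : Spec (.of C) ⟶ G.left, Spec.map (CommRingCat.ofHom p₁.toRingHom) ≫ g =
      Spec.map (CommRingCat.ofHom (i.comp q).toRingHom) ≫ g → Spec.map (CommRingCat.ofHom p₂.toRingHom) ≫ g =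
      Spec.map (CommRingCat.ofHom (i.comp q).toRingHom) ≫ g →
      ∃ g' : Spec (.of B) ⟶ G.left, Spec.map (CommRingCat.ofHom f.toRingHom) ≫ g' = g)
    (x : (yonedaGrpObj G).obj (op (c.aff C))) (h₁ : res (yonedaGrpObj G) p₁ x = 1)
    (h₂ : res (yonedaGrpObj G) p₂ x = 1) (h₃ : res (yonedaGrpObj G) q x = 1) :
    ∃ W : (yonedaGrpObj G).obj (op (c.aff B)), res (yonedaGrpObj G) (q.comp f) W = 1 ∧
      res (yonedaGrpObj G) f W = x := by
  have h₄ : res (yonedaGrpObj G) (i.comp q) x = 1 :=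
    (res_res q i x).symm.trans ((congrArg _ h₃).trans (map_one _))
  let x' : c.aff C ⟶ G := x
  have k₁ : c.map p₁ ≫ x' = c.map (i.comp q) ≫ x' := h₁.trans h₄.symm
  have k₂ : c.map p₂ ≫ x' = c.map (i.comp q) ≫ x' := h₂.trans h₄.symm
  obtain ⟨g, hg⟩ := hdesc x'.left (congrArg (CommaMorphism.left (X := _)) k₁)
    (congrArg (CommaMorphism.left (X := _)) k₂)
  obtain ⟨W, hW⟩ := exists_res_eq_of_comp G f hf hf' x' g hg
  exact ⟨W, (res_res f q W).symm.trans ((congrArg _ hW).trans h₃), hW⟩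

/-- The commutator over the universal ring `B[s, t]` becomes trivial when `s = 0` or `t = 0`, so it
descends along `ε ↦ st` to some `W` over `B[ε]`. Setting `s = t = 0` shows that `W` lies in the Lie
algebra. Arbitrary parameters are specializations of the universal ones, and injectivity of `B[ε] →
B[s, t]` together with surjectivity on spectra gives uniqueness. -/
theorem existsUnique_isLieBracket (Y : c.lie c.B (autPresheaf (yonedaGrpObj G)))
    (Z : c.lie c.B (yonedaGrpObj G)) : ∃! W : c.lie c.B (yonedaGrpObj G), IsLieBracket Y Z W := by
  obtain ⟨C, _, _, ι, s, t, θ, p₁, p₂, q, hs, ht, hθ, hθ', hp₁, hp₂, hq, hinj, hsurj, hqθ, hlift, hdesc⟩ :=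
    exists_doubleDual c.R c.B
  have hst : s * t * (s * t) = 0 := by linear_combination t * t * hs
  have hlieEval (W : c.lie c.B (yonedaGrpObj G)) : res (yonedaGrpObj G) θ W.1 = lieEval W ι (s * t) hst := by
    rw [← lieEval_inl_eps W]
    exact (res_lieEval W _ _ _ θ).trans (lieEval_congr W hθ hθ' _)
  obtain ⟨W, hW, hW'⟩ := exists_res_eq_of_descent G θ hinj hsurj (TrivSqZeroExt.inlAlgHom c.R c.B c.B)
    q p₁ p₂ (hdesc G.left) (lieCommutator Y Z ι s t hs ht)
    ((res_lieCommutator _ _ _ _ _ _ _ _).trans (lieCommutator_eq_one_left _ _ _ _ _ _ _ hp₁))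
    ((res_lieCommutator _ _ _ _ _ _ _ _).trans (lieCommutator_eq_one_right _ _ _ _ _ _ _ hp₂))
    ((res_lieCommutator _ _ _ _ _ _ _ _).trans (lieCommutator_eq_one_left _ _ _ _ _ _ _ hq))
  rw [hqθ] at hW
  obtain ⟨W, rfl⟩ : ∃ W' : c.lie c.B (yonedaGrpObj G), W'.1 = W := ⟨⟨W, hW⟩, rfl⟩
  rw [hlieEval] at hW'
  refine ⟨W, fun D _ _ f a b ha hb => ?_, fun W' hW'' => ?_⟩
  · obtain ⟨g, hg, hgs, hgt⟩ := hlift D f a b ha hb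
    exact lieCommutator_eq_lieEval_of_comp hW'.symm g hg hgs hgt ha hb _
  · refine Subtype.ext (eq_of_res_eq G θ hinj hsurj ?_)
    rw [hlieEval, hlieEval, hW']
    exact (hW'' _ _ _ _ hs ht).symm

end Chart

/-! ### Charts with free differentials, and one-forms -/

theorem isSimplex_of_mul_eq_zero {B C : Type u} [CommRing B] [CommRing C] {n : ℕ}
    {y : Fin (n + 1) → (B →+* C)} (h : ∀ i j a b, (y i a - y j a) * (y i b - y j b) = 0)
    (h' : ∀ i j a, (y i a - y 0 a) * (y j a - y 0 a) = 0) : IsSimplex y where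
  close i j := by
    refine ⟨Ideal.span (Set.range fun a => y i a - y j a), ?_, fun b => Ideal.subset_span ⟨b, rfl⟩⟩
    rw [pow_two, Ideal.span_mul_span, Ideal.span_eq_bot]
    rintro _ ⟨_, ⟨a, rfl⟩, _, ⟨b, rfl⟩, rfl⟩
    exact h i j a b
  strong := h'

theorem exists_chart_of_hom {S : Scheme.{u}} {X : Over S} {A B : CommRingCat.{u}} (φ : A ⟶ B)
    (hφ : φ.hom.IsStandardSmooth) (i : Spec A ⟶ S) (j : Spec B ⟶ X.left) [IsOpenImmersion i]
    [IsOpenImmersion j] (comm : j ≫ X.hom = Spec.map φ ≫ i) :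
    ∃ c : Chart X, Set.range c.j = Set.range j ∧ Set.range c.i = Set.range i ∧
      Module.Free c.B Ω[c.B⁄c.R] ∧ Module.Finite c.B Ω[c.B⁄c.R] := by
  let := φ.hom.toAlgebra
  have : Algebra.IsStandardSmooth A B := hφ
  refine ⟨{ R := A, B := B, i := i, j := j, open_i := inferInstance, open_j := inferInstance, comm := comm },
    rfl, rfl, ?_, ?_⟩
  · exact Algebra.IsStandardSmooth.free_kaehlerDifferential
  · change Module.Finite B Ω[B⁄A]
    infer_instance

/-- Smooth morphisms are locally standard smooth, and then the differentials are finite free.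
Restricting to the preimage of `W` beforehand keeps the base of the chart inside `W`. -/
theorem exists_chart {S : Scheme.{u}} (X : Over S) [Smooth X.hom] (p : X.left) (W : S.Opens)
    (hW : X.hom p ∈ W) : ∃ c : Chart X, p ∈ Set.range c.j ∧ Set.range c.i ⊆ W ∧
      Module.Free c.B Ω[c.B⁄c.R] ∧ Module.Finite c.B Ω[c.B⁄c.R] := by
  let q : (X.hom ⁻¹ᵁ W).toScheme := ⟨p, hW⟩
  obtain ⟨U, hU, V, hV, hq, e, hs⟩ := Smooth.exists_isStandardSmooth (X.hom ∣_ W) q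
  have h := hU.SpecMap_appLE_fromSpec (X.hom ∣_ W) hV e
  obtain ⟨c, hj, hi, hc⟩ := exists_chart_of_hom (X := X) _ hs (hU.fromSpec ≫ W.ι)
    (hV.fromSpec ≫ (X.hom ⁻¹ᵁ W).ι) (by
      rw [Category.assoc, ← morphismRestrict_ι, ← Category.assoc, ← h, Category.assoc])
  refine ⟨c, ?_, ?_, hc⟩
  · obtain ⟨x, hx⟩ : q ∈ Set.range hV.fromSpec := by rwa [hV.range_fromSpec]
    rw [hj]
    exact ⟨x, congrArg (X.hom ⁻¹ᵁ W).ι hx⟩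
  · rw [hi]
    rintro _ ⟨x, rfl⟩
    exact (hU.fromSpec x).2

namespace Chart

variable {S : Scheme.{u}} {X : Over S} {c : Chart X} {F : (Over S)ᵒᵖ ⥤ GrpCat.{w}}
  {C D : Type u} [CommRing C] [CommRing D] [Algebra c.R C] [Algebra c.R D]

theorem map_pt (y : c.B →ₐ[c.R] C) (f : C →ₐ[c.R] D) : c.map f ≫ c.pt y = c.pt (f.comp y) := by
  ext : 1
  change Spec.map _ ≫ Spec.map _ ≫ c.j = Spec.map _ ≫ c.j
  rw [← Category.assoc, ← Spec.map_comp, ← CommRingCat.ofHom_comp]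
  rfl

theorem res_app {n : ℕ} (f : CombForm X F n) (y : Fin (n + 1) → (c.B →ₐ[c.R] C))
    (hy : IsSimplex fun i => (y i : c.B →+* C)) (g : C →ₐ[c.R] D)
    {y' : Fin (n + 1) → (c.B →ₐ[c.R] D)} (hy' : IsSimplex fun i => (y' i : c.B →+* D))
    (h : ∀ i, g.comp (y i) = y' i) :
    res F g (f.app (fun i => c.pt (y i)) (c.inDelta hy)) = f.app (fun i => c.pt (y' i)) (c.inDelta hy') := by
  have h1 : (fun i => c.map g ≫ c.pt (y i)) = fun i => c.pt (y' i) :=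
    funext fun i => (map_pt (y i) g).trans (congrArg c.pt (h i))
  have h2 : F.map (c.map g).op (f.app (fun i => c.pt (y i)) (c.inDelta hy)) = _ :=
    f.naturality (c.map g) (fun i => c.pt (y i)) (c.inDelta hy)
  have h3 := f.app_congr h1 ((c.inDelta hy).comp (c.map g))
  exact h2.trans h3

theorem app_eq_one {n : ℕ} (f : CombForm X F n) (y : Fin (n + 1) → (c.B →ₐ[c.R] C))
    (hy : IsSimplex fun i => (y i : c.B →+* C)) (i : Fin n) (h : y i.castSucc = y i.succ) :
    f.app (fun i => c.pt (y i)) (c.inDelta hy) = 1 :=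
  f.degenerate _ _ i (congrArg c.pt h)

/-- One-forms on a chart with free module of differentials are classical. -/
theorem exists_represents_one (hF : IsSeparatedPresheaf F) [Module.Free c.B Ω[c.B⁄c.R]]
    [Module.Finite c.B Ω[c.B⁄c.R]] (χ : CombForm X F 1) :
    ∃ K : c.TensorForm F c.B 1, Represents K χ := by
  classical
  let κ := Module.Free.ChooseBasisIndex c.B Ω[c.B⁄c.R]
  let b : Module.Basis κ c.B Ω[c.B⁄c.R] := Module.Free.chooseBasis c.B Ω[c.B⁄c.R]
  let d : Derivation c.R c.B Ω[c.B⁄c.R] := KaehlerDifferential.D c.R c.B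
  -- The first-order Taylor expansion `x + ∑ ∂ₖx εₖ` in the coordinates of the basis `b`. With the
  -- constant inclusion it forms a 1-simplex from which all others are induced.
  let y₁ : c.B →ₐ[c.R] TrivSqZeroExt c.B (κ → c.B) :=
    { toFun x := TrivSqZeroExt.inl x + TrivSqZeroExt.inr (b.equivFun (d x))
      map_one' := by simp
      map_zero' := by simp
      map_add' x x' := by ext <;> simp
      map_mul' x x' := by ext <;> simp
      commutes' r := by ext <;> simp [TrivSqZeroExt.algebraMap_eq_inl'] }
  let y : Fin 2 → (c.B →ₐ[c.R] TrivSqZeroExt c.B (κ → c.B)) := ![TrivSqZeroExt.inlAlgHom c.R c.B _, y₁]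
  have hy : IsSimplex fun i => (y i : c.B →+* TrivSqZeroExt c.B (κ → c.B)) := by
    have hdiff (i j : Fin 2) (x : c.B) : (y i x - y j x).fst = 0 := by
      have h (i : Fin 2) : (y i x).fst = x := by fin_cases i <;> simp [y, y₁]
      rw [TrivSqZeroExt.fst_sub, h, h, sub_self]
    have hmul (p q : TrivSqZeroExt c.B (κ → c.B)) (hp : p.fst = 0) (hq : q.fst = 0) : p * q = 0 := by
      ext <;> simp [hp, hq]
    exact isSimplex_of_mul_eq_zero (fun i j a b => hmul _ _ (hdiff i j a) (hdiff i j b))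
      fun i j a => hmul _ _ (hdiff i 0 a) (hdiff j 0 a)
  -- Setting all `εₖ` to zero makes the two vertices coincide, so the value of `χ` becomes trivial
  -- and is a product of components.
  obtain ⟨Y, hY⟩ := exists_eq_prod_lieEval hF (c := c) (A := c.B) (κ := κ)
    (χ.app (fun i => c.pt (y i)) (c.inDelta hy)) (by
      have hy' : IsSimplex fun _ : Fin 2 => (AlgHom.id c.R c.B : c.B →+* c.B) :=
        isSimplex_of_mul_eq_zero (fun i j a b => by simp) fun i j a => by simp
      refine (res_app χ y hy _ (y' := fun _ => AlgHom.id c.R c.B) hy' fun i => ?_).trans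
        (app_eq_one χ _ hy' 0 rfl)
      ext x
      fin_cases i <;> simp [y, y₁])
  refine ⟨Finset.univ.toList.map fun k => (Y k, exteriorPower.ιMulti c.B 1 fun _ => b k), ?_⟩
  intro C _ _ z hz
  let m (k : κ) : C := edge z hz 0 (b k)
  have hm (k l) : m k * m l = 0 := edge_mul_edge z hz 0 _ _
  have hz1 (x : c.B) : z 1 x = z 0 x + ∑ k, z 0 (b.equivFun (d x) k) * m k := by
    have h1 : z 1 x - z 0 x = edge z hz 0 (d x) := (edge_D z hz 0 x).symm
    have h2 : edge z hz 0 (d x) = ∑ k, z 0 (b.equivFun (d x) k) * m k := by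
      conv_lhs => rw [← b.sum_equivFun (d x)]
      rw [map_sum]
      exact Finset.sum_congr rfl fun k _ => edge_smul z hz 0 _ _
    rw [← h2, ← h1, add_sub_cancel]
  -- The specialization sends `εₖ` to the value of the basis form `b k` on the edge of `z`, and
  -- carries `y` to `z`.
  let φ := multiDualLift (R := c.R) (z 0) m hm
  have hφ (x : c.B) : φ (TrivSqZeroExt.inl x) = z 0 x := multiDualLift_inl (z 0) m hm x
  have h := res_app χ y hy φ hz fun i => by
    ext x
    fin_cases i
    · exact hφ x
    · refine Eq.trans ?_ (hz1 x).symm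
      exact (map_add φ _ _).trans (congrArg₂ _ (hφ x) (multiDualLift_inr (z 0) m hm _))
  refine h.symm.trans ((congrArg _ hY).trans ((map_list_prod _ _).trans ?_))
  rw [TensorForm.eval, List.map_map, List.map_map]
  refine congrArg List.prod (List.map_congr_left fun k _ => ?_)
  refine (res_lieEval _ _ _ _ _).trans ?_
  refine lieEval_congr _ ?_ ((multiDualLift_eps (z 0) m hm k).trans ?_) _
  · ext x; exact hφ x
  · rw [evalForm_ιMulti]; simp [m]

end Chart

/-! ### The universal simplex and the functions on it -/

section UniversalSimplex

variable (R B : Type u) [CommRing R] [CommRing B] [Algebra R B] (n : ℕ)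

/-- The relations defining the universal infinitesimal simplex. -/
inductive SimplexRel : MvPolynomial (Fin (n + 1) × B) R → Prop
  | algebraMap (i : Fin (n + 1)) (r : R) : SimplexRel (.X (i, algebraMap R B r) - .C r)
  | add (i : Fin (n + 1)) (a b : B) : SimplexRel (.X (i, a + b) - (.X (i, a) + .X (i, b)))
  | mul (i : Fin (n + 1)) (a b : B) : SimplexRel (.X (i, a * b) - .X (i, a) * .X (i, b))
  | close (i j : Fin (n + 1)) (a b : B) :
    SimplexRel ((.X (i, a) - .X (j, a)) * (.X (i, b) - .X (j, b)))
  | strong (i j : Fin (n + 1)) (a : B) :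
    SimplexRel ((.X (i, a) - .X (0, a)) * (.X (j, a) - .X (0, a)))

variable {R B n}

/-- Both simplex conditions are equations between values of the vertices, since closeness just says
that the products of differences vanish. They can therefore be imposed on a polynomial ring with one
variable for each pair of a vertex and an element of `B`. -/
theorem exists_universal_simplex : ∃ (U : Type u) (_ : CommRing U) (_ : Algebra R U)
    (y : Fin (n + 1) → (B →ₐ[R] U)), IsSimplex (fun i => (y i : B →+* U)) ∧
      Algebra.adjoin R (⋃ i, Set.range (y i)) = ⊤ ∧
      ∀ (C : Type u) [CommRing C] [Algebra R C] (z : Fin (n + 1) → (B →ₐ[R] C)),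
        IsSimplex (fun i => (z i : B →+* C)) → ∃ φ : U →ₐ[R] C, ∀ i, φ.comp (y i) = z i := by
  let I : Ideal (MvPolynomial (Fin (n + 1) × B) R) := Ideal.span {p | SimplexRel R B n p}
  let U := MvPolynomial (Fin (n + 1) × B) R ⧸ I
  let π : MvPolynomial (Fin (n + 1) × B) R →ₐ[R] U := Ideal.Quotient.mkₐ R I
  have hπ {p} (hp : SimplexRel R B n p) : π p = 0 := Ideal.Quotient.eq_zero_iff_mem.2 (Ideal.subset_span hp)
  have halg (i : Fin (n + 1)) (r : R) : π (.X (i, algebraMap R B r)) = algebraMap R U r := by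
    have := hπ (.algebraMap i r)
    rw [map_sub, sub_eq_zero] at this
    exact this
  let y (i : Fin (n + 1)) : B →ₐ[R] U :=
    { toFun b := π (.X (i, b))
      map_one' := by simpa using halg i 1
      map_zero' := by simpa using halg i 0
      map_add' a b := by simpa [sub_eq_zero] using hπ (.add i a b)
      map_mul' a b := by simpa [sub_eq_zero] using hπ (.mul i a b)
      commutes' r := halg i r }
  refine ⟨U, inferInstance, inferInstance, y, isSimplex_of_mul_eq_zero (fun i j a b => ?_) fun i j a => ?_,
    ?_, fun C _ _ z hz => ?_⟩
  · have := hπ (.close i j a b)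
    rw [map_mul, map_sub, map_sub] at this
    exact this
  · have := hπ (.strong i j a)
    rw [map_mul, map_sub, map_sub] at this
    exact this
  · have h : Algebra.adjoin R (Set.range (MvPolynomial.X (R := R) (σ := Fin (n + 1) × B))) = ⊤ :=
      MvPolynomial.adjoin_range_X
    have h2 := congrArg (Subalgebra.map π) h
    rw [AlgHom.map_adjoin, Algebra.map_top, (AlgHom.range_eq_top π).2 Ideal.Quotient.mk_surjective] at h2
    rw [eq_top_iff, ← h2]
    refine Algebra.adjoin_mono ?_
    rintro _ ⟨_, ⟨⟨i, b⟩, rfl⟩, rfl⟩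
    exact Set.mem_iUnion.2 ⟨i, b, rfl⟩
  · let ψ : MvPolynomial (Fin (n + 1) × B) R →ₐ[R] C := MvPolynomial.aeval fun p => z p.1 p.2
    have hψ (i b) : ψ (.X (i, b)) = z i b := MvPolynomial.aeval_X _ _
    have hI : I ≤ RingHom.ker ψ := by
      refine Ideal.span_le.2 fun p hp => ?_
      change ψ p = 0
      induction hp with
      | algebraMap i r => rw [map_sub, hψ, AlgHom.commutes, ← MvPolynomial.algebraMap_eq, AlgHom.commutes, sub_self]
      | add i a b => rw [map_sub, map_add, hψ, hψ, hψ, map_add, sub_self]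
      | mul i a b => rw [map_sub, map_mul, hψ, hψ, hψ, map_mul, sub_self]
      | close i j a b =>
        rw [map_mul, map_sub, map_sub, hψ, hψ, hψ, hψ]
        exact hz.mul_eq_zero i j a b
      | strong i j a =>
        rw [map_mul, map_sub, map_sub, hψ, hψ, hψ]
        exact hz.strong i j a
    exact ⟨Ideal.Quotient.liftₐ I ψ hI, fun i => AlgHom.ext (hψ i)⟩

end UniversalSimplex

section ThreeSimplex

variable {R B U : Type u} [CommRing R] [CommRing B] [CommRing U] [Algebra R B] [Algebra R U]
  {y : Fin 4 → (B →ₐ[R] U)}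

/-- The `yᵢ` are multiplicative, so these monomials are closed under products; hence their additive
span is a subalgebra, and it contains the generators. -/
theorem mem_closure_mul_of_adjoin_eq_top (hU : Algebra.adjoin R (⋃ i, Set.range (y i)) = ⊤) (x : U) :
    x ∈ AddSubgroup.closure {x | ∃ a b c d, x = y 0 a * y 1 b * y 2 c * y 3 d} := by
  have hmul : ∀ x ∈ AddSubgroup.closure {x : U | ∃ a b c d, x = y 0 a * y 1 b * y 2 c * y 3 d},
      ∀ x' ∈ AddSubgroup.closure {x : U | ∃ a b c d, x = y 0 a * y 1 b * y 2 c * y 3 d},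
      x * x' ∈ AddSubgroup.closure {x : U | ∃ a b c d, x = y 0 a * y 1 b * y 2 c * y 3 d} := by
    intro x h x' h'
    induction h, h' using AddSubgroup.closure_induction₂ with
    | mem x x' h h' =>
      obtain ⟨a, b, c, d, rfl⟩ := h
      obtain ⟨a', b', c', d', rfl⟩ := h'
      exact AddSubgroup.subset_closure ⟨a * a', b * b', c * c', d * d', by simp only [map_mul]; ring⟩
    | zero_left x h => rw [zero_mul]; exact zero_mem _
    | zero_right x h => rw [mul_zero]; exact zero_mem _
    | add_left x x' z _ _ _ h h' => rw [add_mul]; exact add_mem h h'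
    | add_right x x' z _ _ _ h h' => rw [mul_add]; exact add_mem h h'
    | neg_left x z _ _ h => rw [neg_mul]; exact neg_mem h
    | neg_right x z _ _ h => rw [mul_neg]; exact neg_mem h
  have hx : x ∈ Algebra.adjoin R (⋃ i, Set.range (y i)) := hU ▸ trivial
  induction hx using Algebra.adjoin_induction with
  | mem x hx =>
    obtain ⟨i, b, rfl⟩ := Set.mem_iUnion.1 hx
    refine AddSubgroup.subset_closure ?_
    fin_cases i
    · exact ⟨b, 1, 1, 1, by simp⟩
    · exact ⟨1, b, 1, 1, by simp⟩
    · exact ⟨1, 1, b, 1, by simp⟩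
    · exact ⟨1, 1, 1, b, by simp⟩
  | algebraMap r => exact AddSubgroup.subset_closure ⟨algebraMap R B r, 1, 1, 1, by simp⟩
  | add x x' _ _ h h' => exact add_mem h h'
  | mul x x' _ _ h h' =>
    exact hmul _ h _ h'

/-- Functions on the universal three-simplex which vanish on its degenerate faces are given by
three-forms. -/
theorem exists_evalForm_eq (hy : IsSimplex fun i => (y i : B →+* U))
    (hU : Algebra.adjoin R (⋃ i, Set.range (y i)) = ⊤) (p₀ p₁ p₂ : U →ₐ[R] U)
    (h₀ : ∀ i, p₀.comp (y i) = y (![0, 0, 2, 3] i)) (h₁ : ∀ i, p₁.comp (y i) = y (![0, 1, 1, 3] i))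
    (h₂ : ∀ i, p₂.comp (y i) = y (![0, 1, 2, 2] i)) (x : U) (hx₀ : p₀ x = 0) (hx₁ : p₁ x = 0)
    (hx₂ : p₂ x = 0) : ∃ ω : ⋀[B]^3 Ω[B⁄R], evalForm y hy ω = x := by
  -- The composite `(1 - p₂)(1 - p₁)(1 - p₀)` fixes every function vanishing on the three degenerate
  -- faces. It sends `y₀a y₁b y₂c y₃d` to `y₀a (y₁b - y₀b)(y₂c - y₁c)(y₃d - y₂d)`, which by the
  -- square-zero relations is the value of `a db ∧ dc ∧ dd`.
  let T : U →+ U := ((AddMonoidHom.id U - p₂.toRingHom.toAddMonoidHom).comp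
    (AddMonoidHom.id U - p₁.toRingHom.toAddMonoidHom)).comp
    (AddMonoidHom.id U - p₀.toRingHom.toAddMonoidHom)
  have hT (x : U) : T x = (x - p₀ x - p₁ (x - p₀ x)) - p₂ (x - p₀ x - p₁ (x - p₀ x)) := rfl
  have key (x : U) : T x ∈ (evalForm y hy).range := by
    induction mem_closure_mul_of_adjoin_eq_top hU x using AddSubgroup.closure_induction with
    | zero => rw [map_zero]; exact zero_mem _
    | add x x' _ _ h h' => rw [map_add]; exact add_mem h h'
    | neg x _ h => rw [map_neg]; exact neg_mem h
    | mem x hx =>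
      obtain ⟨a, b, c, d, rfl⟩ := hx
      refine ⟨a • exteriorPower.ιMulti B 3 fun i => KaehlerDifferential.D R B (![b, c, d] i), ?_⟩
      have e₀ (i) (x) : p₀ (y i x) = y (![0, 0, 2, 3] i) x := congr($(h₀ i) x)
      have e₁ (i) (x) : p₁ (y i x) = y (![0, 1, 1, 3] i) x := congr($(h₁ i) x)
      have e₂ (i) (x) : p₂ (y i x) = y (![0, 1, 2, 2] i) x := congr($(h₂ i) x)
      rw [hT, evalForm_smul_ιMulti_D, Fin.prod_univ_three]
      simp only [map_sub, map_mul, e₀, e₁, e₂]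
      have k₁ := hy.mul_eq_zero 1 0 b c
      have k₂ := hy.mul_eq_zero 2 0 c d
      change y 0 a * ((y 1 b - y 0 b) * (y 2 c - y 0 c) * (y 3 d - y 0 d)) =
        (y 0 a * y 1 b * y 2 c * y 3 d - y 0 a * y 0 b * y 2 c * y 3 d -
          (y 0 a * y 1 b * y 1 c * y 3 d - y 0 a * y 0 b * y 1 c * y 3 d)) -
        (y 0 a * y 1 b * y 2 c * y 2 d - y 0 a * y 0 b * y 2 c * y 2 d -
          (y 0 a * y 1 b * y 1 c * y 2 d - y 0 a * y 0 b * y 1 c * y 2 d))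
      simp only [AlgHom.coe_toRingHom] at k₁ k₂
      linear_combination (y 0 a * (y 3 d - y 2 d)) * k₁ + y 0 a * (y 1 b - y 0 b) * k₂
  obtain ⟨ω, hω⟩ := key x
  exact ⟨ω, by rw [hω, hT, hx₀, sub_zero, hx₁, sub_zero, hx₂, sub_zero]⟩

end ThreeSimplex

/-- As `M` has square zero, `φ - ε` is a derivation along `ε`. It factors through the differentials,
and the `m k` are its values on the basis; they lie in `M` because exact differentials span. -/
theorem exists_expansion {R A U κ : Type*} [CommRing R] [CommRing A] [CommRing U] [Algebra R A] [Fintype κ]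
    (b : Module.Basis κ A Ω[A⁄R]) (ε φ : A →+* U)
    (h : ∀ r, φ (algebraMap R A r) = ε (algebraMap R A r)) (M : Ideal U) (hM : ∀ x, φ x - ε x ∈ M)
    (hM' : ∀ a ∈ M, ∀ b ∈ M, a * b = 0) :
    ∃ m : κ → U, (∀ k, m k ∈ M) ∧
      ∀ x, φ x = ε x + ∑ k, ε (b.equivFun (KaehlerDifferential.D R A x) k) * m k := by
  let := ε.toAlgebra
  let : Algebra R U := (ε.comp (algebraMap R A)).toAlgebra
  have : IsScalarTower R A U := IsScalarTower.of_algebraMap_eq fun r => rfl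
  have hsmul (a : A) (x : U) : a • x = ε a * x := rfl
  have hsmul' (a : R) (x : U) : a • x = ε (algebraMap R A a) * x := rfl
  let δ : Derivation R A U :=
    { toFun x := φ x - ε x
      map_add' x y := by simp only [map_add]; ring
      map_smul' r x := by
        simp only [RingHom.id_apply, hsmul', Algebra.smul_def, map_mul, h, mul_sub]
      map_one_eq_zero' := by simp
      leibniz' x y := by
        have := hM' _ (hM x) _ (hM y)
        simp only [LinearMap.coe_mk, AddHom.coe_mk, hsmul, map_mul]
        linear_combination this }
  let l := δ.liftKaehlerDifferential
  have hl (x : A) : l (KaehlerDifferential.D R A x) = φ x - ε x := δ.liftKaehlerDifferential_comp_D x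
  refine ⟨fun k => l (b k), fun k => ?_, fun x => ?_⟩
  · change l (b k) ∈ M
    generalize b k = ω
    have hω : ω ∈ Submodule.span A (Set.range (KaehlerDifferential.D R A)) := by
      rw [KaehlerDifferential.span_range_derivation]; trivial
    induction hω using Submodule.span_induction with
    | mem x hx => obtain ⟨x, rfl⟩ := hx; rw [hl]; exact hM x
    | zero => rw [map_zero]; exact zero_mem _
    | add x y _ _ hx hy => rw [map_add]; exact add_mem hx hy
    | smul a x _ hx => rw [map_smul, hsmul]; exact M.mul_mem_left _ hx
  · have h2 : l (KaehlerDifferential.D R A x) =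
        ∑ k, ε (b.equivFun (KaehlerDifferential.D R A x) k) * l (b k) := by
      conv_lhs => rw [← b.sum_equivFun (KaehlerDifferential.D R A x)]
      rw [map_sum]
      exact Finset.sum_congr rfl fun k _ => map_smul l _ _
    rw [← h2, hl, add_sub_cancel]

theorem map_evalForm {R B C D : Type u} [CommRing R] [CommRing B] [CommRing C] [CommRing D] [Algebra R B]
    [Algebra R C] [Algebra R D] {n : ℕ} {y : Fin (n + 1) → (B →ₐ[R] C)}
    (hy : IsSimplex fun i => (y i : B →+* C)) {z : Fin (n + 1) → (B →ₐ[R] D)}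
    (hz : IsSimplex fun i => (z i : B →+* D)) (g : C →ₐ[R] D) (h : ∀ i, g.comp (y i) = z i)
    (ω : ⋀[B]^n Ω[B⁄R]) : g (evalForm y hy ω) = evalForm z hz ω := by
  have h' (i x) : g (y i x) = z i x := congr($(h i) x)
  induction ω using form_induction with
  | hadd ω ω' k k' => rw [map_add, map_add, map_add, k, k']
  | hD c b =>
    rw [evalForm_smul_ιMulti_D, evalForm_smul_ιMulti_D, map_mul, map_prod, h']
    simp only [map_sub, h']

/-- Modulo the simplex ideal all vertices agree, so every element of the algebra they generate is
congruent to its image under retraction to the diagonal. -/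
theorem sub_mem_simplexIdeal_of_adjoin_eq_top {R B U : Type u} [CommRing R] [CommRing B] [CommRing U]
    [Algebra R B] [Algebra R U] {n : ℕ} {y : Fin (n + 1) → (B →ₐ[R] U)}
    (hU : Algebra.adjoin R (⋃ i, Set.range (y i)) = ⊤) (r : U →ₐ[R] B)
    (hr : ∀ i, r.comp (y i) = AlgHom.id R B) (x : U) : x - y 0 (r x) ∈ simplexIdeal y := by
  have hx : x ∈ Algebra.adjoin R (⋃ i, Set.range (y i)) := hU ▸ trivial
  induction hx using Algebra.adjoin_induction with
  | mem x hx =>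
    obtain ⟨i, b, rfl⟩ := Set.mem_iUnion.1 hx
    have h : r (y i b) = b := congr($(hr i) b)
    rw [h]
    exact sub_mem_simplexIdeal y i 0 b
  | algebraMap a => simp
  | add x x' _ _ h h' => convert add_mem h h' using 1; simp only [map_add]; ring
  | mul x x' _ _ h h' =>
    convert add_mem (Ideal.mul_mem_right x' _ h) (Ideal.mul_mem_left _ (y 0 (r x)) h') using 1
    simp only [map_mul]; ring

/-! ### Three-forms with values in `G` near the unit section -/

namespace Chart

variable {S : Scheme.{u}} {X G : Over S} [GrpObj G] {c : Chart X} {d : Chart G}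
  {C D : Type u} [CommRing C] [CommRing D] [Algebra c.R C] [Algebra c.R D]

variable (G) in
/-- The unit section of a group scheme. -/
def unitSection : Over.mk (𝟙 S) ⟶ G := (1 : (yonedaGrpObj G).obj (op (Over.mk (𝟙 S))))

theorem unitSection_left_hom : (unitSection G).left ≫ G.hom = 𝟙 S := Over.w (unitSection G)

theorem comp_unitSection (T : Over S) :
    (Over.homMk T.hom (Category.comp_id _) : T ⟶ Over.mk (𝟙 S)) ≫ unitSection G =
      (1 : (yonedaGrpObj G).obj (op T)) :=
  map_one ((yonedaGrpObj G).map (Over.homMk T.hom (Category.comp_id _) : T ⟶ Over.mk (𝟙 S)).op).hom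

variable {e : d.B →+* c.R}

/-- The unit is a section of `G → S`; so if it maps `Spec R` into the chart `d`, then `Spec R → S`
factors through the base of `d`. -/
theorem SpecMap_comp_algebraMap
    (he : Spec.map (CommRingCat.ofHom e) ≫ d.j = c.i ≫ (unitSection G).left) :
    Spec.map (CommRingCat.ofHom (e.comp (algebraMap d.R d.B))) ≫ d.i = c.i := by
  rw [CommRingCat.ofHom_comp, Spec.map_comp, Category.assoc, ← d.comm, ← Category.assoc, he, Category.assoc,
    unitSection_left_hom, Category.comp_id]

/-- The point of a group scheme given by a homomorphism from the ring of a chart. -/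
def groupPt (he : Spec.map (CommRingCat.ofHom e) ≫ d.j = c.i ≫ (unitSection G).left) (φ : d.B →+* C)
    (hφ : φ.comp (algebraMap d.R d.B) = (algebraMap c.R C).comp (e.comp (algebraMap d.R d.B))) :
    (yonedaGrpObj G).obj (op (c.aff C)) :=
  (Over.homMk (Spec.map (CommRingCat.ofHom φ) ≫ d.j) (by
    change (_ ≫ _) ≫ _ = Spec.map _ ≫ c.i
    rw [Category.assoc, d.comm, ← Category.assoc, ← Spec.map_comp, ← CommRingCat.ofHom_comp, hφ,
      CommRingCat.ofHom_comp, Spec.map_comp, Category.assoc, SpecMap_comp_algebraMap he]) : c.aff C ⟶ G)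

variable (he : Spec.map (CommRingCat.ofHom e) ≫ d.j = c.i ≫ (unitSection G).left)

theorem groupPt_one : groupPt he ((algebraMap c.R C).comp e) rfl = 1 := by
  refine Eq.trans ?_ (comp_unitSection (c.aff C))
  refine Over.OverMorphism.ext ?_
  change Spec.map _ ≫ d.j = (Spec.map _ ≫ c.i) ≫ _
  rw [CommRingCat.ofHom_comp, Spec.map_comp, Category.assoc, he, Category.assoc]

theorem groupPt_injective {φ ψ : d.B →+* C} {hφ hψ} (h : groupPt he φ hφ = groupPt he ψ hψ) : φ = ψ := by
  have := d.open_j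
  have h1 : Spec.map (CommRingCat.ofHom φ) ≫ d.j = Spec.map (CommRingCat.ofHom ψ) ≫ d.j :=
    congrArg (CommaMorphism.left (X := c.aff C) (Y := G)) h
  exact congrArg CommRingCat.Hom.hom (Spec.map_injective ((cancel_mono d.j).1 h1))

theorem res_groupPt (φ : d.B →+* C) (hφ) (g : C →ₐ[c.R] D) (ψ : d.B →+* D) (hψ)
    (h : (g : C →+* D).comp φ = ψ) : res (yonedaGrpObj G) g (groupPt he φ hφ) = groupPt he ψ hψ := by
  subst h
  refine Over.OverMorphism.ext ?_
  change Spec.map _ ≫ Spec.map _ ≫ d.j = Spec.map _ ≫ d.j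
  rw [CommRingCat.ofHom_comp, Spec.map_comp, Category.assoc]
  rfl

theorem exists_groupPt_eq (x : (yonedaGrpObj G).obj (op (c.aff C)))
    (hx : Set.range (CommaMorphism.left (X := c.aff C) (Y := G) x) ⊆ Set.range d.j) :
    ∃ φ hφ, groupPt he φ hφ = x := by
  have := d.open_j
  have := d.open_i
  let x' : c.aff C ⟶ G := x
  let l : Spec (.of C) ⟶ Spec (.of d.B) := IsOpenImmersion.lift d.j x'.left hx
  have hl : l ≫ d.j = x'.left := IsOpenImmersion.lift_fac d.j x'.left hx
  obtain ⟨φ, hφ⟩ := Spec.map_surjective l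
  have hw : x'.left ≫ G.hom = Spec.map _ ≫ c.i := Over.w x'
  refine ⟨φ.hom, ?_, ?_⟩
  · refine congrArg CommRingCat.Hom.hom (Spec.map_injective ((cancel_mono d.i).1 ?_) :
      CommRingCat.ofHom (algebraMap d.R d.B) ≫ φ = CommRingCat.ofHom (e.comp (algebraMap d.R d.B)) ≫
        CommRingCat.ofHom (algebraMap c.R C))
    rw [Spec.map_comp, Spec.map_comp, Category.assoc, Category.assoc, SpecMap_comp_algebraMap he, ← d.comm,
      ← Category.assoc, hφ, hl]
    exact hw
  · refine Over.OverMorphism.ext ?_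
    change Spec.map φ ≫ d.j = x'.left
    rw [hφ, hl]

theorem exists_SpecMap_comp_eq (d : Chart G) (hc : Set.range c.i ⊆ (unitSection G).left ⁻¹' Set.range d.j) :
    ∃ e : d.B →+* c.R, Spec.map (CommRingCat.ofHom e) ≫ d.j = c.i ≫ (unitSection G).left := by
  have := d.open_j
  have h : Set.range (c.i ≫ (unitSection G).left) ⊆ Set.range d.j := by
    rintro _ ⟨x, rfl⟩
    exact hc ⟨x, rfl⟩
  obtain ⟨φ, hφ⟩ := Spec.map_surjective (IsOpenImmersion.lift d.j (c.i ≫ (unitSection G).left) h)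
  refine ⟨φ.hom, ?_⟩
  change Spec.map φ ≫ d.j = _
  rw [hφ, IsOpenImmersion.lift_fac]

/-- Surjectivity on spectra means that the image of `x` is already that of its restriction, namely
of the unit section, which stays in the chart. -/
theorem range_left_subset
    (he : Spec.map (CommRingCat.ofHom e) ≫ d.j = c.i ≫ (unitSection G).left) (r : C →ₐ[c.R] D)
    (hr : Function.Surjective (PrimeSpectrum.comap (r : C →+* D)))
    (x : (yonedaGrpObj G).obj (op (c.aff C))) (hx : res (yonedaGrpObj G) r x = 1) :
    Set.range (CommaMorphism.left (X := c.aff C) (Y := G) x) ⊆ Set.range d.j := by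
  rintro _ ⟨p, rfl⟩
  obtain ⟨q, rfl⟩ := hr p
  have h : res (yonedaGrpObj G) r x = groupPt he ((algebraMap c.R D).comp e) rfl := hx.trans (groupPt_one he).symm
  have h1 : Spec.map (CommRingCat.ofHom r.toRingHom) ≫ CommaMorphism.left (X := c.aff C) (Y := G) x =
      Spec.map (CommRingCat.ofHom ((algebraMap c.R D).comp e)) ≫ d.j :=
    congrArg (CommaMorphism.left (X := c.aff D) (Y := G)) h
  have h2 := congr($h1 q)
  exact ⟨Spec.map (CommRingCat.ofHom ((algebraMap c.R D).comp e)) q, h2.symm⟩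

/-- Three-forms with values in a smooth group scheme are classical on charts over which the unit
section lies in a chart with free module of differentials. -/
theorem exists_represents_three (he : Spec.map (CommRingCat.ofHom e) ≫ d.j = c.i ≫ (unitSection G).left)
    [Module.Free d.B Ω[d.B⁄d.R]] [Module.Finite d.B Ω[d.B⁄d.R]] (Ω : CombForm X (yonedaGrpObj G) 3) :
    ∃ L : c.TensorForm (yonedaGrpObj G) c.R 3, Represents L.toB Ω := by
  classical
  obtain ⟨U, _, _, y, hy, hU, huniv⟩ := exists_universal_simplex (R := c.R) (B := c.B) (n := 3)
  let f : (yonedaGrpObj G).obj (op (c.aff U)) := Ω.app (fun i => c.pt (y i)) (c.inDelta hy)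
  -- By universality each degeneracy of the 3-simplex is induced by an endomorphism of `U`, along
  -- which the value of `Ω` becomes trivial.
  have hp (σ : Fin 4 → Fin 4) (i : Fin 3) (hi : σ i.castSucc = σ i.succ) : ∃ p : U →ₐ[c.R] U,
      (∀ i, p.comp (y i) = y (σ i)) ∧ res (yonedaGrpObj G) p f = 1 := by
    obtain ⟨p, hp⟩ := huniv U (fun i => y (σ i)) (hy.precomp σ)
    exact ⟨p, hp, (res_app Ω y hy p (hy.precomp σ) hp).trans
      (app_eq_one Ω (fun i => y (σ i)) (hy.precomp σ) i (congrArg y hi))⟩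
  obtain ⟨p₀, h₀, h₀f⟩ := hp ![0, 0, 2, 3] 0 rfl
  obtain ⟨p₁, h₁, h₁f⟩ := hp ![0, 1, 1, 3] 1 rfl
  obtain ⟨p₂, h₂, h₂f⟩ := hp ![0, 1, 2, 2] 2 rfl
  obtain ⟨φ, hφ, hφf⟩ : ∃ φ hφ, groupPt he φ hφ = f := by
    have hid : IsSimplex fun _ : Fin 4 => (AlgHom.id c.R c.B : c.B →+* c.B) :=
      isSimplex_of_mul_eq_zero (fun i j a b => by simp) fun i j a => by simp
    obtain ⟨r, hr⟩ := huniv c.B (fun _ => AlgHom.id c.R c.B) hid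
    refine exists_groupPt_eq he f (range_left_subset he r ?_ f ?_)
    -- `U` retracts onto the diagonal `B` with nilpotent kernel: for a 3-simplex the fourth power of
    -- the simplex ideal vanishes.
    · refine comap_surjective_of_isNilpotent _ (y 0 : c.B →+* U) fun x => ⟨4, ?_⟩
      have := Ideal.pow_mem_pow (sub_mem_simplexIdeal_of_adjoin_eq_top hU r hr x) 4
      rwa [simplexIdeal_pow y hy] at this
    · exact (res_app Ω y hy r (y' := fun _ => AlgHom.id c.R c.B) hid hr).trans (app_eq_one Ω _ hid 0 rfl)
  let ε : d.B →+* U := (algebraMap c.R U).comp e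
  have hpφ (p : U →ₐ[c.R] U) (hpf : res (yonedaGrpObj G) p f = 1) (x : d.B) : p (φ x - ε x) = 0 := by
    have h1 := res_groupPt he φ hφ p ((p : U →+* U).comp φ) (by
      rw [RingHom.comp_assoc, hφ, ← RingHom.comp_assoc, p.comp_algebraMap]) rfl
    have h2 : (p : U →+* U).comp φ = (algebraMap c.R U).comp e := groupPt_injective he
      (h1.symm.trans ((congrArg _ hφf).trans (hpf.trans (groupPt_one he).symm)))
    rw [map_sub, sub_eq_zero]
    exact congr($h2 x).trans (p.commutes (e x)).symm
  -- The functions vanishing on the three degenerate faces. They contain all `φ x - ε x`, and being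
  -- values of three-forms they have products in the sixth power of the simplex ideal, which is
  -- zero.
  let M : Ideal U := RingHom.ker p₀ ⊓ RingHom.ker p₁ ⊓ RingHom.ker p₂
  have hM (x) (hx : x ∈ M) : ∃ ω : ⋀[c.B]^3 Ω[c.B⁄c.R], evalForm y hy ω = x :=
    exists_evalForm_eq hy hU p₀ p₁ p₂ h₀ h₁ h₂ x hx.1.1 hx.1.2 hx.2
  have hM2 (a) (ha : a ∈ M) (b) (hb : b ∈ M) : a * b = 0 := by
    obtain ⟨α, rfl⟩ := hM a ha
    obtain ⟨β, rfl⟩ := hM b hb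
    exact mul_eq_zero_of_mem_simplexIdeal_pow y (k := 3) (l := 3) (by norm_num)
      (evalForm_mem_simplexIdeal y hy id α) (evalForm_mem_simplexIdeal y hy id β) hy
  let κ := Module.Free.ChooseBasisIndex d.B Ω[d.B⁄d.R]
  let b : Module.Basis κ d.B Ω[d.B⁄d.R] := Module.Free.chooseBasis d.B Ω[d.B⁄d.R]
  obtain ⟨m, hmM, hm⟩ := exists_expansion b ε φ (fun r => congr($hφ r)) M
    (fun x => ⟨⟨hpφ p₀ h₀f x, hpφ p₁ h₁f x⟩, hpφ p₂ h₂f x⟩) hM2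
  have hmm (k l) : m k * m l = 0 := hM2 _ (hmM k) _ (hmM l)
  choose ω hω using fun k => hM (m k) (hmM k)
  let D : Derivation d.R d.B Ω[d.B⁄d.R] := KaehlerDifferential.D d.R d.B
  -- The first-order neighbourhood of the unit section. It involves only `e` and the basis `b`, not
  -- `X`, which is why the resulting `Z k` are defined over `R`.
  let ψ : d.B →+* TrivSqZeroExt c.R (κ → c.R) :=
    { toFun x := TrivSqZeroExt.inl (e x) + TrivSqZeroExt.inr fun k => e (b.equivFun (D x) k)
      map_one' := by ext <;> simp
      map_zero' := by ext <;> simp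
      map_add' x x' := by ext <;> simp
      map_mul' x x' := by ext <;> simp }
  have hψ : ψ.comp (algebraMap d.R d.B) = (algebraMap c.R _).comp (e.comp (algebraMap d.R d.B)) := by
    ext r <;> simp [ψ, TrivSqZeroExt.algebraMap_eq_inl']
  obtain ⟨Z, hZ⟩ := exists_eq_prod_lieEval (yonedaGrpObj_isSeparatedPresheaf G) (c := c) (A := c.R) (κ := κ)
    (groupPt he ψ hψ) ((res_groupPt he ψ hψ (TrivSqZeroExt.fstHom c.R c.R (κ → c.R)) _ rfl (by
      ext x; simp [ψ])).trans (groupPt_one he))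
  refine ⟨Finset.univ.toList.map fun k => (Z k, ω k), ?_⟩
  intro C _ _ z hz
  obtain ⟨g, hg⟩ := huniv C z hz
  rw [TensorForm.eval_toB, List.map_map]
  -- Sending `εₖ` to `m k` turns `ψ` into `φ`, so `f` is a specialization of the point given by `ψ`;
  -- the parameter `m k` is the value of `ω k`.
  let θ := multiDualLift (R := c.R) (Algebra.ofId c.R U) m hmm
  have hθ : res (yonedaGrpObj G) θ (groupPt he ψ hψ) = f := by
    refine (res_groupPt he ψ hψ θ φ hφ ?_).trans hφf
    ext x
    refine Eq.trans ?_ (hm x).symm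
    exact (map_add θ _ _).trans (congrArg₂ _ (multiDualLift_inl (Algebra.ofId c.R U) m hmm _)
      (multiDualLift_inr (Algebra.ofId c.R U) m hmm _))
  refine (res_app Ω y hy g hz hg).symm.trans ((congrArg _ hθ.symm).trans ((res_res θ g _).trans
    ((congrArg _ hZ).trans ((map_list_prod _ _).trans ?_))))
  rw [List.map_map]
  refine congrArg List.prod (List.map_congr_left fun k _ => ?_)
  refine (res_lieEval _ _ _ _ _).trans ?_
  refine lieEval_congr _ (Subsingleton.elim _ _) ?_ _
  refine (congrArg g (multiDualLift_eps (Algebra.ofId c.R U) m hmm k)).trans ?_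
  rw [← hω]
  exact map_evalForm hy hz g hg (ω k)

/-- Combinatorial forms are locally classical. -/
theorem exists_represents [Smooth X.hom] [Smooth G.hom] (Ω : CombForm X (yonedaGrpObj G) 3)
    (χ : CombForm X (autPresheaf (yonedaGrpObj G)) 1) (p : X.left) :
    ∃ (c : Chart X) (L : c.TensorForm (yonedaGrpObj G) c.R 3)
      (K : c.TensorForm (autPresheaf (yonedaGrpObj G)) c.B 1),
      p ∈ Set.range c.j ∧ Represents L.toB Ω ∧ Represents K χ := by
  obtain ⟨d, hd, -, _, _⟩ := exists_chart G ((unitSection G).left (X.hom p)) ⊤ trivial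
  have := d.open_j
  -- The base of the chart of `X` is chosen so small that the unit section maps it into the chart
  -- `d` of `G`.
  obtain ⟨c, hp, hc, _, _⟩ := exists_chart X p ((unitSection G).left ⁻¹ᵁ d.j.opensRange) hd
  obtain ⟨e, he⟩ := exists_SpecMap_comp_eq d hc
  obtain ⟨L, hL⟩ := exists_represents_three he Ω
  obtain ⟨K, hK⟩ := exists_represents_one (c := c) (autPresheaf_yonedaGrpObj_isSeparatedPresheaf G) χ
  exact ⟨c, L, K, hp, hL, hK⟩

end Chart

end

end CombForms

theorem theorem3p13 {S : Scheme.{u}} (X G : Over S) [GrpObj G] [Smooth X.hom] [Smooth G.hom]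
    (Ω : CombForms.CombForm X (yonedaGrpObj G) 3)
    (χ : CombForms.CombForm X (CombForms.autPresheaf (yonedaGrpObj G)) 1) :
    -- near each point of `X`, the combinatorial forms `Ω` and `χ` correspond to classical forms
    (∀ p : X.left, ∃ (c : CombForms.Chart X) (L : c.TensorForm (yonedaGrpObj G) c.R 3)
      (K : c.TensorForm (CombForms.autPresheaf (yonedaGrpObj G)) c.B 1),
      p ∈ Set.range c.j ∧ CombForms.Chart.Represents L.toB Ω ∧ CombForms.Chart.Represents K χ) ∧
    -- the bracket `Lie(Aut G) × Lie(G) → Lie(G)` is well defined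
    (∀ (c : CombForms.Chart X)
      (Y : c.lie c.B (CombForms.autPresheaf (yonedaGrpObj G))) (Z : c.lie c.B (yonedaGrpObj G)),
      ∃! W : c.lie c.B (yonedaGrpObj G), CombForms.Chart.IsLieBracket Y Z W) ∧
    -- in terms of such classical forms, `δ³_χ(Ω) = dΩ + [χ, Ω]`
    (∀ (c : CombForms.Chart X)
      (br : c.lie c.B (CombForms.autPresheaf (yonedaGrpObj G)) → c.lie c.B (yonedaGrpObj G) →
        c.lie c.B (yonedaGrpObj G))
      (_ : ∀ Y Z, CombForms.Chart.IsLieBracket Y Z (br Y Z))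
      (L : c.TensorForm (yonedaGrpObj G) c.R 3)
      (K : c.TensorForm (CombForms.autPresheaf (yonedaGrpObj G)) c.B 1)
      (_ : CombForms.Chart.Represents L.toB Ω) (_ : CombForms.Chart.Represents K χ),
      CombForms.Chart.Represents (n := 4) (L.d.toB ++ CombForms.Chart.TensorForm.bracket br K L.toB)
        (CombForms.CombForm.delta χ Ω)) := by
  refine ⟨CombForms.Chart.exists_represents Ω χ, fun c => CombForms.Chart.existsUnique_isLieBracket G,
    fun c br hbr L K => CombForms.Chart.represents_delta
      (CombForms.yonedaGrpObj_isSeparatedPresheaf G) Ω χ br hbr L K⟩
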